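/- **Setting.** For each $n$ let $p=p_n$ and let $(Y_i,A_i,L_i)$, $i=1,\dots,n$, be i.i.d. with law $P_n$, where $Y$ is real, $A\in\{0,1\}$, $L\in\mathbb R^p$. Let $g$ be the identity link, with $H(\psi)=Y-\psi A$, or the log link, with $H(\psi)=Y e^{-\psi A}$. Model $\mathcal M$: $g\{E(Y|A=a,L)\}-g\{E(Y|A=0,L)\}=\psi_0a$ (for the log link the conditional means are positive). Exposure model $\mathcal A$: $E(A|L)=\pi(L;\gamma_0)$ with $\pi(L;\gamma)=\mathrm{expit}(\gamma^TL)$. Outcome model $\mathcal B$: $E(Y|A=0,L)=m(L;\beta_0)$, where $m(L;\beta)$ is a known function, linear in $\beta\in\mathbb R^p$. The parameters $\psi_0,\gamma_0,\beta_0$ and the function $m$ may depend on $n$; in all cases $\beta_0$ solves $E[w(L;\gamma_0)\{H(\psi_0)-m(L;\beta_0)\}L]=0$, where $w=\pi(1-\pi)$. Put $s_\gamma=|\mathrm{supp}\,\gamma_0|$, $s_\beta=|\mathrm{supp}\,\beta_0|$, $s^*=s_\gamma\vee s_\beta$, and write $\mathbb E_n$ for the sample mean. **Procedure.** With penalties $\lambda_\gamma,\lambda_\beta>0$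 of order $O(\sqrt{\log(p\vee n)/n})$, let $$\hat\gamma\in\arg\min_\gamma \mathbb E_n\big[\log\{1+\exp(\gamma^TL_i)\}-A_i\gamma^TL_i\big]+\lambda_\gamma\|\gamma\|_1,$$ and for every $\psi$ let $\hat\beta(\psi)$ be a limit as $\delta\to1+$ of solutions $\beta$ of $$0=-\mathbb E_n\big[w(L_i;\hat\gamma)\{H_i(\psi)-m(L_i;\beta)\}L_i\big]+\lambda_\beta\delta|\beta|^{\delta-1}\circ\mathrm{sign}(\beta).$$ With $U_i(\psi,(\gamma,\beta))=\{A_i-\pi(L_i;\gamma)\}\{H_i(\psi)-m(L_i;\beta)\}$ and $\hat\eta(\psi)=(\hat\gamma,\hat\beta(\psi))$, let $\hat V(\psi)$ be the empirical variance of the $U_i\{\psi,\hat\eta(\psi)\}$, let $\chi^2_1(\alpha)$ be the upper $\alpha$-critical value of $\chi^2_1$, $0<\alpha<1$, and let $[\hat l_s,\hat u_s]$ denote the set $$\Big\{\psi:\big(\mathbb E_n[U_i\{\psi,\hat\eta(\psi)\}]\big)^2-\tfrac{\chi^2_1(\alpha)}{n}\hat V(\psi)\le 0\Big\}.$$ **Conditions.**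 For each $n$ let $\mathcal P'_n$ be a non-empty class of laws (with their parameters) that obey the union model $\mathcal M\cap(\mathcal A\cup\mathcal B)$. Suppose that along every sequence $P_n\in\mathcal P'_n$: 1. for some constants $0<c<C<\infty$ and $r>4$: with $P_n$-probability tending to one, for all $i\le n$, $E[\{H(\psi_0)-m(L;\beta_0)\}^4|A,L]<C$, $E[\{A-\pi(L;\gamma_0)\}^2|L]>c$ and $E[\{H(\psi_0)-m(L;\beta_0)\}^2|A,L]>c$ at $(A,L)=(A_i,L_i)$; and $E|H(\psi_0)-m(L;\beta_0)|^r<C$; 2. $\big\|n^{-1/2}\sum_i\{A_i-\pi(L_i;\gamma_0)\}\,\partial m(L_i;\beta_0)/\partial\beta\big\|_\infty=O_{P_n}(\sqrt{\log(p\vee n)})$; 3. $\|\hat\gamma-\gamma_0\|_1=O_{P_n}(s_\gamma\sqrt{\log(p\vee n)/n})$, $\|\hat\gamma-\gamma_0\|_2=O_{P_n}(\sqrt{s_\gamma\log(p\vee n)/n})$, $\|\hat\beta(\psi_0)-\beta_0\|_1=O_{P_n}(s^*\sqrt{\log(p\vee n)/n})$, $\|\hat\beta(\psi_0)-\beta_0\|_2=O_{P_n}(\sqrt{s^*\log(p\vee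 n)/n})$; 4. $\mathbb E_n[\{\pi(L_i;\gamma_0)-\pi(L_i;\hat\gamma)\}^2]=O_{P_n}(s_\gamma\log(p\vee n)/n)$ and $\mathbb E_n[\{m(L_i;\beta_0)-m(L_i;\hat\beta(\psi_0))\}^2]=O_{P_n}(s^*\log(p\vee n)/n)$; 5. $(s_\gamma^2+s_\beta^2)\log^2(p\vee n)=o(n)$. **Conclusion.** Then $[\hat l_s,\hat u_s]$ is uniformly valid over the union model, i.e. uniformly doubly robust: $$\lim_{n\to\infty}\ \sup_{P_n\in\mathcal P'_n}\Big|\mathbb P_{P_n}\big(\psi_0\in[\hat l_s,\hat u_s]\big)-(1-\alpha)\Big|=0 .$$ -/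

import Mathlib

open MeasureTheory ProbabilityTheory Filter Topology

noncomputable section

namespace UDR

/-- One observation `(Y, A, L)`: outcome, exposure and covariate vector `L ∈ ℝᵖ`. -/
abbrev Obs (p : ℕ) : Type := ℝ × ℝ × (Fin p → ℝ)

/-- The outcome `Y`. -/
abbrev outcome {p : ℕ} (z : Obs p) : ℝ := z.1

/-- The exposure `A`. -/
abbrev exposure {p : ℕ} (z : Obs p) : ℝ := z.2.1

/-- The covariate vector `L`. -/
abbrev covar {p : ℕ} (z : Obs p) : Fin p → ℝ := z.2.2

/-- The σ-algebra generated by `(A, L)`. -/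
abbrev sigmaAL (p : ℕ) : MeasurableSpace (Obs p) :=
  MeasurableSpace.comap (fun z : Obs p => (exposure z, covar z)) inferInstance

/-- The σ-algebra generated by `L`. -/
abbrev sigmaL (p : ℕ) : MeasurableSpace (Obs p) :=
  MeasurableSpace.comap (fun z : Obs p => covar z) inferInstance

/-- A law of one observation, together with the values `ψ₀`, `γ₀`, `β₀` of the target parameter
and of the two nuisance parameters. (When the exposure model is misspecified, `γ₀` is whatever value the
estimator of `γ` converges to, in the sense of the assumptions below.) -/
structure DGP (p : ℕ) where
  law : Measure (Obs p)
  isProb : IsProbabilityMeasure law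
  ψ₀ : ℝ
  γ₀ : Fin p → ℝ
  β₀ : Fin p → ℝ

instance {p : ℕ} (Q : DGP p) : IsProbabilityMeasure Q.law := Q.isProb

/-- The joint law of `n` independent observations with law `Q.law`. -/
def DGP.sample {p : ℕ} (Q : DGP p) (n : ℕ) : Measure (Fin n → Obs p) :=
  Measure.pi (fun _ : Fin n => Q.law)

/-! ### Working models, links, scores -/

/-- The two link functions under consideration. -/
inductive Link where
  | identity
  | log

/-- The link function `g`. -/
def Link.g : Link → ℝ → ℝ
  | .identity, x => x
  | .log, x => Real.log x

/-- The domain of the link function: all reals, or the positive reals for the log link. -/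
def Link.dom : Link → Set ℝ
  | .identity => Set.univ
  | .log => Set.Ioi 0

/-- The transformed outcome `H(ψ)`: `Y - ψ A` for the identity link, `Y exp(-ψ A)` for the log
link. -/
def H {p : ℕ} : Link → ℝ → Obs p → ℝ
  | .identity, ψ, z => outcome z - ψ * exposure z
  | .log, ψ, z => outcome z * Real.exp (-(ψ * exposure z))

/-- The logistic exposure model `π(l; γ) = expit(γᵀ l)`. -/
def propensity {p : ℕ} (l γ : Fin p → ℝ) : ℝ := Real.sigmoid (γ ⬝ᵥ l)

/-- The weight `w(l; γ) = expit(γᵀ l) {1 - expit(γᵀ l)}`. -/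
def weight {p : ℕ} (l γ : Fin p → ℝ) : ℝ := propensity l γ * (1 - propensity l γ)

/-- The residual `H(ψ) - m(L; β)` of the outcome working model. -/
def resid {p : ℕ} (g : Link) (m : (Fin p → ℝ) → (Fin p → ℝ) → ℝ) (ψ : ℝ) (β : Fin p → ℝ)
    (z : Obs p) : ℝ :=
  H g ψ z - m (covar z) β

/-- The score `U(ψ, η) = {A - π(L; γ)} {H(ψ) - m(L; β)}`, `η = (γ, β)`. -/
def score {p : ℕ} (g : Link) (m : (Fin p → ℝ) → (Fin p → ℝ) → ℝ) (ψ : ℝ) (γ β : Fin p → ℝ)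
    (z : Obs p) : ℝ :=
  (exposure z - propensity (covar z) γ) * resid g m ψ β z

/-- The gradient `d(l; β) = ∂ m(l; β) / ∂ β`. -/
def gradM {p : ℕ} (m : (Fin p → ℝ) → (Fin p → ℝ) → ℝ) (l β : Fin p → ℝ) : Fin p → ℝ :=
  fun j => fderiv ℝ (m l) β (Pi.single j 1)

/-! ### Estimators -/

/-- The sample mean `𝔼ₙ[x] = n⁻¹ ∑ᵢ xᵢ`. -/
def sampleMean {n : ℕ} (x : Fin n → ℝ) : ℝ := (1 / (n : ℝ)) * ∑ i, x i

/-- The empirical variance `n⁻¹ ∑ᵢ (xᵢ - x̄)²`. -/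
def sampleVar {n : ℕ} (x : Fin n → ℝ) : ℝ := sampleMean (fun i => (x i - sampleMean x) ^ 2)

/-- The `ℓ₁` norm. -/
def norm1 {p : ℕ} (v : Fin p → ℝ) : ℝ := ∑ j, |v j|

/-- The `ℓ₂` norm. -/
def norm2 {p : ℕ} (v : Fin p → ℝ) : ℝ := Real.sqrt (∑ j, v j ^ 2)

/-- The size of the support of a vector. -/
def sparsity {p : ℕ} (v : Fin p → ℝ) : ℕ := {j : Fin p | v j ≠ 0}.ncard

/-- The objective function of the logistic Lasso; `x i = (Aᵢ, Lᵢ)`. -/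
def lassoObjective {n p : ℕ} (lam : ℝ) (x : Fin n → ℝ × (Fin p → ℝ)) (γ : Fin p → ℝ) : ℝ :=
  sampleMean (fun i => Real.log (1 + Real.exp (γ ⬝ᵥ (x i).2)) - (x i).1 * (γ ⬝ᵥ (x i).2))
    + lam * norm1 γ

/-- `γ` is a logistic Lasso estimate with penalty `lam`. -/
def IsLassoEstimate {n p : ℕ} (lam : ℝ) (x : Fin n → ℝ × (Fin p → ℝ)) (γ : Fin p → ℝ) : Prop :=
  ∀ γ' : Fin p → ℝ, lassoObjective lam x γ ≤ lassoObjective lam x γ'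

/-- `β` solves the bridge-penalised estimating equations with exponent `δ`,
`0 = -n⁻¹ ∑ᵢ w(Lᵢ; γ) {Hᵢ(ψ) - m(Lᵢ; β)} Lᵢ + lam δ |β|^(δ-1) ∘ sign(β)`. -/
def SolvesBridge {n p : ℕ} (g : Link) (m : (Fin p → ℝ) → (Fin p → ℝ) → ℝ) (lam δ ψ : ℝ)
    (γ : Fin p → ℝ) (z : Fin n → Obs p) (β : Fin p → ℝ) : Prop :=
  ∀ j : Fin p,
    0 = -sampleMean (fun i => weight (covar (z i)) γ * resid g m ψ β (z i) * covar (z i) j)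
      + lam * (δ * |β j| ^ (δ - 1) * Real.sign (β j))

/-- `β` is a bridge estimate with `δ → 1+`: a limit of solutions of the bridge-penalised
estimating equations along exponents `δ` decreasing to one. -/
def IsBridgeEstimate {n p : ℕ} (g : Link) (m : (Fin p → ℝ) → (Fin p → ℝ) → ℝ) (lam ψ : ℝ)
    (γ : Fin p → ℝ) (z : Fin n → Obs p) (β : Fin p → ℝ) : Prop :=
  ∃ (δ : ℕ → ℝ) (b : ℕ → Fin p → ℝ),
    (∀ k, 1 < δ k) ∧ Tendsto δ atTop (𝓝 1) ∧
    (∀ k, SolvesBridge g m lam (δ k) ψ γ z (b k)) ∧ Tendsto b atTop (𝓝 β)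

/-- The score-test confidence set (written `[l̂, û]`) with critical value `q`:
all `ψ` with `(n⁻¹ ∑ᵢ Uᵢ{ψ, η̂(ψ)})² - (q / n) V̂ ≤ 0`, where `V̂` is the empirical variance of the
`Uᵢ{ψ, η̂(ψ)}` and `η̂(ψ) = (γ, β ψ)`. -/
def confSet {n p : ℕ} (g : Link) (m : (Fin p → ℝ) → (Fin p → ℝ) → ℝ) (q : ℝ)
    (γ : Fin p → ℝ) (β : ℝ → Fin p → ℝ) (z : Fin n → Obs p) : Set ℝ :=
  {ψ : ℝ | sampleMean (fun i => score g m ψ γ (β ψ) (z i)) ^ 2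
      - q / n * sampleVar (fun i => score g m ψ γ (β ψ) (z i)) ≤ 0}

/-- The chi-squared distribution with one degree of freedom. -/
def chiSq1 : Measure ℝ := (gaussianReal 0 1).map (fun x => x ^ 2)

/-- `q` is the critical value `χ²₁(α)` at level `α`. -/
def IsCriticalValue (α q : ℝ) : Prop := chiSq1 (Set.Ioi q) = ENNReal.ofReal α

/-! ### Models -/

/-- `μ a l` is a version of the regression function `E(Y | A = a, L = l)`. -/
def IsRegression {p : ℕ} (Q : DGP p) (μ : ℝ → (Fin p → ℝ) → ℝ) : Prop :=
  Measurable (Function.uncurry μ) ∧ Integrable (fun z : Obs p => outcome z) Q.law ∧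
    Q.law[(fun z : Obs p => outcome z) | sigmaAL p]
      =ᵐ[Q.law] fun z => μ (exposure z) (covar z)

/-- Model `𝓜`: `g{E(Y | A = a, L)} - g{E(Y | A = 0, L)} = ψ₀ a`, for a binary exposure. -/
def ModelM {p : ℕ} (g : Link) (Q : DGP p) (μ : ℝ → (Fin p → ℝ) → ℝ) : Prop :=
  IsRegression Q μ ∧
    ∀ᵐ z ∂Q.law, ∀ a ∈ ({0, 1} : Set ℝ), μ a (covar z) ∈ g.dom ∧
      g.g (μ a (covar z)) - g.g (μ 0 (covar z)) = Q.ψ₀ * a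

/-- Model `𝓐`: `E(A | L) = π(L; γ₀)`. -/
def ModelA {p : ℕ} (Q : DGP p) : Prop :=
  Q.law[(fun z : Obs p => exposure z) | sigmaL p]
    =ᵐ[Q.law] fun z => propensity (covar z) Q.γ₀

/-- Model `𝓑`: `E(Y | A = 0, L) = m(L; β₀)`. -/
def ModelB {p : ℕ} (m : (Fin p → ℝ) → (Fin p → ℝ) → ℝ) (Q : DGP p)
    (μ : ℝ → (Fin p → ℝ) → ℝ) : Prop :=
  ∀ᵐ z ∂Q.law, μ 0 (covar z) = m (covar z) Q.β₀

/-- The union model `𝓜 ∩ (𝓐 ∪ 𝓑)`. -/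
def UnionModel {p : ℕ} (g : Link) (m : (Fin p → ℝ) → (Fin p → ℝ) → ℝ) (Q : DGP p) : Prop :=
  ∃ μ : ℝ → (Fin p → ℝ) → ℝ, ModelM g Q μ ∧ (ModelA Q ∨ ModelB m Q μ)

/-- The exposure is binary. -/
def BinaryExposure {p : ℕ} (Q : DGP p) : Prop :=
  ∀ᵐ z ∂Q.law, exposure z = 0 ∨ exposure z = 1

/-- `β₀` solves the unpenalised population estimating equations
`E[w(L; γ₀) {H(ψ₀) - m(L; β₀)} L] = 0`. -/
def PopulationBeta {p : ℕ} (g : Link) (m : (Fin p → ℝ) → (Fin p → ℝ) → ℝ) (Q : DGP p) : Prop :=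
  ∀ j : Fin p,
    Integrable (fun z => weight (covar z) Q.γ₀ * resid g m Q.ψ₀ Q.β₀ z * covar z j) Q.law ∧
    ∫ z, weight (covar z) Q.γ₀ * resid g m Q.ψ₀ Q.β₀ z * covar z j ∂Q.law = 0

/-! ### Assumptions along a sequence of laws -/

/-- `Xₙ = O_{Pₙ}(rₙ)`. -/
def IsBigOP {Ω : ℕ → Type*} [∀ n, MeasurableSpace (Ω n)] (P : ∀ n, Measure (Ω n))
    (X : ∀ n, Ω n → ℝ) (r : ℕ → ℝ) : Prop :=
  ∀ ε : ℝ, 0 < ε → ∃ K : ℝ, ∀ᶠ n in atTop, P n {ω | K * r n < |X n ω|} ≤ ENNReal.ofReal ε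

/-- The events `Eₙ` have `Pₙ`-probability approaching one. -/
def WithProbApproachingOne {Ω : ℕ → Type*} [∀ n, MeasurableSpace (Ω n)] (P : ∀ n, Measure (Ω n))
    (E : ∀ n, Set (Ω n)) : Prop :=
  Tendsto (fun n => P n (E n)) atTop (𝓝 1)

/-- `log (p ∨ n)`. -/
def logDim (p : ℕ → ℕ) (n : ℕ) : ℝ := Real.log ((max (p n) n : ℕ) : ℝ)

section Assumptions

variable {p : ℕ → ℕ}

/-- Moment conditions. The conditional moments are evaluated at the `n` sampled observations. -/
def MomentConditions (g : Link) (m : ∀ n, (Fin (p n) → ℝ) → (Fin (p n) → ℝ) → ℝ)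
    (Q : ∀ n, DGP (p n)) : Prop :=
  ∃ c C r : ℝ, 0 < c ∧ c < C ∧ 4 < r ∧
    WithProbApproachingOne (fun n => (Q n).sample n) (fun n => {z | ∀ i,
      ((Q n).law[fun y => resid g (m n) (Q n).ψ₀ (Q n).β₀ y ^ 4 | sigmaAL (p n)]) (z i) < C}) ∧
    (∀ n, Integrable (fun y => |resid g (m n) (Q n).ψ₀ (Q n).β₀ y| ^ r) (Q n).law ∧
      ∫ y, |resid g (m n) (Q n).ψ₀ (Q n).β₀ y| ^ r ∂(Q n).law < C) ∧
    WithProbApproachingOne (fun n => (Q n).sample n) (fun n => {z | ∀ i,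
      c < ((Q n).law[fun y => (exposure y - propensity (covar y) (Q n).γ₀) ^ 2
        | sigmaL (p n)]) (z i)}) ∧
    WithProbApproachingOne (fun n => (Q n).sample n) (fun n => {z | ∀ i,
      c < ((Q n).law[fun y => resid g (m n) (Q n).ψ₀ (Q n).β₀ y ^ 2 | sigmaAL (p n)]) (z i)})

/-- Concentration bound; the norm on `Fin (p n) → ℝ` is the sup norm. -/
def ConcentrationBound (m : ∀ n, (Fin (p n) → ℝ) → (Fin (p n) → ℝ) → ℝ)
    (Q : ∀ n, DGP (p n)) : Prop :=
  IsBigOP (fun n => (Q n).sample n)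
    (fun n z => ‖(1 / Real.sqrt n) • ∑ i : Fin n,
      (exposure (z i) - propensity (covar (z i)) (Q n).γ₀) •
        gradM (m n) (covar (z i)) (Q n).β₀‖)
    (fun n => Real.sqrt (logDim p n))

/-- `s* = s_γ ∨ s_β`. -/
def maxSparsity {p : ℕ} (Q : DGP p) : ℕ := max (sparsity Q.γ₀) (sparsity Q.β₀)

/-- Rates of convergence of the parameter estimates. -/
def EstimationRates (γhat : ∀ n, (Fin n → ℝ × (Fin (p n) → ℝ)) → Fin (p n) → ℝ)
    (βhat : ∀ n, ℝ → (Fin n → Obs (p n)) → Fin (p n) → ℝ) (Q : ∀ n, DGP (p n)) : Prop :=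
  IsBigOP (fun n => (Q n).sample n)
    (fun n z => norm1 (γhat n (fun i => (exposure (z i), covar (z i))) - (Q n).γ₀))
    (fun n => sparsity (Q n).γ₀ * Real.sqrt (logDim p n / n)) ∧
  IsBigOP (fun n => (Q n).sample n)
    (fun n z => norm2 (γhat n (fun i => (exposure (z i), covar (z i))) - (Q n).γ₀))
    (fun n => Real.sqrt (sparsity (Q n).γ₀ * logDim p n / n)) ∧
  IsBigOP (fun n => (Q n).sample n)
    (fun n z => norm1 (βhat n (Q n).ψ₀ z - (Q n).β₀))
    (fun n => maxSparsity (Q n) * Real.sqrt (logDim p n / n)) ∧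
  IsBigOP (fun n => (Q n).sample n)
    (fun n z => norm2 (βhat n (Q n).ψ₀ z - (Q n).β₀))
    (fun n => Real.sqrt (maxSparsity (Q n) * logDim p n / n))

/-- Rates of convergence of the predictions. -/
def PredictionRates (m : ∀ n, (Fin (p n) → ℝ) → (Fin (p n) → ℝ) → ℝ)
    (γhat : ∀ n, (Fin n → ℝ × (Fin (p n) → ℝ)) → Fin (p n) → ℝ)
    (βhat : ∀ n, ℝ → (Fin n → Obs (p n)) → Fin (p n) → ℝ) (Q : ∀ n, DGP (p n)) : Prop :=
  IsBigOP (fun n => (Q n).sample n)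
    (fun n z => sampleMean (fun i => (propensity (covar (z i)) (Q n).γ₀
      - propensity (covar (z i)) (γhat n (fun i => (exposure (z i), covar (z i))))) ^ 2))
    (fun n => sparsity (Q n).γ₀ * logDim p n / n) ∧
  IsBigOP (fun n => (Q n).sample n)
    (fun n z => sampleMean (fun i => (m n (covar (z i)) (Q n).β₀
      - m n (covar (z i)) (βhat n (Q n).ψ₀ z)) ^ 2))
    (fun n => maxSparsity (Q n) * logDim p n / n)

/-- Ultra-sparsity: `(s_γ² + s_β²) log² (p ∨ n) = o(n)`. -/
def UltraSparse (Q : ∀ n, DGP (p n)) : Prop :=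
  (fun n => ((sparsity (Q n).γ₀ : ℝ) ^ 2 + (sparsity (Q n).β₀ : ℝ) ^ 2) * logDim p n ^ 2)
    =o[atTop] (fun n : ℕ => (n : ℝ))

end Assumptions

end UDR

end

/-!
Along a sequence of laws `Qₙ` in the classes, write `Uᵢ = aᵢ εᵢ` for the score at the true parameters,
with `aᵢ = Aᵢ - π(Lᵢ; γ₀)` and `εᵢ = Hᵢ(ψ₀) - m(Lᵢ; β₀)`, and let `dᵢ = π(Lᵢ; γ₀) - π(Lᵢ; γ̂)` and
`eᵢ = m(Lᵢ; β₀) - m(Lᵢ; β̂)` be the prediction errors. The estimated score is `(aᵢ + dᵢ)(εᵢ + eᵢ)`,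
so that the error made by estimating the nuisance parameters is `dᵢ εᵢ + aᵢ eᵢ + dᵢ eᵢ`. Each of the
three terms contributes `o_P(1)` to the score normalized by `√n`.

* `dᵢ eᵢ`: by Cauchy–Schwarz, the prediction rates and ultra-sparsity.
* `aᵢ eᵢ`: the outcome model is linear, so this is an inner product of `β₀ - β̂` with the exposure
  residuals averaged against the gradient; Hölder's inequality applies
  (`abs_sqrt_mul_sampleMean_outcome_error_le`).
* `dᵢ εᵢ` (`isLittleOP_exposure_error_term`): under the outcome model the `εᵢ` are centred given the
  design `(Aᵢ, Lᵢ)`, and `dᵢ` depends on the design only, so the conditional variance is of the order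
  of the mean of `dᵢ²`. Under the exposure model, linearize `π` at `γ̂`: the linear part is controlled
  by the estimating equations for `β̂`, which bound its empirical covariance with the residuals by the
  penalty (`IsBridgeEstimate.abs_sampleMean_le`), and the remainder is at most `c⁻¹ dᵢ²`
  (`abs_sigmoid_linearization_le`), whose product with `|εᵢ|` is again handled conditionally on the
  design. Which working model holds may change with `n`.

The score at the true parameters has mean zero if either working model holds
(`integral_score_eq_zero`), its variance is bounded away from zero, and its fourth moment is bounded,
so Lyapunov's theorem applies (`tendsto_map_inv_sqrt_mul_sum_gaussian`). The empirical variance is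
consistent (`isLittleOP_sampleVar_score_sub`), and Slutsky's lemma (`tendsto_measure_sq_le_mul`) gives
coverage `1 - α` along every sequence (`tendsto_coverage`). Uniformity follows by applying this to laws
that nearly attain the suprema.
-/

namespace UDR

/-! ### A central limit theorem for triangular arrays -/

/-- Second-order Taylor bound for the complex exponential along the imaginary axis, valid for
all real arguments. -/
theorem norm_exp_mul_I_sub_taylor_le (x : ℝ) :
    ‖Complex.exp (x * Complex.I) - (1 + x * Complex.I - (x : ℂ) ^ 2 / 2)‖ ≤ 4 * |x| ^ 3 := by
  rcases le_or_gt |x| 1 with hx | hx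
  · have h := Complex.exp_bound (x := x * Complex.I) (n := 3) (by simpa using hx) (by norm_num)
    have e : ∑ k ∈ Finset.range 3, (x * Complex.I) ^ k / (k.factorial : ℂ)
        = 1 + x * Complex.I - (x : ℂ) ^ 2 / 2 := by
      simp [Finset.sum_range_succ, mul_pow]; ring
    rw [e] at h
    refine h.trans ?_
    have : (0 : ℝ) ≤ |x| ^ 3 := by positivity
    simp [Nat.factorial]
    nlinarith
  · have h1 : ‖Complex.exp (x * Complex.I)‖ = 1 := Complex.norm_exp_ofReal_mul_I x
    have h2 : ‖(1 + x * Complex.I - (x : ℂ) ^ 2 / 2)‖ ≤ 1 + |x| + |x| ^ 2 / 2 := by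
      refine (norm_sub_le _ _).trans ?_
      refine add_le_add ((norm_add_le _ _).trans ?_) ?_ <;> simp
    refine (norm_sub_le _ _).trans ?_
    rw [h1]
    have h3 : |x| ^ 2 ≤ |x| ^ 3 := pow_le_pow_right₀ hx.le (by norm_num)
    have h4 : |x| ≤ |x| ^ 2 := by nlinarith
    linarith

theorem abs_pow_three_le (x : ℝ) : |x| ^ 3 ≤ 1 + x ^ 4 := by
  have h : x ^ 4 = |x| ^ 4 := by rw [← abs_pow, abs_of_nonneg (by positivity)]
  rw [h]
  rcases le_total |x| 1 with hx | hx
  · have := pow_le_one₀ (n := 3) (abs_nonneg x) hx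
    have : 0 ≤ |x| ^ 4 := by positivity
    linarith
  · have := pow_le_pow_right₀ hx (show 3 ≤ 4 by norm_num)
    linarith

theorem sq_le_one_add_pow_four (x : ℝ) : x ^ 2 ≤ 1 + x ^ 4 := by
  nlinarith [sq_nonneg (x ^ 2 - 1), sq_nonneg (x ^ 2)]

theorem abs_le_one_add_pow_four (x : ℝ) : |x| ≤ 1 + x ^ 4 := by
  nlinarith [sq_nonneg (|x| - 1), sq_abs x, sq_le_one_add_pow_four x, sq_nonneg (x ^ 2),
    sq_nonneg (x ^ 2 - 1)]

theorem memLp_four_of_integrable_pow {α : Type*} [MeasurableSpace α] {μ : Measure α}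
    {X : α → ℝ} (hX : AEStronglyMeasurable X μ) (h : Integrable (fun a => X a ^ 4) μ) :
    MemLp X 4 μ := by
  rw [← integrable_norm_rpow_iff hX (by norm_num) (by norm_num)]
  refine h.congr (Eventually.of_forall fun a => ?_)
  have : ((4 : ENNReal).toReal) = ((4 : ℕ) : ℝ) := by norm_num
  simp only [this, Real.rpow_natCast, Real.norm_eq_abs]
  rw [← abs_pow, abs_of_nonneg (by positivity)]

theorem norm_charFun_sub_taylor_le {α : Type*} [MeasurableSpace α] {μ : Measure α}
    [IsProbabilityMeasure μ] {X : α → ℝ} (hX : Measurable X)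
    (h4 : Integrable (fun a => X a ^ 4) μ) (h0 : ∫ a, X a ∂μ = 0) (h1 : ∫ a, X a ^ 2 ∂μ = 1)
    (s : ℝ) :
    ‖charFun (μ.map X) s - (1 - (s : ℂ) ^ 2 / 2)‖ ≤ 4 * |s| ^ 3 * (1 + ∫ a, X a ^ 4 ∂μ) := by
  have hL4 := memLp_four_of_integrable_pow hX.aestronglyMeasurable h4
  have i1 : Integrable X μ := hL4.integrable (by norm_num)
  have i2 : Integrable (fun a => X a ^ 2) μ :=
    (hL4.mono_exponent (p := 2) (by norm_num)).integrable_sq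
  have iE : Integrable (fun a => Complex.exp ((s * X a : ℝ) * Complex.I)) μ := by
    refine Integrable.of_bound (by fun_prop) 1 (Eventually.of_forall fun a => ?_)
    rw [Complex.norm_exp_ofReal_mul_I]
  have iT : Integrable (fun a => (1 + ((s * X a : ℝ) : ℂ) * Complex.I
      - ((s * X a : ℝ) : ℂ) ^ 2 / 2)) μ := by
    refine ((integrable_const _).add ((i1.const_mul s).ofReal.mul_const _)).sub ?_
    have := ((i2.const_mul (s ^ 2 / 2)).ofReal (𝕜 := ℂ))
    refine this.congr (Eventually.of_forall fun a => ?_)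
    simp; ring
  have eT : ∫ a, (1 + ((s * X a : ℝ) : ℂ) * Complex.I - ((s * X a : ℝ) : ℂ) ^ 2 / 2) ∂μ
      = 1 - (s : ℂ) ^ 2 / 2 := by
    have e : ∀ a, (1 + ((s * X a : ℝ) : ℂ) * Complex.I - ((s * X a : ℝ) : ℂ) ^ 2 / 2)
        = 1 + (s * Complex.I) * (X a : ℂ) - (s ^ 2 / 2 : ℂ) * ((X a ^ 2 : ℝ) : ℂ) := by
      intro a; push_cast; ring
    have j1 : Integrable (fun a => (s * Complex.I) * (X a : ℂ)) μ := i1.ofReal.const_mul _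
    have j2 : Integrable (fun a => (s ^ 2 / 2 : ℂ) * ((X a ^ 2 : ℝ) : ℂ)) μ :=
      i2.ofReal.const_mul _
    simp_rw [e]
    have j0 : Integrable (fun a => 1 + (s * Complex.I) * (X a : ℂ)) μ :=
      (integrable_const _).add j1
    rw [integral_sub j0 j2, integral_add (integrable_const _) j1,
      integral_const_mul, integral_const_mul, integral_complex_ofReal, integral_complex_ofReal,
      h0, h1]
    simp
  rw [charFun_apply_real, integral_map hX.aemeasurable (by fun_prop), ← eT]
  have e2 : ∀ a, Complex.exp (s * X a * Complex.I)
      = Complex.exp ((s * X a : ℝ) * Complex.I) := by intro a; push_cast; rfl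
  simp_rw [e2]
  rw [← integral_sub iE iT]
  have i3 : Integrable (fun a => 4 * |s| ^ 3 * (1 + X a ^ 4)) μ :=
    ((integrable_const _).add h4).const_mul _
  refine (norm_integral_le_of_norm_le i3 (Eventually.of_forall fun a => ?_)).trans ?_
  · refine (norm_exp_mul_I_sub_taylor_le _).trans ?_
    rw [abs_mul, mul_pow, mul_assoc]
    have := abs_pow_three_le (X a)
    gcongr
  · rw [integral_const_mul, integral_add (integrable_const _) h4]
    simp

variable {α : ℕ → Type*} [∀ n, MeasurableSpace (α n)] {μ : ∀ n, Measure (α n)}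
  [∀ n, IsProbabilityMeasure (μ n)] {X : ∀ n, α n → ℝ}

theorem charFun_map_inv_sqrt_mul_sum (hX : ∀ n, Measurable (X n)) (n : ℕ) (t : ℝ) :
    charFun ((Measure.pi fun _ : Fin n => μ n).map fun z => (√n)⁻¹ * ∑ i, X n (z i)) t
      = charFun ((μ n).map (X n)) ((√n)⁻¹ * t) ^ n := by
  have hi : iIndepFun (fun (i : Fin n) (z : Fin n → α n) => X n (z i))
      (Measure.pi fun _ : Fin n => μ n) :=
    iIndepFun_pi (X := fun _ => X n) (fun _ => (hX n).aemeasurable)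
  have hm : ∀ i : Fin n, Measurable (fun z : Fin n → α n => X n (z i)) :=
    fun i => (hX n).comp (measurable_pi_apply i)
  rw [charFun_map_mul_comp, hi.charFun_map_fun_sum_eq_prod fun i => (hm i).aemeasurable]
  · have : ∀ i : Fin n, (Measure.pi fun _ : Fin n => μ n).map (fun z => X n (z i))
        = (μ n).map (X n) := by
      intro i
      have e := (measurePreserving_eval (fun _ : Fin n => μ n) i).map_eq
      conv_rhs => rw [← e]
      rw [Measure.map_map (hX n) (measurable_pi_apply i)]
      rfl
    simp [this]
  · exact (Finset.measurable_fun_sum _ fun i _ => hm i).aemeasurable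

/-- Lyapunov's central limit theorem for triangular arrays with i.i.d. rows, standardized
entries and bounded fourth moments; the conditions are only needed eventually. -/
theorem tendsto_map_inv_sqrt_mul_sum_gaussian (hX : ∀ n, Measurable (X n)) {K : ℝ}
    (h : ∀ᶠ n in atTop, Integrable (fun a => X n a ^ 4) (μ n) ∧ ∫ a, X n a ∂μ n = 0 ∧
      ∫ a, X n a ^ 2 ∂μ n = 1 ∧ ∫ a, X n a ^ 4 ∂μ n ≤ K)
    {E : Set ℝ} (hE : gaussianReal 0 1 (frontier E) = 0) :
    Tendsto (fun n => ((Measure.pi fun _ : Fin n => μ n).map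
      fun z => (√n)⁻¹ * ∑ i, X n (z i)) E) atTop (𝓝 (gaussianReal 0 1 E)) := by
  have hm : ∀ n, Measurable (fun z : Fin n → α n => (√n)⁻¹ * ∑ i, X n (z i)) := fun n =>
    (Finset.measurable_fun_sum _ fun i _ => (hX n).comp (measurable_pi_apply i)).const_mul _
  let ν : ℕ → ProbabilityMeasure ℝ := fun n =>
    ⟨(Measure.pi fun _ : Fin n => μ n).map fun z => (√n)⁻¹ * ∑ i, X n (z i),
      Measure.isProbabilityMeasure_map (hm n).aemeasurable⟩
  let ν₀ : ProbabilityMeasure ℝ := ⟨gaussianReal 0 1, inferInstance⟩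
  suffices hν : Tendsto ν atTop (𝓝 ν₀) from
    ProbabilityMeasure.tendsto_measure_of_null_frontier_of_tendsto' hν hE
  refine ProbabilityMeasure.tendsto_iff_tendsto_charFun.2 fun t => ?_
  have e0 : charFun (ν₀ : Measure ℝ) t = Complex.exp (-(t : ℂ) ^ 2 / 2) := by
    simp [ν₀, charFun_gaussianReal, neg_div]
  have e1 : ∀ n, charFun (ν n : Measure ℝ) t = charFun ((μ n).map (X n)) ((√n)⁻¹ * t) ^ n :=
    fun n => charFun_map_inv_sqrt_mul_sum hX n t
  simp_rw [e0, e1]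
  refine Complex.tendsto_pow_exp_of_isLittleO_sub_add_div _ ?_
  have hb : (fun n : ℕ => charFun ((μ n).map (X n)) ((√n)⁻¹ * t) - (1 + (-(t : ℂ) ^ 2 / 2) / n))
      =O[atTop] fun n : ℕ => (1 / (n : ℝ)) * (√n)⁻¹ := by
    refine Asymptotics.IsBigO.of_bound (4 * |t| ^ 3 * (1 + K)) ?_
    filter_upwards [h, eventually_gt_atTop 0] with n hn hn0
    obtain ⟨i4, m0, m2, m4⟩ := hn
    have hn' : (0 : ℝ) < n := by exact_mod_cast hn0
    have hs := norm_charFun_sub_taylor_le (hX n) i4 m0 m2 ((√n)⁻¹ * t)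
    have hsq : ((√n : ℝ) : ℂ) ^ 2 = (n : ℂ) := by
      rw [← Complex.ofReal_pow, Real.sq_sqrt hn'.le]; simp
    have e : (1 - (((√n)⁻¹ * t : ℝ) : ℂ) ^ 2 / 2) = 1 + (-(t : ℂ) ^ 2 / 2) / n := by
      push_cast
      rw [mul_pow, inv_pow, hsq]; ring
    rw [e] at hs
    refine hs.trans ?_
    have e3 : |(√n)⁻¹ * t| ^ 3 = |t| ^ 3 * (1 / (n : ℝ) * (√n)⁻¹) := by
      rw [abs_mul, mul_pow, abs_of_pos (by positivity), pow_succ (√n)⁻¹ 2, inv_pow,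
        Real.sq_sqrt hn'.le]
      ring
    rw [e3, Real.norm_of_nonneg (by positivity)]
    have : 0 ≤ |t| ^ 3 * (1 / (n : ℝ) * (√n)⁻¹) := by positivity
    nlinarith
  refine hb.trans_isLittleO ?_
  have aux : (fun n : ℕ => ‖(1 / n : ℂ)‖) = fun n : ℕ => ‖(1 / n : ℝ)‖ := by simp
  rw [← Asymptotics.isLittleO_norm_right, aux, Asymptotics.isLittleO_norm_right]
  have : (fun n : ℕ => (√(n : ℝ))⁻¹) =o[atTop] fun _ : ℕ => (1 : ℝ) :=
    (Asymptotics.isLittleO_one_iff ℝ).2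
      (tendsto_inv_atTop_zero.comp (Real.tendsto_sqrt_atTop.comp tendsto_natCast_atTop_atTop))
  simpa using (Asymptotics.isBigO_refl (fun n : ℕ => 1 / (n : ℝ)) atTop).mul_isLittleO this

/-! ### Stochastic order symbols -/

section StochasticOrder

variable {Ω : ℕ → Type*} [∀ n, MeasurableSpace (Ω n)] {P : ∀ n, Measure (Ω n)}

/-- `Xₙ = o_{Pₙ}(1)`: convergence to zero in probability along a sequence of spaces. -/
def IsLittleOP (P : ∀ n, Measure (Ω n)) (X : ∀ n, Ω n → ℝ) : Prop :=
  ∀ ε : ℝ, 0 < ε → Tendsto (fun n => P n {ω | ε < |X n ω|}) atTop (𝓝 0)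

/-- The complements of the events `Eₙ` have vanishing probability. For non-measurable events this
is stronger than asking that the (outer) probability of `Eₙ` tends to one. -/
def HoldsWHP (P : ∀ n, Measure (Ω n)) (E : ∀ n, Set (Ω n)) : Prop :=
  Tendsto (fun n => P n (E n)ᶜ) atTop (𝓝 0)

theorem tendsto_measure_zero_of_le_add {u v w : ℕ → ENNReal} (h : ∀ᶠ n in atTop, u n ≤ v n + w n)
    (hv : Tendsto v atTop (𝓝 0)) (hw : Tendsto w atTop (𝓝 0)) : Tendsto u atTop (𝓝 0) := by
  have := hv.add hw
  rw [add_zero] at this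
  exact tendsto_of_tendsto_of_tendsto_of_le_of_le' tendsto_const_nhds this
    (Eventually.of_forall fun _ => zero_le) h

theorem WithProbApproachingOne.holdsWHP [∀ n, IsProbabilityMeasure (P n)] {E : ∀ n, Set (Ω n)}
    (h : WithProbApproachingOne P E) (hE : ∀ n, MeasurableSet (E n)) : HoldsWHP P E := by
  have h1 : ∀ n, P n (E n)ᶜ = 1 - P n (E n) := fun n => prob_compl_eq_one_sub (hE n)
  simp only [HoldsWHP, h1]
  have := ENNReal.Tendsto.sub (tendsto_const_nhds (x := (1 : ENNReal)) (f := atTop)) h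
    (Or.inl ENNReal.one_ne_top)
  simpa using this

theorem HoldsWHP.of_ae {E : ∀ n, Set (Ω n)} (h : ∀ n, ∀ᵐ ω ∂P n, ω ∈ E n) : HoldsWHP P E := by
  have : ∀ n, P n (E n)ᶜ = 0 := fun n => h n
  simp [HoldsWHP, this]

theorem HoldsWHP.inter {E F : ∀ n, Set (Ω n)} (hE : HoldsWHP P E) (hF : HoldsWHP P F) :
    HoldsWHP P (fun n => E n ∩ F n) := by
  refine tendsto_measure_zero_of_le_add (Eventually.of_forall fun n => ?_) hE hF
  rw [Set.compl_inter]
  exact measure_union_le _ _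

theorem IsLittleOP.mono {X Y : ∀ n, Ω n → ℝ} {E : ∀ n, Set (Ω n)} (hY : IsLittleOP P Y)
    (hE : HoldsWHP P E) (h : ∀ᶠ n in atTop, ∀ ω ∈ E n, |X n ω| ≤ |Y n ω|) : IsLittleOP P X := by
  intro ε hε
  refine tendsto_measure_zero_of_le_add (h.mono fun n hn => ?_) (hY ε hε) hE
  refine (measure_mono fun ω hω => ?_).trans (measure_union_le _ _)
  by_cases hωE : ω ∈ E n
  · exact Or.inl (lt_of_lt_of_le hω (hn ω hωE))
  · exact Or.inr hωE

theorem IsLittleOP.mono' {X Y : ∀ n, Ω n → ℝ} (hY : IsLittleOP P Y)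
    (h : ∀ᶠ n in atTop, ∀ ω, |X n ω| ≤ |Y n ω|) : IsLittleOP P X :=
  hY.mono (E := fun _ => Set.univ) (by simp [HoldsWHP]) (h.mono fun _ hn ω _ => hn ω)

theorem IsLittleOP.add {X Y : ∀ n, Ω n → ℝ} (hX : IsLittleOP P X) (hY : IsLittleOP P Y) :
    IsLittleOP P (fun n ω => X n ω + Y n ω) := by
  intro ε hε
  refine tendsto_measure_zero_of_le_add (Eventually.of_forall fun n => ?_)
    (hX (ε / 2) (by linarith)) (hY (ε / 2) (by linarith))
  refine (measure_mono fun ω hω => ?_).trans (measure_union_le _ _)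
  by_contra hc
  simp only [Set.mem_union, Set.mem_ofPred_eq, not_or, not_lt] at hc hω
  have := abs_add_le (X n ω) (Y n ω)
  linarith

theorem IsLittleOP.neg {X : ∀ n, Ω n → ℝ} (hX : IsLittleOP P X) :
    IsLittleOP P (fun n ω => - X n ω) := by
  intro ε hε
  simpa using hX ε hε

theorem IsLittleOP.sub {X Y : ∀ n, Ω n → ℝ} (hX : IsLittleOP P X) (hY : IsLittleOP P Y) :
    IsLittleOP P (fun n ω => X n ω - Y n ω) := by
  simpa [sub_eq_add_neg] using hX.add hY.neg

theorem IsLittleOP.const_mul {X : ∀ n, Ω n → ℝ} (hX : IsLittleOP P X) (c : ℝ) :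
    IsLittleOP P (fun n ω => c * X n ω) := by
  intro ε hε
  have hc : 0 < |c| + 1 := by positivity
  refine tendsto_of_tendsto_of_tendsto_of_le_of_le tendsto_const_nhds
    (hX (ε / (|c| + 1)) (by positivity)) (fun _ => zero_le) fun n => measure_mono fun ω hω => ?_
  simp only [Set.mem_ofPred_eq, abs_mul] at hω ⊢
  rw [div_lt_iff₀ hc]
  nlinarith [abs_nonneg (X n ω), abs_nonneg c]

theorem IsLittleOP.of_sq {X : ∀ n, Ω n → ℝ} (hX : IsLittleOP P (fun n ω => X n ω ^ 2)) :
    IsLittleOP P X := by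
  intro ε hε
  refine tendsto_of_tendsto_of_tendsto_of_le_of_le tendsto_const_nhds
    (hX (ε ^ 2) (by positivity)) (fun _ => zero_le) fun n => measure_mono fun ω hω => ?_
  simp only [Set.mem_ofPred_eq, abs_pow] at hω ⊢
  gcongr

theorem IsLittleOP.sq {X : ∀ n, Ω n → ℝ} (hX : IsLittleOP P X) :
    IsLittleOP P (fun n ω => X n ω ^ 2) := by
  intro ε hε
  refine tendsto_of_tendsto_of_tendsto_of_le_of_le tendsto_const_nhds
    (hX (√ε) (by positivity)) (fun _ => zero_le) fun n => measure_mono fun ω hω => ?_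
  simp only [Set.mem_ofPred_eq, abs_pow] at hω ⊢
  exact (Real.sqrt_lt' (by by_contra h; nlinarith [abs_nonneg (X n ω)])).2 hω

theorem IsBigOP.isLittleOP {X : ∀ n, Ω n → ℝ} {r : ℕ → ℝ} (hX : IsBigOP P X r)
    (hr : Tendsto r atTop (𝓝 0)) : IsLittleOP P X := by
  intro ε hε
  rw [ENNReal.tendsto_nhds_zero]
  intro δ hδ
  obtain ⟨δ', hδ'0, hδ'⟩ : ∃ δ' : ℝ, 0 < δ' ∧ ENNReal.ofReal δ' ≤ δ := by
    obtain ⟨x, hx0, hx⟩ := ENNReal.lt_iff_exists_nnreal_btwn.1 hδ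
    exact ⟨x, by simpa using hx0, by simpa using hx.le⟩
  obtain ⟨K, hK⟩ := hX δ' hδ'0
  have hKr : Tendsto (fun n => K * r n) atTop (𝓝 0) := by simpa using hr.const_mul K
  filter_upwards [hK, hKr.eventually_lt_const hε] with n hn hn2
  refine (measure_mono fun ω hω => ?_).trans (hn.trans hδ')
  exact hn2.trans hω

theorem IsBigOP.mul {X Y : ∀ n, Ω n → ℝ} {r s : ℕ → ℝ} (hX : IsBigOP P X r) (hY : IsBigOP P Y s)
    (hr : ∀ n, 0 ≤ r n) (hs : ∀ n, 0 ≤ s n) :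
    IsBigOP P (fun n ω => X n ω * Y n ω) (fun n => r n * s n) := by
  intro ε hε
  obtain ⟨K, hK⟩ := hX (ε / 2) (by linarith)
  obtain ⟨M, hM⟩ := hY (ε / 2) (by linarith)
  refine ⟨max K 0 * max M 0, ?_⟩
  filter_upwards [hK, hM] with n hKn hMn
  have : ENNReal.ofReal ε = ENNReal.ofReal (ε / 2) + ENNReal.ofReal (ε / 2) := by
    rw [← ENNReal.ofReal_add (by linarith) (by linarith)]; ring_nf
  rw [this]
  refine le_trans (le_trans (measure_mono fun ω hω => ?_) (measure_union_le _ _))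
    (add_le_add hKn hMn)
  by_contra hc
  simp only [Set.mem_union, Set.mem_ofPred_eq, not_or, not_lt, abs_mul] at hc hω
  have h1 : |X n ω| ≤ max K 0 * r n :=
    hc.1.trans (mul_le_mul_of_nonneg_right (le_max_left _ _) (hr n))
  have h2 : |Y n ω| ≤ max M 0 * s n :=
    hc.2.trans (mul_le_mul_of_nonneg_right (le_max_left _ _) (hs n))
  have h3 := mul_le_mul h1 h2 (abs_nonneg _) (mul_nonneg (le_max_right _ _) (hr n))
  nlinarith

/-- A deterministic sequence of order `O(rₙ)` is `O_{Pₙ}(rₙ)`. -/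
theorem IsBigOP.of_isBigO {u r : ℕ → ℝ} (h : u =O[atTop] r) (hr : ∀ n, 0 ≤ r n) :
    IsBigOP P (fun n _ => u n) r := by
  intro ε _
  obtain ⟨K, hK⟩ := h.bound
  refine ⟨K, hK.mono fun n hn => ?_⟩
  rw [Real.norm_eq_abs, Real.norm_of_nonneg (hr n)] at hn
  simp [not_lt.2 hn]

theorem measure_abs_gt_le {α : Type*} [MeasurableSpace α] {μ : Measure α} {X : α → ℝ}
    (hX : AEMeasurable X μ) {ε : ℝ} (hε : 0 < ε) :
    μ {a | ε < |X a|} ≤ (∫⁻ a, ENNReal.ofReal |X a| ∂μ) / ENNReal.ofReal ε := by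
  refine (measure_mono fun a (ha : ε < |X a|) => ?_).trans
    (meas_ge_le_lintegral_div (by fun_prop) (by simpa using hε) ENNReal.ofReal_ne_top)
  exact ENNReal.ofReal_le_ofReal ha.le

theorem measure_abs_gt_le_integral {α : Type*} [MeasurableSpace α] {μ : Measure α} {X : α → ℝ}
    (hX : Integrable X μ) {ε : ℝ} (hε : 0 < ε) :
    μ {a | ε < |X a|} ≤ ENNReal.ofReal ((∫ a, |X a| ∂μ) / ε) := by
  refine (measure_abs_gt_le hX.aemeasurable hε).trans ?_
  rw [ENNReal.ofReal_div_of_pos hε,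
    ofReal_integral_eq_lintegral_ofReal hX.abs (Eventually.of_forall fun a => abs_nonneg _)]

theorem IsLittleOP.of_integral {X : ∀ n, Ω n → ℝ} {u : ℕ → ℝ}
    (h : ∀ᶠ n in atTop, Integrable (X n) (P n) ∧ ∫ ω, |X n ω| ∂P n ≤ u n)
    (hu : Tendsto u atTop (𝓝 0)) : IsLittleOP P X := by
  intro ε hε
  have h2 : Tendsto (fun n => ENNReal.ofReal (u n / ε)) atTop (𝓝 0) := by
    have := ENNReal.tendsto_ofReal (hu.div_const ε)
    simpa using this
  refine tendsto_of_tendsto_of_tendsto_of_le_of_le' tendsto_const_nhds h2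
    (Eventually.of_forall fun _ => zero_le) (h.mono fun n hn => ?_)
  refine (measure_abs_gt_le_integral hn.1 hε).trans (ENNReal.ofReal_le_ofReal ?_)
  have := hn.2
  gcongr

/-- Markov's inequality: bounded first absolute moments give `O_{Pₙ}(1)`. -/
theorem IsBigOP.of_integral {X : ∀ n, Ω n → ℝ} {C : ℝ}
    (h : ∀ᶠ n in atTop, Integrable (X n) (P n) ∧ ∫ ω, |X n ω| ∂P n ≤ C) :
    IsBigOP P X (fun _ => 1) := by
  intro ε hε
  have hK : 0 < (|C| + 1) / ε := by positivity
  refine ⟨(|C| + 1) / ε, h.mono fun n hn => ?_⟩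
  rw [mul_one]
  refine (measure_abs_gt_le_integral hn.1 hK).trans (ENNReal.ofReal_le_ofReal ?_)
  rw [div_le_iff₀ hK, mul_div_cancel₀ _ hε.ne']
  linarith [le_abs_self C, hn.2]

/-- To prove `Xₙ = o_{Pₙ}(1)` it is enough to do so on the events where a variable of order
`O_{Pₙ}(rₙ)` is at most `K rₙ`, for each fixed `K`. -/
theorem IsLittleOP.of_truncate {X D : ∀ n, Ω n → ℝ} {r : ℕ → ℝ} (hD : IsBigOP P D r)
    (h : ∀ K : ℝ, IsLittleOP P (fun n ω => {ω | |D n ω| ≤ K * r n}.indicator (X n) ω)) :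
    IsLittleOP P X := by
  intro ε hε
  rw [ENNReal.tendsto_nhds_zero]
  intro δ hδ
  obtain ⟨x, hx0, hx⟩ := ENNReal.lt_iff_exists_nnreal_btwn.1 hδ
  have hx0' : 0 < (x : ℝ) / 2 := by
    have : 0 < x := by simpa using hx0
    positivity
  obtain ⟨K, hK⟩ := hD (x / 2) hx0'
  have hx2 : (0 : ENNReal) < ENNReal.ofReal (x / 2) := by simpa using hx0'
  filter_upwards [hK, (ENNReal.tendsto_nhds_zero.1 (h K ε hε)) _ hx2] with n h1 h2
  have e : (x : ENNReal) = ENNReal.ofReal (x / 2) + ENNReal.ofReal (x / 2) := by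
    rw [← ENNReal.ofReal_add hx0'.le hx0'.le]; simp
  refine le_trans ?_ hx.le
  rw [e]
  refine le_trans (le_trans (measure_mono fun ω hω => ?_) (measure_union_le _ _))
    (add_le_add h2 h1)
  by_cases hc : |D n ω| ≤ K * r n
  · left
    simpa [Set.indicator, hc] using hω
  · exact Or.inr (not_le.1 hc)

/-- Splitting a sequence according to an alternative that may change with `n`. -/
theorem IsLittleOP.of_cases (A : ℕ → Prop) [DecidablePred A] {X : ∀ n, Ω n → ℝ}
    (h1 : IsLittleOP P (fun n ω => if A n then X n ω else 0))
    (h2 : IsLittleOP P (fun n ω => if A n then 0 else X n ω)) : IsLittleOP P X := by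
  have := h1.add h2
  refine this.mono' (Eventually.of_forall fun n ω => ?_)
  split_ifs <;> simp

end StochasticOrder

/-! ### Slutsky's lemma for self-normalized sums -/

theorem gaussianReal_Icc_le (a b : ℝ) :
    (gaussianReal 0 1).real (Set.Icc a b) ≤ max (b - a) 0 := by
  have h : gaussianReal 0 1 (Set.Icc a b) ≤ ENNReal.ofReal (b - a) := by
    rw [gaussianReal_apply _ one_ne_zero, ← Real.volume_Icc]
    refine (lintegral_mono (g := fun _ => 1) fun x => ?_).trans (by simp)
    rw [gaussianPDF, ← ENNReal.ofReal_one]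
    refine ENNReal.ofReal_le_ofReal ?_
    rw [gaussianPDFReal]
    have h1 : (1 : ℝ) ≤ √(2 * Real.pi * ((1 : NNReal) : ℝ)) := by
      rw [Real.one_le_sqrt]
      have := Real.pi_gt_three
      push_cast; linarith
    have h2 : (√(2 * Real.pi * ((1 : NNReal) : ℝ)))⁻¹ ≤ 1 := inv_le_one_of_one_le₀ h1
    have h3 : Real.exp (-(x - 0) ^ 2 / (2 * ((1 : NNReal) : ℝ))) ≤ 1 := by
      rw [Real.exp_le_one_iff]
      have := sq_nonneg (x - 0)
      push_cast; linarith
    exact mul_le_one₀ h2 (Real.exp_pos _).le h3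
  refine (ENNReal.toReal_mono ENNReal.ofReal_ne_top h).trans ?_
  rw [ENNReal.toReal_ofReal']

/-- The probability that a standard Gaussian variable is at most `u` in absolute value is Lipschitz
in `u`. -/
theorem gaussianReal_Icc_neg_le (u κ : ℝ) (hκ : 0 ≤ κ) :
    (gaussianReal 0 1).real (Set.Icc (-(u + κ)) (u + κ))
      ≤ (gaussianReal 0 1).real (Set.Icc (-u) u) + 2 * κ := by
  have hsub : Set.Icc (-(u + κ)) (u + κ)
      ⊆ Set.Icc (-u) u ∪ (Set.Icc u (u + κ) ∪ Set.Icc (-(u + κ)) (-u)) := by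
    intro x hx
    simp only [Set.mem_union, Set.mem_Icc] at hx ⊢
    rcases lt_or_ge u x with h | h
    · exact Or.inr (Or.inl ⟨h.le, hx.2⟩)
    · rcases lt_or_ge x (-u) with h' | h'
      · exact Or.inr (Or.inr ⟨hx.1, h'.le⟩)
      · exact Or.inl ⟨h', h⟩
  refine (measureReal_mono hsub).trans ((measureReal_union_le _ _).trans ?_)
  refine add_le_add le_rfl ((measureReal_union_le _ _).trans ?_)
  have h1 := gaussianReal_Icc_le u (u + κ)
  have h2 := gaussianReal_Icc_le (-(u + κ)) (-u)
  have e1 : u + κ - u = κ := by ring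
  have e2 : -u - -(u + κ) = κ := by ring
  rw [e1, max_eq_left hκ] at h1
  rw [e2, max_eq_left hκ] at h2
  linarith

/-- If `Sₙ` is asymptotically standard Gaussian, `Tₙ - Sₙ` tends to zero and `Wₙ` to one in
probability, then `ℙ(Tₙ² ≤ q Wₙ)` tends to `ℙ(|Z| ≤ √q)` for a standard Gaussian `Z`. -/
theorem tendsto_measure_sq_le_mul {Ω : ℕ → Type*} [∀ n, MeasurableSpace (Ω n)]
    {P : ∀ n, Measure (Ω n)} [∀ n, IsProbabilityMeasure (P n)] {S T W : ∀ n, Ω n → ℝ}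
    (hS : ∀ u : ℝ, Tendsto (fun n => (P n).real {ω | |S n ω| ≤ u}) atTop
      (𝓝 ((gaussianReal 0 1).real (Set.Icc (-u) u))))
    (hT : IsLittleOP P (fun n ω => T n ω - S n ω)) (hW : IsLittleOP P (fun n ω => W n ω - 1))
    {q : ℝ} (hq : 0 ≤ q) :
    Tendsto (fun n => (P n).real {ω | T n ω ^ 2 ≤ q * W n ω}) atTop
      (𝓝 ((gaussianReal 0 1).real (Set.Icc (-√q) (√q)))) := by
  set s := √q with hs
  have hs0 : 0 ≤ s := Real.sqrt_nonneg q
  have hsq : s ^ 2 = q := Real.sq_sqrt hq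
  rw [Metric.tendsto_atTop']
  intro ε hε
  -- `η` bounds `|Tₙ - Sₙ|` and `|Wₙ - 1|`; the interval for `Sₙ` then changes by `κ`
  obtain ⟨η, hη0, hη1, hηε⟩ : ∃ η : ℝ, 0 < η ∧ η < 1 ∧ 2 * ((s + 1) * η) < ε / 4 := by
    refine ⟨min (1 / 2) (ε / (16 * (s + 1))), by positivity,
      (min_le_left _ _).trans_lt (by norm_num), ?_⟩
    have h1 : min (1 / 2) (ε / (16 * (s + 1))) ≤ ε / (16 * (s + 1)) := min_le_right _ _
    have h2 : (s + 1) * (ε / (16 * (s + 1))) = ε / 16 := by field_simp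
    nlinarith
  set κ := (s + 1) * η with hκ
  have hκ0 : 0 ≤ κ := by positivity
  have toReal : ∀ {X : ∀ n, Ω n → ℝ}, IsLittleOP P X →
      ∀ᶠ n in atTop, (P n).real {ω | η < |X n ω|} < ε / 4 := by
    intro X hX
    have := (ENNReal.tendsto_toReal_zero_iff fun n => measure_ne_top _ _).2 (hX η hη0)
    exact this.eventually_lt_const (by linarith)
  have hG1 := gaussianReal_Icc_neg_le s κ hκ0
  have hG2 := gaussianReal_Icc_neg_le (s - κ) κ hκ0
  rw [sub_add_cancel] at hG2
  have hu := (hS (s + κ)).eventually_lt_const (u := (gaussianReal 0 1).real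
    (Set.Icc (-(s + κ)) (s + κ)) + ε / 4) (by linarith)
  have hl := (hS (s - κ)).eventually_const_lt (u := (gaussianReal 0 1).real
    (Set.Icc (-(s - κ)) (s - κ)) - ε / 4) (by linarith)
  obtain ⟨N, hN⟩ := eventually_atTop.1
    ((toReal hT).and ((toReal hW).and (hu.and hl)))
  refine ⟨N, fun n hn => ?_⟩
  obtain ⟨hTn, hWn, hun, hln⟩ := hN n hn.le
  have key1 : (P n).real {ω | T n ω ^ 2 ≤ q * W n ω} ≤ (P n).real {ω | |S n ω| ≤ s + κ}
      + ((P n).real {ω | η < |T n ω - S n ω|} + (P n).real {ω | η < |W n ω - 1|}) := by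
    refine le_trans (measureReal_mono fun ω hω => ?_) ((measureReal_union_le _ _).trans
      (add_le_add le_rfl (measureReal_union_le _ _)))
    by_contra hc
    simp only [Set.mem_union, Set.mem_ofPred_eq, not_or, not_lt, not_le] at hc hω
    obtain ⟨h1, h2, h3⟩ := hc
    have h4 : W n ω ≤ 1 + η := by have := (abs_le.1 h3).2; linarith
    have h5 : T n ω ^ 2 ≤ (s * (1 + η)) ^ 2 := by
      rw [mul_pow, hsq]
      refine hω.trans (mul_le_mul_of_nonneg_left ?_ hq)
      nlinarith
    have h6 : |T n ω| ≤ s * (1 + η) := abs_le_of_sq_le_sq h5 (by positivity)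
    have h7 : |S n ω| ≤ |T n ω| + |T n ω - S n ω| := by
      have := abs_sub_abs_le_abs_sub (S n ω) (T n ω)
      rw [abs_sub_comm] at this; linarith
    rw [hκ] at h1
    nlinarith
  have key2 : (P n).real {ω | |S n ω| ≤ s - κ} ≤ (P n).real {ω | T n ω ^ 2 ≤ q * W n ω}
      + ((P n).real {ω | η < |T n ω - S n ω|} + (P n).real {ω | η < |W n ω - 1|}) := by
    refine le_trans (measureReal_mono fun ω hω => ?_) ((measureReal_union_le _ _).trans
      (add_le_add le_rfl (measureReal_union_le _ _)))
    by_contra hc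
    simp only [Set.mem_union, Set.mem_ofPred_eq, not_or, not_lt, not_le] at hc hω
    obtain ⟨h1, h2, h3⟩ := hc
    have h4 : 1 - η ≤ W n ω := by have := (abs_le.1 h3).1; linarith
    have h7 : |T n ω| ≤ |S n ω| + |T n ω - S n ω| := by
      have := abs_sub_abs_le_abs_sub (T n ω) (S n ω)
      linarith
    have h6 : |T n ω| ≤ s * (1 - η) := by rw [hκ] at hω; nlinarith
    have h5 : T n ω ^ 2 ≤ (s * (1 - η)) ^ 2 := by
      rw [← sq_abs]; gcongr
    rw [mul_pow, hsq] at h5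
    have h8 : q * (1 - η) ^ 2 ≤ q * W n ω := mul_le_mul_of_nonneg_left (by nlinarith) hq
    linarith
  rw [Real.dist_eq, abs_lt]
  constructor <;> linarith

/-! ### Conditioning on part of each observation -/

section Resampling

variable {α 𝒳 ι : Type*} [MeasurableSpace α] [MeasurableSpace 𝒳] [Fintype ι]
  {μ : Measure α} [IsProbabilityMeasure μ]

theorem integrable_pi_comp_eval {h : α → ℝ} (hh : Integrable h μ) (i : ι) :
    Integrable (fun z : ι → α => h (z i)) (Measure.pi fun _ : ι => μ) :=
  (measurePreserving_eval (fun _ : ι => μ) i).integrable_comp_of_integrable hh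

variable [DecidableEq ι]

/-- Replacing one observation of an i.i.d. sample by an independent copy does not change the law
of the sample. -/
theorem measurePreserving_update (i : ι) :
    MeasurePreserving (fun q : (ι → α) × α => Function.update q.1 i q.2)
      ((Measure.pi fun _ : ι => μ).prod μ) (Measure.pi fun _ : ι => μ) := by
  have hm : Measurable (fun q : (ι → α) × α => Function.update q.1 i q.2) := by
    refine measurable_pi_iff.2 fun j => ?_
    by_cases h : j = i
    · subst h; simpa using measurable_snd
    · simp only [Function.update_of_ne h]
      exact (measurable_pi_apply j).comp measurable_fst
  refine ⟨hm, ?_⟩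
  refine (Measure.pi_eq fun s hs => ?_).symm
  rw [Measure.map_apply hm (MeasurableSet.univ_pi hs)]
  have e : (fun q : (ι → α) × α => Function.update q.1 i q.2) ⁻¹' Set.univ.pi s
      = (Set.univ.pi (Function.update s i Set.univ)) ×ˢ s i := by
    ext q
    simp only [Set.mem_preimage, Set.mem_pi, Set.mem_univ, true_imp_iff, Set.mem_prod]
    constructor
    · intro h
      refine ⟨fun j => ?_, by simpa using h i⟩
      by_cases hj : j = i
      · subst hj; simp
      · simpa [Function.update_of_ne hj] using h j
    · rintro ⟨h1, h2⟩ j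
      by_cases hj : j = i
      · subst hj; simpa using h2
      · simpa [Function.update_of_ne hj] using h1 j
  rw [e, Measure.prod_prod, Measure.pi_pi, ← Finset.mul_prod_erase Finset.univ _ (Finset.mem_univ i),
    ← Finset.mul_prod_erase Finset.univ (fun j => μ (s j)) (Finset.mem_univ i)]
  simp only [Function.update_self, measure_univ, one_mul]
  rw [mul_comm]
  congr 1
  refine Finset.prod_congr rfl fun j hj => ?_
  rw [Function.update_of_ne (Finset.ne_of_mem_erase hj)]

theorem integral_pi_eq_integral_update {F : (ι → α) → ℝ}
    (hF : Integrable F (Measure.pi fun _ : ι => μ)) (i : ι) :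
    ∫ z, F z ∂(Measure.pi fun _ : ι => μ)
      = ∫ z, ∫ y, F (Function.update z i y) ∂μ ∂(Measure.pi fun _ : ι => μ) := by
  have hp := measurePreserving_update (μ := μ) i
  have hc : Integrable (fun q : (ι → α) × α => F (Function.update q.1 i q.2))
      ((Measure.pi fun _ : ι => μ).prod μ) := hp.integrable_comp_of_integrable hF
  rw [← integral_prod _ hc]
  conv_lhs => rw [← hp.map_eq]
  rw [integral_map hp.measurable.aemeasurable]
  rw [hp.map_eq]
  exact hF.aestronglyMeasurable

variable {x : α → 𝒳}

theorem integral_comp_mul_condExp (hx : Measurable x) {f : 𝒳 → ℝ} (hf : Measurable f) {B : ℝ}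
    (hB : ∀ᵐ a ∂μ, |f (x a)| ≤ B) {h : α → ℝ} (hh : Integrable h μ) :
    ∫ a, f (x a) * h a ∂μ = ∫ a, f (x a) * (μ[h | MeasurableSpace.comap x inferInstance]) a ∂μ := by
  have hm : MeasurableSpace.comap x inferInstance ≤ (inferInstance : MeasurableSpace α) :=
    hx.comap_le
  have hfm : StronglyMeasurable[MeasurableSpace.comap x inferInstance] (fun a => f (x a)) :=
    (hf.comp (comap_measurable x)).stronglyMeasurable
  have hi : Integrable (fun a => f (x a) * h a) μ :=
    hh.bdd_mul (hf.comp hx).aestronglyMeasurable hB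
  rw [← integral_condExp hm (f := fun a => f (x a) * h a)]
  exact integral_congr_ae (condExp_mul_of_stronglyMeasurable_left hfm hi hh)

/-- In an i.i.d. sample, weights depending on all the `x (z j)` see `h (z i)` only through its
conditional expectation given `x (z i)`. -/
theorem integral_weight_mul_eval (hx : Measurable x) {φ : (ι → 𝒳) → ℝ} (hφ : Measurable φ) {B : ℝ}
    (hB : ∀ v, |φ v| ≤ B) {h : α → ℝ} (hh : Integrable h μ) (i : ι) :
    ∫ z, φ (fun j => x (z j)) * h (z i) ∂(Measure.pi fun _ : ι => μ)
      = ∫ z, φ (fun j => x (z j)) * (μ[h | MeasurableSpace.comap x inferInstance]) (z i)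
          ∂(Measure.pi fun _ : ι => μ) := by
  have hφx : Measurable fun z : ι → α => φ (fun j => x (z j)) :=
    hφ.comp (measurable_pi_iff.2 fun j => hx.comp (measurable_pi_apply j))
  have hi : ∀ {k : α → ℝ}, Integrable k μ →
      Integrable (fun z : ι → α => φ (fun j => x (z j)) * k (z i)) (Measure.pi fun _ : ι => μ) :=
    fun hk => (integrable_pi_comp_eval hk i).bdd_mul hφx.aestronglyMeasurable
      (Eventually.of_forall fun z => hB _)
  rw [integral_pi_eq_integral_update (hi hh) i, integral_pi_eq_integral_update
    (hi integrable_condExp) i]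
  refine integral_congr_ae (Eventually.of_forall fun z => ?_)
  have e : ∀ y, (fun j => x (Function.update z i y j))
      = Function.update (fun j => x (z j)) i (x y) := by
    intro y; ext j
    by_cases hj : j = i
    · subst hj; simp
    · simp [Function.update_of_ne hj]
  simp only [e, Function.update_self]
  exact integral_comp_mul_condExp (f := fun x' => φ (Function.update (fun j => x (z j)) i x')) hx
    (hφ.comp (measurable_update _)) (Eventually.of_forall fun a => hB _) hh

theorem integral_weight_mul_eval_le (hx : Measurable x) {φ : (ι → 𝒳) → ℝ} (hφ : Measurable φ)
    {B : ℝ} (hB : ∀ v, |φ v| ≤ B) (hφ0 : ∀ v, 0 ≤ φ v) {h : α → ℝ} (hh : Integrable h μ) (i : ι)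
    {C : ℝ} (hC : ∀ z : ι → α, φ (fun j => x (z j)) ≠ 0 →
      (μ[h | MeasurableSpace.comap x inferInstance]) (z i) ≤ C) :
    ∫ z, φ (fun j => x (z j)) * h (z i) ∂(Measure.pi fun _ : ι => μ)
      ≤ C * ∫ z, φ (fun j => x (z j)) ∂(Measure.pi fun _ : ι => μ) := by
  have hφx : Measurable fun z : ι → α => φ (fun j => x (z j)) :=
    hφ.comp (measurable_pi_iff.2 fun j => hx.comp (measurable_pi_apply j))
  rw [integral_weight_mul_eval hx hφ hB hh i, ← integral_const_mul]
  refine integral_mono ?_ ?_ fun z => ?_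
  · exact (integrable_pi_comp_eval integrable_condExp i).bdd_mul hφx.aestronglyMeasurable
      (Eventually.of_forall fun z => hB _)
  · exact (Integrable.of_bound hφx.aestronglyMeasurable B
      (Eventually.of_forall fun z => hB _)).const_mul C
  · by_cases h0 : φ (fun j => x (z j)) = 0
    · simp [h0]
    · show φ (fun j => x (z j)) * _ ≤ _
      rw [mul_comm]
      exact mul_le_mul_of_nonneg_right (hC z h0) (hφ0 _)

/-- A sum of conditionally centred terms, with weights depending on the conditioning variables, has
uncorrelated summands. -/
theorem integral_sq_sum_weight_mul (hx : Measurable x) {φ : ι → (ι → 𝒳) → ℝ}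
    (hφ : ∀ i, Measurable (φ i)) {B : ℝ} (hB : ∀ i v, |φ i v| ≤ B) {h : α → ℝ} (hh : MemLp h 2 μ)
    (h0 : μ[h | MeasurableSpace.comap x inferInstance] =ᵐ[μ] 0) :
    Integrable (fun z : ι → α => (∑ i, φ i (fun j => x (z j)) * h (z i)) ^ 2)
      (Measure.pi fun _ : ι => μ) ∧
    ∫ z, (∑ i, φ i (fun j => x (z j)) * h (z i)) ^ 2 ∂(Measure.pi fun _ : ι => μ)
      = ∑ i, ∫ z, φ i (fun j => x (z j)) ^ 2 * h (z i) ^ 2 ∂(Measure.pi fun _ : ι => μ) := by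
  have hφx : ∀ i, Measurable fun z : ι → α => φ i (fun j => x (z j)) := fun i =>
    (hφ i).comp (measurable_pi_iff.2 fun j => hx.comp (measurable_pi_apply j))
  have hh1 : Integrable h μ := hh.integrable (by norm_num)
  have hL : ∀ i, MemLp (fun z : ι → α => h (z i)) 2 (Measure.pi fun _ : ι => μ) := fun i =>
    hh.comp_measurePreserving (measurePreserving_eval (fun _ : ι => μ) i)
  have hI : ∀ i j, Integrable (fun z : ι → α => (φ i (fun l => x (z l)) * φ j (fun l => x (z l)))
      * (h (z i) * h (z j))) (Measure.pi fun _ : ι => μ) := by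
    intro i j
    refine ((hL i).integrable_mul (hL j)).bdd_mul (c := B * B)
      ((hφx i).mul (hφx j)).aestronglyMeasurable (Eventually.of_forall fun z => ?_)
    rw [Real.norm_eq_abs, abs_mul]
    exact mul_le_mul (hB _ _) (hB _ _) (abs_nonneg _) ((abs_nonneg _).trans (hB i fun l => x (z l)))
  have e : ∀ z : ι → α, (∑ i, φ i (fun j => x (z j)) * h (z i)) ^ 2
      = ∑ i, ∑ j, (φ i (fun l => x (z l)) * φ j (fun l => x (z l))) * (h (z i) * h (z j)) := by
    intro z
    rw [sq, Finset.sum_mul_sum]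
    exact Finset.sum_congr rfl fun i _ => Finset.sum_congr rfl fun j _ => by ring
  simp_rw [e]
  refine ⟨integrable_finsetSum _ fun i _ => integrable_finsetSum _ fun j _ => hI i j, ?_⟩
  rw [integral_finsetSum _ fun i _ => integrable_finsetSum _ fun j _ => hI i j]
  refine Finset.sum_congr rfl fun i _ => ?_
  rw [integral_finsetSum _ fun j _ => hI i j, Finset.sum_eq_single i]
  · exact integral_congr_ae (Eventually.of_forall fun z => by simp only; ring)
  · intro j _ hji
    -- integrate over the `i`-th observation first
    rw [integral_pi_eq_integral_update (hI i j) i]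
    refine integral_eq_zero_of_ae (Eventually.of_forall fun z => ?_)
    have e : ∀ y, (fun j => x (Function.update z i y j))
        = Function.update (fun j => x (z j)) i (x y) := by
      intro y; ext j
      by_cases hj : j = i
      · subst hj; simp
      · simp [Function.update_of_ne hj]
    simp only [e, Function.update_self, Function.update_of_ne hji, Pi.zero_apply]
    have hz := integral_comp_mul_condExp (μ := μ) (f := fun x' =>
      φ i (Function.update (fun j => x (z j)) i x') * φ j (Function.update (fun j => x (z j)) i x'))
      hx (((hφ i).comp (measurable_update _)).mul ((hφ j).comp (measurable_update _)))
      (B := B * B) (Eventually.of_forall fun a => by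
        rw [abs_mul]
        exact mul_le_mul (hB _ _) (hB _ _) (abs_nonneg _)
          ((abs_nonneg _).trans (hB i fun l => x (z l)))) hh1
    have hz0 : ∫ a, φ i (Function.update (fun j => x (z j)) i (x a))
        * φ j (Function.update (fun j => x (z j)) i (x a))
        * (μ[h | MeasurableSpace.comap x inferInstance]) a ∂μ = 0 := by
      refine integral_eq_zero_of_ae ?_
      filter_upwards [h0] with a ha
      simp [ha]
    rw [hz0] at hz
    simp_rw [← mul_assoc]
    rw [integral_mul_const, hz, zero_mul]
  · simp

end Resampling

/-! ### Conditional moment bounds for triangular arrays -/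

section Arrays

variable {α 𝒳 : ℕ → Type*} [∀ n, MeasurableSpace (α n)] [∀ n, MeasurableSpace (𝒳 n)]
  {μ : ∀ n, Measure (α n)} [∀ n, IsProbabilityMeasure (μ n)]

theorem integral_sampleMean_comp {β : Type*} [MeasurableSpace β] {ν : Measure β}
    [IsProbabilityMeasure ν] {h : β → ℝ} (hh : Integrable h ν) (n : ℕ) (hn : 0 < n) :
    Integrable (fun z : Fin n → β => sampleMean (fun i => h (z i))) (Measure.pi fun _ => ν) ∧
    ∫ z : Fin n → β, sampleMean (fun i => h (z i)) ∂(Measure.pi fun _ => ν) = ∫ b, h b ∂ν := by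
  have hi : ∀ i : Fin n, Integrable (fun z : Fin n → β => h (z i)) (Measure.pi fun _ => ν) :=
    fun i => integrable_pi_comp_eval hh i
  have he : ∀ i : Fin n, ∫ z : Fin n → β, h (z i) ∂(Measure.pi fun _ => ν) = ∫ b, h b ∂ν := by
    intro i
    have hp := measurePreserving_eval (fun _ : Fin n => ν) i
    conv_rhs => rw [← hp.map_eq]
    rw [integral_map hp.measurable.aemeasurable]
    rw [hp.map_eq]; exact hh.aestronglyMeasurable
  refine ⟨(integrable_finsetSum _ fun i _ => hi i).const_mul _, ?_⟩
  simp only [sampleMean]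
  rw [integral_const_mul, integral_finsetSum _ fun i _ => hi i]
  simp only [he, Finset.sum_const, Finset.card_univ, Fintype.card_fin, nsmul_eq_mul]
  have : (n : ℝ) ≠ 0 := by exact_mod_cast hn.ne'
  field_simp

/-- Weak law of large numbers for triangular arrays with centred i.i.d. rows and bounded second
moments. -/
theorem isLittleOP_sampleMean {W : ∀ n, α n → ℝ} {C : ℝ} (hW : ∀ n, MemLp (W n) 2 (μ n))
    (h0 : ∀ n, ∫ a, W n a ∂μ n = 0) (h2 : ∀ n, ∫ a, W n a ^ 2 ∂μ n ≤ C) :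
    IsLittleOP (fun n => Measure.pi fun _ : Fin n => μ n)
      (fun n z => sampleMean (fun i => W n (z i))) := by
  refine IsLittleOP.of_sq (IsLittleOP.of_integral (u := fun n => C * (1 / (n : ℝ))) ?_ ?_)
  · filter_upwards [eventually_gt_atTop 0] with n hn
    have hn' : (0 : ℝ) < n := by exact_mod_cast hn
    have hc : (μ n)[W n | MeasurableSpace.comap (fun _ : α n => ()) inferInstance] =ᵐ[μ n] 0 := by
      rw [MeasurableSpace.comap_const, condExp_bot, h0]
      rfl
    obtain ⟨hi, he⟩ := integral_sq_sum_weight_mul (ι := Fin n) (μ := μ n) (x := fun _ : α n => ())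
      measurable_const (φ := fun _ _ => 1 / (n : ℝ)) (fun _ => measurable_const)
      (B := |1 / (n : ℝ)|) (fun _ _ => le_rfl) (hW n) hc
    have e : ∀ z : Fin n → α n, sampleMean (fun i => W n (z i)) ^ 2
        = (∑ i, 1 / (n : ℝ) * W n (z i)) ^ 2 := by
      intro z; rw [sampleMean, Finset.mul_sum]
    simp only [abs_sq, e]
    refine ⟨hi, ?_⟩
    rw [he]
    have hm : ∀ i : Fin n, ∫ z : Fin n → α n, (1 / (n : ℝ)) ^ 2 * W n (z i) ^ 2
        ∂(Measure.pi fun _ => μ n) = (1 / (n : ℝ)) ^ 2 * ∫ a, W n a ^ 2 ∂μ n := by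
      intro i
      rw [integral_const_mul]
      congr 1
      have hp := measurePreserving_eval (fun _ : Fin n => μ n) i
      conv_rhs => rw [← hp.map_eq]
      rw [integral_map hp.measurable.aemeasurable]
      rw [hp.map_eq]; exact (hW n).integrable_sq.aestronglyMeasurable
    simp only [hm, Finset.sum_const, Finset.card_univ, Fintype.card_fin, nsmul_eq_mul]
    have e3 : (n : ℝ) * ((1 / (n : ℝ)) ^ 2 * ∫ a, W n a ^ 2 ∂μ n)
        = (∫ a, W n a ^ 2 ∂μ n) * (1 / (n : ℝ)) := by field_simp
    rw [e3]
    have := h2 n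
    gcongr
  · have := tendsto_one_div_atTop_nhds_zero_nat.const_mul C
    simpa using this

variable {x : ∀ n, α n → 𝒳 n} {ε : ∀ n, α n → ℝ} {d : ∀ n, Fin n → (Fin n → 𝒳 n) → ℝ}

/-- The event, in terms of the conditioning variables `v`, on which the conditional fourth moments
`k (v i)` are below `C` and the mean square of the weights `d i v` is at most `b`. -/
def goodDesign {n : ℕ} {𝒴 : Type*} (k : 𝒴 → ℝ) (d : Fin n → (Fin n → 𝒴) → ℝ) (C b : ℝ) :
    Set (Fin n → 𝒴) :=
  {v | (∀ i, k (v i) < C) ∧ |sampleMean (fun i => d i v ^ 2)| ≤ b}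

theorem measurable_sampleMean {n : ℕ} {β : Type*} [MeasurableSpace β] {f : Fin n → β → ℝ}
    (hf : ∀ i, Measurable (f i)) : Measurable fun b => sampleMean (fun i => f i b) :=
  (Finset.measurable_fun_sum _ fun i _ => hf i).const_mul _

theorem measurableSet_goodDesign {n : ℕ} {𝒴 : Type*} [MeasurableSpace 𝒴] {k : 𝒴 → ℝ}
    (hk : Measurable k) {d : Fin n → (Fin n → 𝒴) → ℝ} (hd : ∀ i, Measurable (d i)) (C b : ℝ) :
    MeasurableSet (goodDesign k d C b) := by
  refine MeasurableSet.inter ?_ ?_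
  · have e : {v : Fin n → 𝒴 | ∀ i, k (v i) < C} = ⋂ i, {v | k (v i) < C} := by ext; simp
    change MeasurableSet {v : Fin n → 𝒴 | ∀ i, k (v i) < C}
    rw [e]
    exact MeasurableSet.iInter fun i =>
      measurableSet_lt (hk.comp (measurable_pi_apply i)) measurable_const
  · exact measurableSet_le (measurable_sampleMean fun i => (hd i).pow_const 2).abs measurable_const

theorem sampleMean_mono {n : ℕ} {u v : Fin n → ℝ} (h : ∀ i, u i ≤ v i) :
    sampleMean u ≤ sampleMean v :=
  mul_le_mul_of_nonneg_left (Finset.sum_le_sum fun i _ => h i) (by positivity)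

theorem sampleMean_nonneg {n : ℕ} {u : Fin n → ℝ} (h : ∀ i, 0 ≤ u i) : 0 ≤ sampleMean u :=
  mul_nonneg (by positivity) (Finset.sum_nonneg fun i _ => h i)

/-- On an event determined by the design, on which the conditional fourth moments of the errors are
at most `C`, the mean of `dᵢ² (1 + eᵢ⁴)` is at most `1 + C` times the mean of `dᵢ²`. Since
`|e| ≤ 1 + e⁴` and `e² ≤ 1 + e⁴`, this controls both linear and quadratic remainders. -/
theorem integral_indicator_goodDesign_le {n : ℕ} {β 𝒴 : Type*} [MeasurableSpace β]
    [MeasurableSpace 𝒴] {ν : Measure β} [IsProbabilityMeasure ν] {x : β → 𝒴} (hx : Measurable x)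
    {e : β → ℝ} (he : Integrable (fun a => e a ^ 4) ν)
    {k : 𝒴 → ℝ} (hk : Measurable k)
    (hke : ν[fun a => e a ^ 4 | MeasurableSpace.comap x inferInstance] = k ∘ x)
    {d : Fin n → (Fin n → 𝒴) → ℝ} (hd : ∀ i, Measurable (d i)) (hd1 : ∀ i v, |d i v| ≤ 1)
    (C b : ℝ) (i : Fin n) :
    Integrable (fun z : Fin n → β => (goodDesign k d C b).indicator (fun v => d i v ^ 2)
      (fun j => x (z j)) * (1 + e (z i) ^ 4)) (Measure.pi fun _ => ν) ∧
    ∫ z : Fin n → β, (goodDesign k d C b).indicator (fun v => d i v ^ 2) (fun j => x (z j))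
        * (1 + e (z i) ^ 4) ∂(Measure.pi fun _ => ν)
      ≤ (1 + C) * ∫ z : Fin n → β, (goodDesign k d C b).indicator (fun v => d i v ^ 2)
        (fun j => x (z j)) ∂(Measure.pi fun _ => ν) := by
  have hG := measurableSet_goodDesign hk hd C b
  set φ : (Fin n → 𝒴) → ℝ := (goodDesign k d C b).indicator (fun v => d i v ^ 2) with hφ
  have hφm : Measurable φ := ((hd i).pow_const 2).indicator hG
  have hφ0 : ∀ v, 0 ≤ φ v := fun v => Set.indicator_nonneg (fun v _ => sq_nonneg _) v
  have hφ1 : ∀ v, |φ v| ≤ 1 := by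
    intro v
    rw [abs_of_nonneg (hφ0 v)]
    refine Set.indicator_le' (g := fun _ => (1 : ℝ)) (fun v _ => ?_) (fun _ _ => zero_le_one) v
    have := hd1 i v
    rw [← sq_abs]
    exact pow_le_one₀ (abs_nonneg _) this
  have hφx : Measurable fun z : Fin n → β => φ (fun j => x (z j)) :=
    hφm.comp (measurable_pi_iff.2 fun j => hx.comp (measurable_pi_apply j))
  have i0 : Integrable (fun z : Fin n → β => φ (fun j => x (z j))) (Measure.pi fun _ => ν) :=
    Integrable.of_bound hφx.aestronglyMeasurable 1 (Eventually.of_forall fun z => hφ1 _)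
  have i4 : Integrable (fun z : Fin n → β => φ (fun j => x (z j)) * e (z i) ^ 4)
      (Measure.pi fun _ => ν) :=
    (integrable_pi_comp_eval he i).bdd_mul hφx.aestronglyMeasurable
      (Eventually.of_forall fun z => hφ1 _)
  have key := integral_weight_mul_eval_le hx hφm hφ1 hφ0 he i (C := C) (fun z hz => by
    rw [hke]
    have : (fun j => x (z j)) ∈ goodDesign k d C b := Set.mem_of_indicator_ne_zero hz
    exact (this.1 i).le)
  have e1 : ∀ z : Fin n → β, φ (fun j => x (z j)) * (1 + e (z i) ^ 4)
      = φ (fun j => x (z j)) + φ (fun j => x (z j)) * e (z i) ^ 4 := fun z => by ring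
  simp only [e1]
  refine ⟨i0.add i4, ?_⟩
  rw [integral_add i0 i4]
  linarith

theorem integral_sum_indicator_goodDesign_le {n : ℕ} {β 𝒴 : Type*} [MeasurableSpace β]
    [MeasurableSpace 𝒴] {ν : Measure β} [IsProbabilityMeasure ν] {x : β → 𝒴} (hx : Measurable x)
    {k : 𝒴 → ℝ} (hk : Measurable k)
    {d : Fin n → (Fin n → 𝒴) → ℝ} (hd : ∀ i, Measurable (d i)) (hd1 : ∀ i v, |d i v| ≤ 1)
    (C b : ℝ) (hb : 0 ≤ b) :
    ∑ i, ∫ z : Fin n → β, (goodDesign k d C b).indicator (fun v => d i v ^ 2)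
        (fun j => x (z j)) ∂(Measure.pi fun _ => ν) ≤ n * b := by
  have hG := measurableSet_goodDesign hk hd C b
  have hxm : Measurable fun z : Fin n → β => (fun j => x (z j)) :=
    measurable_pi_iff.2 fun j => hx.comp (measurable_pi_apply j)
  have hi : ∀ i, Integrable (fun z : Fin n → β => (goodDesign k d C b).indicator
      (fun v => d i v ^ 2) (fun j => x (z j))) (Measure.pi fun _ => ν) := by
    intro i
    refine Integrable.of_bound ((((hd i).pow_const 2).indicator hG).comp hxm).aestronglyMeasurable 1
      (Eventually.of_forall fun z => ?_)
    simp only [Set.indicator, Real.norm_eq_abs]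
    split_ifs
    · rw [abs_pow]; exact pow_le_one₀ (abs_nonneg _) (hd1 i _)
    · simp
  rw [← integral_finsetSum _ fun i _ => hi i]
  refine (integral_mono (integrable_finsetSum _ fun i _ => hi i)
    (integrable_const ((n : ℝ) * b)) fun z => ?_).trans (by simp)
  simp only [Set.indicator]
  split_ifs with h
  · have h2 := (le_abs_self _).trans h.2
    rcases Nat.eq_zero_or_pos n with rfl | hn
    · simp
    · have hn' : (0 : ℝ) < n := by exact_mod_cast hn
      rw [sampleMean, div_mul_eq_mul_div, one_mul, div_le_iff₀ hn'] at h2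
      rwa [mul_comm]
  · simp only [Finset.sum_const_zero]; positivity

/-- Quadratic remainders: since the weights depend on the design only, the errors `ε` enter
through their conditional moments, and no maximal inequality is needed. -/
theorem isLittleOP_sqrt_mul_sampleMean_sq_mul_abs (hx : ∀ n, Measurable (x n))
    (h4 : ∀ n, Integrable (fun a => ε n a ^ 4) (μ n)) {C : ℝ} (hC : 0 ≤ C)
    (hmom : HoldsWHP (fun n => Measure.pi fun _ : Fin n => μ n) (fun n => {z | ∀ i,
      ((μ n)[fun a => ε n a ^ 4 | MeasurableSpace.comap (x n) inferInstance]) (z i) < C}))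
    (hd : ∀ n i, Measurable (d n i)) (hd1 : ∀ n i v, |d n i v| ≤ 1) {r : ℕ → ℝ}
    (hr0 : ∀ n, 0 ≤ r n)
    (hrate : IsBigOP (fun n => Measure.pi fun _ : Fin n => μ n)
      (fun n z => sampleMean (fun i => d n i (fun j => x n (z j)) ^ 2)) r)
    (hr : Tendsto (fun n : ℕ => √(n : ℝ) * r n) atTop (𝓝 0)) :
    IsLittleOP (fun n => Measure.pi fun _ : Fin n => μ n)
      (fun n z => √(n : ℝ) * sampleMean (fun i => d n i (fun j => x n (z j)) ^ 2 * |ε n (z i)|)) := by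
  have hk : ∀ n, ∃ k : 𝒳 n → ℝ, StronglyMeasurable k ∧
      (μ n)[fun a => ε n a ^ 4 | MeasurableSpace.comap (x n) inferInstance] = k ∘ x n :=
    fun n => stronglyMeasurable_condExp.exists_eq_measurable_comp
  choose k hkm hke using hk
  refine IsLittleOP.of_truncate hrate fun K => ?_
  set b : ℕ → ℝ := fun n => max K 0 * r n with hb
  have hb0 : ∀ n, 0 ≤ b n := fun n => mul_nonneg (le_max_right _ _) (hr0 n)
  have hZ : IsLittleOP (fun n => Measure.pi fun _ : Fin n => μ n) (fun n z => √(n : ℝ) *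
      sampleMean (fun i => (goodDesign (k n) (d n) C (b n)).indicator (fun v => d n i v ^ 2)
        (fun j => x n (z j)) * (1 + ε n (z i) ^ 4))) := by
    refine IsLittleOP.of_integral (u := fun n => (1 + C) * max K 0 * (√(n : ℝ) * r n)) ?_
      (by simpa using hr.const_mul ((1 + C) * max K 0))
    filter_upwards [eventually_gt_atTop 0] with n hn
    have hn' : (0 : ℝ) < n := by exact_mod_cast hn
    have hi := fun i => integral_indicator_goodDesign_le (hx n) (h4 n) (hkm n).measurable (hke n)
      (hd n) (hd1 n) C (b n) i
    have hpos : ∀ z : Fin n → α n, 0 ≤ √(n : ℝ) *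
        sampleMean (fun i => (goodDesign (k n) (d n) C (b n)).indicator (fun v => d n i v ^ 2)
        (fun j => x n (z j)) * (1 + ε n (z i) ^ 4)) := fun z =>
      mul_nonneg (Real.sqrt_nonneg _) (sampleMean_nonneg fun i => mul_nonneg
        (Set.indicator_nonneg (fun v _ => sq_nonneg _) _) (by positivity))
    refine ⟨((integrable_finsetSum _ fun i _ => (hi i).1).const_mul _).const_mul _, ?_⟩
    simp only [abs_of_nonneg (hpos _)]
    simp only [sampleMean]
    rw [integral_const_mul, integral_const_mul, integral_finsetSum _ fun i _ => (hi i).1]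
    have h1 := Finset.sum_le_sum fun i (_ : i ∈ Finset.univ) => (hi i).2
    rw [← Finset.mul_sum] at h1
    have h2 := integral_sum_indicator_goodDesign_le (hx n) (hkm n).measurable (hd n) (hd1 n) C (b n)
      (hb0 n) (ν := μ n)
    have h3 := h1.trans (mul_le_mul_of_nonneg_left h2 (by linarith : 0 ≤ 1 + C))
    refine (mul_le_mul_of_nonneg_left (mul_le_mul_of_nonneg_left h3 (by positivity))
      (Real.sqrt_nonneg _)).trans (le_of_eq ?_)
    simp only [hb]
    field_simp
  refine hZ.mono hmom (Eventually.of_forall fun n z hz => ?_)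
  by_cases h : |sampleMean (fun i => d n i (fun j => x n (z j)) ^ 2)| ≤ K * r n
  · have hg : (fun j => x n (z j)) ∈ goodDesign (k n) (d n) C (b n) := by
      refine ⟨fun i => ?_, h.trans (mul_le_mul_of_nonneg_right (le_max_left _ _) (hr0 n))⟩
      have := hz i
      rw [hke n] at this
      exact this
    rw [Set.indicator_of_mem (by exact h), abs_of_nonneg (mul_nonneg (Real.sqrt_nonneg _) (sampleMean_nonneg fun i => by positivity))]
    refine le_trans (mul_le_mul_of_nonneg_left (sampleMean_mono fun i => ?_) (Real.sqrt_nonneg _))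
      (le_abs_self _)
    rw [Set.indicator_of_mem hg]
    exact mul_le_mul_of_nonneg_left (abs_le_one_add_pow_four _) (sq_nonneg _)
  · rw [Set.indicator_of_notMem (by exact h), abs_zero]
    exact abs_nonneg _

open Classical in
/-- Linear terms with conditionally centred errors: the conditional variance given the design is of
the order of the mean square of the weights. The centring is only used for those `n` for which it is
asserted. -/
theorem isLittleOP_sqrt_mul_sampleMean_mul (hx : ∀ n, Measurable (x n))
    (hεm : ∀ n, AEStronglyMeasurable (ε n) (μ n))
    (h4 : ∀ n, Integrable (fun a => ε n a ^ 4) (μ n)) {C : ℝ} (hC : 0 ≤ C)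
    (hmom : HoldsWHP (fun n => Measure.pi fun _ : Fin n => μ n) (fun n => {z | ∀ i,
      ((μ n)[fun a => ε n a ^ 4 | MeasurableSpace.comap (x n) inferInstance]) (z i) < C}))
    (hd : ∀ n i, Measurable (d n i)) (hd1 : ∀ n i v, |d n i v| ≤ 1) {r : ℕ → ℝ}
    (hr0 : ∀ n, 0 ≤ r n)
    (hrate : IsBigOP (fun n => Measure.pi fun _ : Fin n => μ n)
      (fun n z => sampleMean (fun i => d n i (fun j => x n (z j)) ^ 2)) r)
    (hr : Tendsto r atTop (𝓝 0)) {B : ℕ → Prop}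
    (hB : ∀ n, B n → (μ n)[ε n | MeasurableSpace.comap (x n) inferInstance] =ᵐ[μ n] 0) :
    IsLittleOP (fun n => Measure.pi fun _ : Fin n => μ n)
      (fun n z => if B n then
        √(n : ℝ) * sampleMean (fun i => d n i (fun j => x n (z j)) * ε n (z i)) else 0) := by
  have hk : ∀ n, ∃ k : 𝒳 n → ℝ, StronglyMeasurable k ∧
      (μ n)[fun a => ε n a ^ 4 | MeasurableSpace.comap (x n) inferInstance] = k ∘ x n :=
    fun n => stronglyMeasurable_condExp.exists_eq_measurable_comp
  choose k hkm hke using hk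
  refine IsLittleOP.of_truncate hrate fun K => ?_
  set b : ℕ → ℝ := fun n => max K 0 * r n with hb
  have hb0 : ∀ n, 0 ≤ b n := fun n => mul_nonneg (le_max_right _ _) (hr0 n)
  let φ : ∀ n, Fin n → (Fin n → 𝒳 n) → ℝ := fun n i =>
    (goodDesign (k n) (d n) C (b n)).indicator (fun v => √(n : ℝ) * (1 / n) * d n i v)
  have hZ : IsLittleOP (fun n => Measure.pi fun _ : Fin n => μ n) (fun n z =>
      if B n then ∑ i, φ n i (fun j => x n (z j)) * ε n (z i) else 0) := by
    refine IsLittleOP.of_sq (IsLittleOP.of_integral (u := fun n => (1 + C) * max K 0 * r n) ?_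
      (by simpa using hr.const_mul ((1 + C) * max K 0)))
    filter_upwards [eventually_gt_atTop 0] with n hn
    have hn' : (0 : ℝ) < n := by exact_mod_cast hn
    by_cases hBn : B n
    swap
    · have hpos : 0 ≤ (1 + C) * max K 0 * r n := by
        have := hr0 n
        have : 0 ≤ max K 0 := le_max_right _ _
        positivity
      simpa [hBn] using hpos
    simp only [hBn, if_true, abs_sq]
    have hG := measurableSet_goodDesign (hkm n).measurable (hd n) C (b n)
    have hφm : ∀ i, Measurable (φ n i) := fun i => ((hd n i).const_mul _).indicator hG
    have hφb : ∀ i v, |φ n i v| ≤ √(n : ℝ) * (1 / n) := by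
      intro i v
      simp only [φ, Set.indicator]
      split_ifs
      · rw [abs_mul, abs_of_nonneg (by positivity)]
        exact mul_le_of_le_one_right (by positivity) (hd1 n i v)
      · simp only [abs_zero]; positivity
    obtain ⟨hint, hval⟩ := integral_sq_sum_weight_mul (ι := Fin n) (hx n) hφm hφb
      ((memLp_four_of_integrable_pow (hεm n) (h4 n)).mono_exponent (p := 2) (by norm_num))
      (hB n hBn)
    refine ⟨hint, ?_⟩
    rw [hval]
    have hi := fun i => integral_indicator_goodDesign_le (hx n) (h4 n) (hkm n).measurable (hke n)
      (hd n) (hd1 n) C (b n) i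
    have hcmp : ∀ i : Fin n, ∫ z : Fin n → α n, φ n i (fun j => x n (z j)) ^ 2 * ε n (z i) ^ 2
        ∂(Measure.pi fun _ => μ n) ≤ (1 / (n : ℝ)) * ∫ z : Fin n → α n,
          (goodDesign (k n) (d n) C (b n)).indicator (fun v => d n i v ^ 2)
          (fun j => x n (z j)) * (1 + ε n (z i) ^ 4) ∂(Measure.pi fun _ => μ n) := by
      intro i
      rw [← integral_const_mul]
      refine integral_mono_of_nonneg (Eventually.of_forall fun z => by positivity)
        ((hi i).1.const_mul _) (Eventually.of_forall fun z => ?_)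
      simp only [φ, Set.indicator]
      split_ifs
      · have e : (√(n : ℝ) * (1 / n) * d n i (fun j => x n (z j))) ^ 2
            = 1 / (n : ℝ) * d n i (fun j => x n (z j)) ^ 2 := by
          rw [mul_pow, mul_pow, Real.sq_sqrt hn'.le]
          field_simp
        rw [e, mul_assoc]
        have := sq_le_one_add_pow_four (ε n (z i))
        gcongr
      · simp
    refine (Finset.sum_le_sum fun i _ => hcmp i).trans ?_
    rw [← Finset.mul_sum]
    have h1 := Finset.sum_le_sum fun i (_ : i ∈ Finset.univ) => (hi i).2
    rw [← Finset.mul_sum] at h1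
    have h2 := integral_sum_indicator_goodDesign_le (hx n) (hkm n).measurable (hd n) (hd1 n) C (b n)
      (hb0 n) (ν := μ n)
    have h3 := h1.trans (mul_le_mul_of_nonneg_left h2 (by linarith : 0 ≤ 1 + C))
    refine (mul_le_mul_of_nonneg_left h3 (by positivity)).trans (le_of_eq ?_)
    simp only [hb]
    field_simp
  refine hZ.mono hmom (Eventually.of_forall fun n z hz => ?_)
  simp only [Set.indicator, Set.mem_ofPred_eq]
  split_ifs with h hBn
  · have hg : (fun j => x n (z j)) ∈ goodDesign (k n) (d n) C (b n) := by
      refine ⟨fun i => ?_, h.trans (mul_le_mul_of_nonneg_right (le_max_left _ _) (hr0 n))⟩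
      have := hz i
      rw [hke n] at this
      exact this
    refine le_of_eq (congrArg _ ?_)
    simp only [φ, Set.indicator_of_mem hg, sampleMean, Finset.mul_sum]
    exact Finset.sum_congr rfl fun i _ => by ring
  all_goals simp

end Arrays

/-! ### The logistic function -/

theorem log_sigmoid_sub_log_one_sub (x : ℝ) :
    Real.log (Real.sigmoid x) - Real.log (1 - Real.sigmoid x) = x := by
  have h0 := Real.sigmoid_pos x
  have h : 1 - Real.sigmoid x = Real.sigmoid x * Real.exp (-x) := by
    rw [Real.sigmoid_mul_rexp_neg, Real.sigmoid_neg]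
  rw [h, Real.log_mul h0.ne' (Real.exp_pos _).ne', Real.log_exp]
  ring

/-- Linearization of the logistic function at the perturbed point `y`. The error is bounded by the
square of the change in the *probability*, for increments of any size, provided that the variance
at the reference point `x` is bounded below. Both bounds come from `1 - 1 / s ≤ log s ≤ s - 1`. -/
theorem abs_sigmoid_linearization_le {c x y : ℝ} (hc : 0 < c)
    (hx : c ≤ Real.sigmoid x * (1 - Real.sigmoid x)) :
    |Real.sigmoid x - Real.sigmoid y + Real.sigmoid y * (1 - Real.sigmoid y) * (y - x)|
      ≤ c⁻¹ * (Real.sigmoid x - Real.sigmoid y) ^ 2 := by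
  have hyx : y - x = Real.log (Real.sigmoid y) - Real.log (1 - Real.sigmoid y)
      - (Real.log (Real.sigmoid x) - Real.log (1 - Real.sigmoid x)) := by
    rw [log_sigmoid_sub_log_one_sub, log_sigmoid_sub_log_one_sub]
  have hu0 := Real.sigmoid_pos x
  have hu1 := Real.sigmoid_lt_one x
  have hv0 := Real.sigmoid_pos y
  have hv1 := Real.sigmoid_lt_one y
  rw [hyx]
  generalize Real.sigmoid x = u at *
  generalize Real.sigmoid y = v at *
  have hu1' : 0 < 1 - u := by linarith
  have hv1' : 0 < 1 - v := by linarith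
  have e : Real.log v - Real.log (1 - v) - (Real.log u - Real.log (1 - u))
      = Real.log (v / u) + Real.log ((1 - u) / (1 - v)) := by
    rw [Real.log_div hv0.ne' hu0.ne', Real.log_div hu1'.ne' hv1'.ne']; ring
  rw [e]
  have p1 := Real.one_sub_inv_le_log_of_pos (div_pos hv0 hu0)
  have p2 := Real.log_le_sub_one_of_pos (div_pos hv0 hu0)
  have q1 := Real.one_sub_inv_le_log_of_pos (div_pos hu1' hv1')
  have q2 := Real.log_le_sub_one_of_pos (div_pos hu1' hv1')
  have hw : 0 ≤ v * (1 - v) := by positivity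
  have lo := mul_le_mul_of_nonneg_left (add_le_add p1 q1) hw
  have up := mul_le_mul_of_nonneg_left (add_le_add p2 q2) hw
  have elo : v * (1 - v) * (1 - (v / u)⁻¹ + (1 - ((1 - u) / (1 - v))⁻¹))
      = (v - u) - (u - v) ^ 2 * (v / (1 - u)) := by
    field_simp; ring
  have eup : v * (1 - v) * (v / u - 1 + ((1 - u) / (1 - v) - 1))
      = (v - u) + (u - v) ^ 2 * ((1 - v) / u) := by
    field_simp; ring
  rw [elo] at lo
  rw [eup] at up
  have b1 : v / (1 - u) ≤ c⁻¹ := by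
    rw [div_le_iff₀ hu1', ← div_eq_inv_mul, le_div_iff₀ hc]; nlinarith
  have b2 : (1 - v) / u ≤ c⁻¹ := by
    rw [div_le_iff₀ hu0, ← div_eq_inv_mul, le_div_iff₀ hc]; nlinarith
  have c1 := mul_le_mul_of_nonneg_left b1 (sq_nonneg (u - v))
  have c2 := mul_le_mul_of_nonneg_left b2 (sq_nonneg (u - v))
  rw [abs_le]
  constructor <;> linarith

theorem abs_weight_mul_increment_le {c x y : ℝ} (hc : 0 < c)
    (hx : c ≤ Real.sigmoid x * (1 - Real.sigmoid x)) :
    |Real.sigmoid y * (1 - Real.sigmoid y) * (y - x)|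
      ≤ (1 + c⁻¹) * |Real.sigmoid x - Real.sigmoid y| := by
  have h := abs_sigmoid_linearization_le (y := y) hc hx
  have h1 : |Real.sigmoid x - Real.sigmoid y| ≤ 1 := by
    rw [abs_le]
    constructor <;> linarith [Real.sigmoid_pos x, Real.sigmoid_pos y, Real.sigmoid_lt_one x,
      Real.sigmoid_lt_one y]
  generalize Real.sigmoid y * (1 - Real.sigmoid y) * (y - x) = w at *
  generalize Real.sigmoid x - Real.sigmoid y = d at *
  have h2 : |w| ≤ |d + w| + |d| := by
    have := abs_sub (d + w) d
    rwa [add_sub_cancel_left] at this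
  have h3 : d ^ 2 ≤ |d| := by rw [← sq_abs]; nlinarith [abs_nonneg d]
  have h4 := mul_le_mul_of_nonneg_left h3 (inv_nonneg.2 hc.le)
  linarith

/-! ### The estimating equations for `β` -/

theorem abs_sign_le_one (x : ℝ) : |Real.sign x| ≤ 1 := by
  rcases Real.sign_apply_eq x with h | h | h <;> simp [h]

theorem continuous_of_isLinearMap {p : ℕ} {f : (Fin p → ℝ) → ℝ} (hf : IsLinearMap ℝ f) :
    Continuous f :=
  (hf.mk' f).continuous_of_finiteDimensional

/-- First-order condition in the limit `δ → 1+`: since `δ |b|^(δ-1)` is asymptotically at most one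
for bounded `b`, each component of the empirical estimating function at a bridge estimate is at most
the penalty. -/
theorem IsBridgeEstimate.abs_sampleMean_le {n p : ℕ} {g : Link}
    {m : (Fin p → ℝ) → (Fin p → ℝ) → ℝ} (hm : ∀ l, IsLinearMap ℝ (m l)) {lam ψ : ℝ}
    (hlam : 0 ≤ lam) {γ : Fin p → ℝ} {z : Fin n → Obs p} {β : Fin p → ℝ}
    (h : IsBridgeEstimate g m lam ψ γ z β) (j : Fin p) :
    |sampleMean (fun i => weight (covar (z i)) γ * resid g m ψ β (z i) * covar (z i) j)|
      ≤ lam := by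
  obtain ⟨δ, b, hδ1, hδ, hb, hlim⟩ := h
  have hcont : Continuous fun β' : Fin p → ℝ =>
      |sampleMean (fun i => weight (covar (z i)) γ * resid g m ψ β' (z i) * covar (z i) j)| := by
    unfold sampleMean resid
    have := fun l => continuous_of_isLinearMap (hm l)
    fun_prop
  have hL := (hcont.tendsto β).comp hlim
  have hbj : Tendsto (fun k => |b k j|) atTop (𝓝 |β j|) := ((tendsto_pi_nhds.1 hlim) j).abs
  set M := |β j| + 1 with hM
  have hM1 : 1 ≤ M := by have := abs_nonneg (β j); linarith
  have hev : ∀ᶠ k in atTop, |b k j| ≤ M := (hbj.eventually_lt_const (by linarith)).mono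
    fun k hk => hk.le
  have hR : Tendsto (fun k => lam * (δ k * M ^ (δ k - 1))) atTop (𝓝 (lam * (1 * M ^ ((1 : ℝ) - 1)))) := by
    refine (hδ.mul ?_).const_mul lam
    exact (Real.continuousAt_const_rpow (by positivity)).tendsto.comp (hδ.sub_const 1)
  have hR' : lam * (1 * M ^ ((1 : ℝ) - 1)) = lam := by simp
  rw [hR'] at hR
  refine le_of_tendsto_of_tendsto hL hR (hev.mono fun k hk => ?_)
  have e := hb k j
  have e' : sampleMean (fun i => weight (covar (z i)) γ * resid g m ψ (b k) (z i) * covar (z i) j)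
      = lam * (δ k * |b k j| ^ (δ k - 1) * Real.sign (b k j)) := by linarith
  have hδk := hδ1 k
  simp only [Function.comp_apply]
  rw [e', abs_mul, abs_of_nonneg hlam, abs_mul, abs_of_nonneg (by positivity)]
  refine mul_le_mul_of_nonneg_left ?_ hlam
  refine (mul_le_of_le_one_right (by positivity) (abs_sign_le_one _)).trans ?_
  refine mul_le_mul_of_nonneg_left ?_ (by linarith)
  exact Real.rpow_le_rpow (abs_nonneg _) hk (by linarith)

/-! ### Linear outcome models and sample means -/

theorem eq_sum_of_isLinearMap {p : ℕ} {f : (Fin p → ℝ) → ℝ} (hf : IsLinearMap ℝ f)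
    (β : Fin p → ℝ) : f β = ∑ j, β j * f (Pi.single j 1) := by
  have h := LinearMap.pi_apply_eq_sum_univ (hf.mk' f) β
  have e : ∀ j : Fin p, (fun i : Fin p => if j = i then (1 : ℝ) else 0) = Pi.single j 1 := by
    intro j; ext i; simp [Pi.single_apply, eq_comm]
  simpa [e] using h

theorem gradM_of_isLinearMap {p : ℕ} {m : (Fin p → ℝ) → (Fin p → ℝ) → ℝ}
    (hm : ∀ l, IsLinearMap ℝ (m l)) (l β : Fin p → ℝ) (j : Fin p) :
    gradM m l β j = m l (Pi.single j 1) := by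
  have h : HasFDerivAt (m l) (LinearMap.toContinuousLinearMap ((hm l).mk' (m l))) β :=
    (LinearMap.toContinuousLinearMap ((hm l).mk' (m l))).hasFDerivAt
  rw [gradM, h.fderiv]
  rfl

theorem abs_sum_mul_le_norm_mul_norm1 {p : ℕ} (u v : Fin p → ℝ) {B : ℝ} (hu : ∀ j, |u j| ≤ B) :
    |∑ j, v j * u j| ≤ B * norm1 v := by
  refine (Finset.abs_sum_le_sum_abs _ _).trans ?_
  rw [norm1, Finset.mul_sum]
  refine Finset.sum_le_sum fun j _ => ?_
  rw [abs_mul, mul_comm]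
  exact mul_le_mul_of_nonneg_right (hu j) (abs_nonneg _)

theorem sq_sampleMean_mul_le {n : ℕ} (u v : Fin n → ℝ) :
    sampleMean (fun i => u i * v i) ^ 2
      ≤ sampleMean (fun i => u i ^ 2) * sampleMean (fun i => v i ^ 2) := by
  have h := Finset.sum_mul_sq_le_sq_mul_sq Finset.univ u v
  simp only [sampleMean]
  have e : (1 / (n : ℝ) * ∑ i, u i * v i) ^ 2 = (1 / (n : ℝ)) ^ 2 * (∑ i, u i * v i) ^ 2 := by ring
  rw [e]
  calc _ ≤ (1 / (n : ℝ)) ^ 2 * ((∑ i, u i ^ 2) * ∑ i, v i ^ 2) := by gcongr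
    _ = _ := by ring

theorem sampleMean_add {n : ℕ} (u v : Fin n → ℝ) :
    sampleMean (fun i => u i + v i) = sampleMean u + sampleMean v := by
  simp only [sampleMean, Finset.sum_add_distrib]; ring

theorem sampleMean_sub {n : ℕ} (u v : Fin n → ℝ) :
    sampleMean (fun i => u i - v i) = sampleMean u - sampleMean v := by
  simp only [sampleMean, Finset.sum_sub_distrib]; ring

theorem sampleMean_const_mul {n : ℕ} (c : ℝ) (u : Fin n → ℝ) :
    sampleMean (fun i => c * u i) = c * sampleMean u := by
  simp only [sampleMean, ← Finset.mul_sum]; ring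

theorem abs_sampleMean_le {n : ℕ} (u : Fin n → ℝ) :
    |sampleMean u| ≤ sampleMean (fun i => |u i|) := by
  rw [sampleMean, abs_mul, abs_of_nonneg (by positivity), sampleMean]
  exact mul_le_mul_of_nonneg_left (Finset.abs_sum_le_sum_abs _ _) (by positivity)

theorem sampleVar_eq {n : ℕ} (hn : 0 < n) (u : Fin n → ℝ) :
    sampleVar u = sampleMean (fun i => u i ^ 2) - sampleMean u ^ 2 := by
  have hn' : (n : ℝ) ≠ 0 := by exact_mod_cast hn.ne'
  have e : ∀ i, (u i - sampleMean u) ^ 2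
      = u i ^ 2 - (2 * sampleMean u) * u i + sampleMean u ^ 2 := fun i => by ring
  have hc : sampleMean (fun _ : Fin n => sampleMean u ^ 2) = sampleMean u ^ 2 := by
    simp only [sampleMean, Finset.sum_const, Finset.card_univ, Fintype.card_fin, nsmul_eq_mul]
    field_simp
  rw [sampleVar]
  simp only [e]
  rw [sampleMean_add, sampleMean_sub, sampleMean_const_mul, hc]
  ring

/-! ### Consequences of the union model for a single law -/

/-- The design variables `(A, L)` of an observation; they generate `sigmaAL`. -/
abbrev design {p : ℕ} (z : Obs p) : ℝ × (Fin p → ℝ) := (exposure z, covar z)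

section Law

variable {p : ℕ} {g : Link} {m : (Fin p → ℝ) → (Fin p → ℝ) → ℝ} {Q : DGP p}

theorem measurable_exposure : Measurable (fun z : Obs p => exposure z) :=
  measurable_fst.comp measurable_snd

theorem measurable_covar : Measurable (fun z : Obs p => covar z) :=
  measurable_snd.comp measurable_snd

theorem measurable_design : Measurable (design : Obs p → ℝ × (Fin p → ℝ)) := measurable_snd

theorem measurable_dotProduct : Measurable fun q : (Fin p → ℝ) × (Fin p → ℝ) => q.2 ⬝ᵥ q.1 := by
  unfold dotProduct
  fun_prop

theorem measurable_propensity :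
    Measurable fun q : (Fin p → ℝ) × (Fin p → ℝ) => propensity q.1 q.2 :=
  differentiable_sigmoid.continuous.measurable.comp measurable_dotProduct

theorem measurable_propensity_left (γ : Fin p → ℝ) : Measurable fun l => propensity l γ :=
  measurable_propensity.comp (measurable_id.prodMk measurable_const)

theorem propensity_pos (l γ : Fin p → ℝ) : 0 < propensity l γ := Real.sigmoid_pos _

theorem propensity_lt_one (l γ : Fin p → ℝ) : propensity l γ < 1 := Real.sigmoid_lt_one _

theorem measurable_H (ψ : ℝ) : Measurable (H (p := p) g ψ) := by
  cases g <;> unfold H <;> fun_prop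

theorem measurable_resid (hm : ∀ β, Measurable fun l => m l β) (ψ : ℝ) (β : Fin p → ℝ) :
    Measurable (resid g m ψ β) :=
  (measurable_H ψ).sub ((hm β).comp measurable_covar)

theorem measurable_score (hm : ∀ β, Measurable fun l => m l β) (ψ : ℝ) (γ β : Fin p → ℝ) :
    Measurable (score g m ψ γ β) :=
  (measurable_exposure.sub ((measurable_propensity_left γ).comp measurable_covar)).mul
    (measurable_resid hm ψ β)

theorem sigmaAL_le : sigmaAL p ≤ (inferInstance : MeasurableSpace (Obs p)) :=
  measurable_design.comap_le

theorem sigmaL_le : sigmaL p ≤ (inferInstance : MeasurableSpace (Obs p)) :=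
  measurable_covar.comap_le

theorem stronglyMeasurable_sigmaAL {f : ℝ × (Fin p → ℝ) → ℝ} (hf : Measurable f) :
    StronglyMeasurable[sigmaAL p] fun z => f (design z) :=
  (hf.comp (comap_measurable (design : Obs p → _))).stronglyMeasurable

theorem stronglyMeasurable_sigmaL {f : (Fin p → ℝ) → ℝ} (hf : Measurable f) :
    StronglyMeasurable[sigmaL p] fun z => f (covar z) :=
  (hf.comp (comap_measurable (fun z : Obs p => covar z))).stronglyMeasurable

theorem abs_exposure_sub_le {z : Obs p} (hz : exposure z = 0 ∨ exposure z = 1)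
    (γ : Fin p → ℝ) : |exposure z - propensity (covar z) γ| ≤ 1 := by
  have h0 := propensity_pos (covar z) γ
  have h1 := propensity_lt_one (covar z) γ
  rw [abs_le]
  rcases hz with h | h <;> rw [h] <;> constructor <;> linarith

theorem pow_four_le_one_add_rpow {x r : ℝ} (hr : 4 < r) : x ^ 4 ≤ 1 + |x| ^ r := by
  have h : x ^ 4 = |x| ^ (4 : ℝ) := by
    rw [show (4 : ℝ) = ((4 : ℕ) : ℝ) by norm_num, Real.rpow_natCast, ← abs_pow,
      abs_of_nonneg (by positivity)]
  rw [h]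
  rcases le_total |x| 1 with hx | hx
  · have := Real.rpow_le_one (abs_nonneg x) hx (by norm_num : (0 : ℝ) ≤ 4)
    have : 0 ≤ |x| ^ r := by positivity
    linarith
  · have := Real.rpow_le_rpow_of_exponent_le hx hr.le
    linarith

theorem integrable_pow_four_of_rpow {β : Type*} [MeasurableSpace β] {ν : Measure β}
    [IsProbabilityMeasure ν] {X : β → ℝ} (hX : Measurable X) {r C : ℝ} (hr : 4 < r)
    (hi : Integrable (fun a => |X a| ^ r) ν) (hC : ∫ a, |X a| ^ r ∂ν ≤ C) :
    Integrable (fun a => X a ^ 4) ν ∧ ∫ a, X a ^ 4 ∂ν ≤ 1 + C := by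
  have hi' : Integrable (fun a => 1 + |X a| ^ r) ν := (integrable_const 1).add hi
  have h4 : Integrable (fun a => X a ^ 4) ν := by
    refine hi'.mono' (hX.pow_const 4).aestronglyMeasurable (Eventually.of_forall fun a => ?_)
    rw [Real.norm_of_nonneg (by positivity)]
    exact pow_four_le_one_add_rpow hr
  refine ⟨h4, (integral_mono h4 hi' fun a => pow_four_le_one_add_rpow hr).trans ?_⟩
  rw [integral_add (integrable_const 1) hi]
  simpa using hC

theorem integrable_exposure (hbin : BinaryExposure Q) :
    Integrable (fun z => exposure z) Q.law := by
  refine Integrable.of_bound measurable_exposure.aestronglyMeasurable 1 ?_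
  filter_upwards [hbin] with z hz
  rcases hz with h | h <;> simp [h]

/-- Under model `𝓜` the transformed outcome `H(ψ₀)` has conditional mean `E(Y | A = 0, L)` given
`(A, L)`, for either link. -/
theorem condExp_H (hbin : BinaryExposure Q) {μ : ℝ → (Fin p → ℝ) → ℝ} (hM : ModelM g Q μ) :
    Q.law[H g Q.ψ₀ | sigmaAL p] =ᵐ[Q.law] fun z => μ 0 (covar z) := by
  obtain ⟨⟨-, hY, hreg⟩, hlink⟩ := hM
  cases g with
  | identity =>
    have hA : Integrable (fun z : Obs p => Q.ψ₀ * exposure z) Q.law :=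
      (integrable_exposure hbin).const_mul _
    have hsub := condExp_sub hY hA (sigmaAL p)
    have hAc : Q.law[fun z : Obs p => Q.ψ₀ * exposure z | sigmaAL p]
        = fun z : Obs p => Q.ψ₀ * exposure z :=
      condExp_of_stronglyMeasurable sigmaAL_le
        (stronglyMeasurable_sigmaAL (f := fun v => Q.ψ₀ * v.1) (measurable_fst.const_mul _)) hA
    have e : H .identity Q.ψ₀ = (fun z : Obs p => outcome z) - fun z : Obs p => Q.ψ₀ * exposure z :=
      rfl
    rw [e]
    filter_upwards [hsub, hreg, hlink, hbin] with z h1 h2 h3 h4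
    rw [h1, Pi.sub_apply, h2, hAc]
    have := (h3 (exposure z) (by simpa using h4)).2
    simp only [Link.g] at this
    linarith
  | log =>
    have hf : Measurable fun v : ℝ × (Fin p → ℝ) => Real.exp (-(Q.ψ₀ * v.1)) := by fun_prop
    have hbd : ∀ᵐ z ∂Q.law, ‖Real.exp (-(Q.ψ₀ * exposure z))‖ ≤ 1 + Real.exp (-Q.ψ₀) := by
      filter_upwards [hbin] with z hz
      have := Real.exp_pos (-Q.ψ₀)
      rcases hz with h | h <;> rw [h, Real.norm_of_nonneg (Real.exp_pos _).le] <;> simp [this.le]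
    have hi : Integrable (fun z : Obs p => Real.exp (-(Q.ψ₀ * exposure z)) * outcome z) Q.law :=
      hY.bdd_mul (hf.comp measurable_design).aestronglyMeasurable hbd
    have e : H .log Q.ψ₀
        = (fun z : Obs p => Real.exp (-(Q.ψ₀ * exposure z))) * fun z : Obs p => outcome z := by
      ext z; simp [H, mul_comm]
    rw [e]
    filter_upwards [condExp_mul_of_stronglyMeasurable_left (stronglyMeasurable_sigmaAL hf) hi hY,
      hreg, hlink, hbin] with z h1 h2 h3 h4
    rw [h1, Pi.mul_apply, h2]
    have ha := h3 (exposure z) (by simpa using h4)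
    have h0 := h3 0 (by simp)
    have ha0 : 0 < μ (exposure z) (covar z) := ha.1
    have h00 : 0 < μ 0 (covar z) := h0.1
    have hl : Real.log (μ (exposure z) (covar z)) = Real.log (μ 0 (covar z)) + Q.ψ₀ * exposure z := by
      have := ha.2
      simp only [Link.g] at this
      linarith
    have hx : μ (exposure z) (covar z) = μ 0 (covar z) * Real.exp (Q.ψ₀ * exposure z) := by
      rw [← Real.exp_log ha0, hl, Real.exp_add, Real.exp_log h00]
    show Real.exp (-(Q.ψ₀ * exposure z)) * μ (exposure z) (covar z) = _
    rw [hx, mul_left_comm, ← Real.exp_add]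
    simp

theorem integrable_H (hbin : BinaryExposure Q) {μ : ℝ → (Fin p → ℝ) → ℝ} (hM : ModelM g Q μ) :
    Integrable (H g Q.ψ₀) Q.law := by
  have hY := hM.1.2.1
  cases g with
  | identity => exact hY.sub ((integrable_exposure hbin).const_mul _)
  | log =>
    refine (hY.norm.mul_const (1 + Real.exp (-Q.ψ₀))).mono' (measurable_H _).aestronglyMeasurable ?_
    filter_upwards [hbin] with z hz
    have := Real.exp_pos (-Q.ψ₀)
    simp only [H, norm_mul, Real.norm_of_nonneg (Real.exp_pos _).le]
    refine mul_le_mul_of_nonneg_left ?_ (norm_nonneg _)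
    rcases hz with h | h <;> rw [h] <;> simp [this.le]

theorem condExp_resid (hm : ∀ β, Measurable fun l => m l β) (hbin : BinaryExposure Q)
    {μ : ℝ → (Fin p → ℝ) → ℝ} (hM : ModelM g Q μ)
    (hε : Integrable (resid g m Q.ψ₀ Q.β₀) Q.law) :
    Q.law[resid g m Q.ψ₀ Q.β₀ | sigmaAL p]
      =ᵐ[Q.law] fun z => μ 0 (covar z) - m (covar z) Q.β₀ := by
  have hH := integrable_H hbin hM
  have hmi : Integrable (fun z => m (covar z) Q.β₀) Q.law := by
    refine (hH.sub hε).congr (Eventually.of_forall fun z => ?_)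
    simp [resid]
  have hmc : Q.law[fun z => m (covar z) Q.β₀ | sigmaAL p] = fun z => m (covar z) Q.β₀ :=
    condExp_of_stronglyMeasurable sigmaAL_le
      (stronglyMeasurable_sigmaAL (f := fun v => m v.2 Q.β₀) ((hm _).comp measurable_snd)) hmi
  have e : resid g m Q.ψ₀ Q.β₀ = H g Q.ψ₀ - fun z => m (covar z) Q.β₀ := rfl
  rw [e]
  filter_upwards [condExp_sub hH hmi (sigmaAL p), condExp_H hbin hM] with z h1 h2
  rw [h1, Pi.sub_apply, h2, hmc]

theorem ae_abs_exposure_sub_le (hbin : BinaryExposure Q) :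
    ∀ᵐ z ∂Q.law, |exposure z - propensity (covar z) Q.γ₀| ≤ 1 := by
  filter_upwards [hbin] with z hz using abs_exposure_sub_le hz _

theorem measurable_exposure_sub (γ : Fin p → ℝ) :
    Measurable fun v : ℝ × (Fin p → ℝ) => v.1 - propensity v.2 γ :=
  measurable_fst.sub ((measurable_propensity_left γ).comp measurable_snd)

theorem integrable_propensity (Q : DGP p) (γ : Fin p → ℝ) :
    Integrable (fun z => propensity (covar z) γ) Q.law :=
  Integrable.of_bound ((measurable_propensity_left γ).comp measurable_covar).aestronglyMeasurable 1
    (Eventually.of_forall fun z => by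
      rw [Real.norm_of_nonneg (propensity_pos _ _).le]; exact (propensity_lt_one _ _).le)

/-- Double robustness: the score at the true parameters has mean zero as soon as one of the two
working models is correct. -/
theorem integral_score_eq_zero (hm : ∀ β, Measurable fun l => m l β) (hbin : BinaryExposure Q)
    (hunion : UnionModel g m Q) (hε : Integrable (resid g m Q.ψ₀ Q.β₀) Q.law) :
    ∫ z, score g m Q.ψ₀ Q.γ₀ Q.β₀ z ∂Q.law = 0 := by
  obtain ⟨μ, hM, hAB⟩ := hunion
  have h1 := integral_comp_mul_condExp measurable_design (measurable_exposure_sub Q.γ₀)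
    (ae_abs_exposure_sub_le hbin) hε
  have hce := condExp_resid hm hbin hM hε
  have h2 : ∫ z, score g m Q.ψ₀ Q.γ₀ Q.β₀ z ∂Q.law = ∫ z, (exposure z - propensity (covar z) Q.γ₀)
      * (μ 0 (covar z) - m (covar z) Q.β₀) ∂Q.law := by
    refine h1.trans (integral_congr_ae ?_)
    filter_upwards [hce] with z hz
    have hz' : (Q.law[resid g m Q.ψ₀ Q.β₀ | MeasurableSpace.comap design inferInstance]) z
        = μ 0 (covar z) - m (covar z) Q.β₀ := hz
    rw [hz']
  rw [h2]
  rcases hAB with hA | hB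
  · have hei : Integrable (fun z => μ 0 (covar z) - m (covar z) Q.β₀) Q.law :=
      integrable_condExp.congr hce
    have hem : Measurable fun l => μ 0 l - m l Q.β₀ :=
      (hM.1.1.comp (measurable_const.prodMk measurable_id)).sub (hm _)
    have hai : Integrable (fun z => exposure z - propensity (covar z) Q.γ₀) Q.law :=
      (integrable_exposure hbin).sub (integrable_propensity Q _)
    have hpi : Integrable (fun z => (exposure z - propensity (covar z) Q.γ₀)
        * (μ 0 (covar z) - m (covar z) Q.β₀)) Q.law :=
      hei.bdd_mul ((measurable_exposure_sub Q.γ₀).comp measurable_design).aestronglyMeasurable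
        (ae_abs_exposure_sub_le hbin)
    rw [← integral_condExp sigmaL_le]
    refine integral_eq_zero_of_ae ?_
    have hpc : Q.law[fun z => propensity (covar z) Q.γ₀ | sigmaL p]
        = fun z => propensity (covar z) Q.γ₀ :=
      condExp_of_stronglyMeasurable sigmaL_le
        (stronglyMeasurable_sigmaL (measurable_propensity_left _)) (integrable_propensity Q _)
    filter_upwards [condExp_mul_of_stronglyMeasurable_right (stronglyMeasurable_sigmaL hem) hpi hai,
      condExp_sub (integrable_exposure hbin) (integrable_propensity Q Q.γ₀) (sigmaL p), hA]
      with z k1 k2 k3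
    refine k1.trans ?_
    have k2' : (Q.law[fun z => exposure z - propensity (covar z) Q.γ₀ | sigmaL p]) z = _ := k2
    rw [Pi.mul_apply, k2', Pi.sub_apply, k3, hpc]
    simp
  · refine integral_eq_zero_of_ae ?_
    have hB' : ∀ᵐ z ∂Q.law, μ 0 (covar z) = m (covar z) Q.β₀ := hB
    filter_upwards [hB'] with z hz
    simp [hz]

theorem condExp_sq_exposure_sub (hbin : BinaryExposure Q) (hA : ModelA Q) :
    Q.law[fun z => (exposure z - propensity (covar z) Q.γ₀) ^ 2 | sigmaL p]
      =ᵐ[Q.law] fun z => weight (covar z) Q.γ₀ := by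
  have hpm := measurable_propensity_left Q.γ₀
  have hfm : Measurable fun l => 1 - 2 * propensity l Q.γ₀ := (hpm.const_mul 2).const_sub 1
  have h1i : Integrable (fun z => (1 - 2 * propensity (covar z) Q.γ₀) * exposure z) Q.law := by
    refine (integrable_exposure hbin).bdd_mul (c := 1) (hfm.comp measurable_covar).aestronglyMeasurable
      (Eventually.of_forall fun z => ?_)
    have := propensity_pos (covar z) Q.γ₀
    have := propensity_lt_one (covar z) Q.γ₀
    rw [Real.norm_eq_abs, abs_le]
    constructor <;> linarith
  have h2i : Integrable (fun z => propensity (covar z) Q.γ₀ ^ 2) Q.law := by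
    refine Integrable.of_bound ((hpm.comp measurable_covar).pow_const 2).aestronglyMeasurable 1
      (Eventually.of_forall fun z => ?_)
    rw [Real.norm_of_nonneg (by positivity)]
    exact pow_le_one₀ (propensity_pos _ _).le (propensity_lt_one _ _).le
  have hcongr : (fun z => (exposure z - propensity (covar z) Q.γ₀) ^ 2) =ᵐ[Q.law]
      (fun z => (1 - 2 * propensity (covar z) Q.γ₀) * exposure z)
        + fun z => propensity (covar z) Q.γ₀ ^ 2 := by
    filter_upwards [hbin] with z hz
    simp only [Pi.add_apply]
    rcases hz with h | h <;> rw [h] <;> ring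
  have hpc : Q.law[fun z => propensity (covar z) Q.γ₀ ^ 2 | sigmaL p]
      = fun z => propensity (covar z) Q.γ₀ ^ 2 :=
    condExp_of_stronglyMeasurable sigmaL_le (stronglyMeasurable_sigmaL (hpm.pow_const 2)) h2i
  refine (condExp_congr_ae hcongr).trans ?_
  filter_upwards [condExp_add h1i h2i (sigmaL p), condExp_mul_of_stronglyMeasurable_left
    (stronglyMeasurable_sigmaL hfm) h1i (integrable_exposure hbin), hA] with z k1 k2 k3
  have k2' : (Q.law[fun z => (1 - 2 * propensity (covar z) Q.γ₀) * exposure z | sigmaL p]) z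
      = _ := k2
  rw [k1, Pi.add_apply, k2', Pi.mul_apply, k3, hpc, weight]
  ring

/-- Lower bound for the variance of the score in terms of the conditional variances of its two
factors. -/
theorem le_integral_score_sq (hm : ∀ β, Measurable fun l => m l β) (hbin : BinaryExposure Q)
    (h4 : Integrable (fun z => resid g m Q.ψ₀ Q.β₀ z ^ 4) Q.law) {c : ℝ} (hc : 0 ≤ c) :
    c * (c * Q.law.real {z | c < (Q.law[fun y => (exposure y - propensity (covar y) Q.γ₀) ^ 2
        | sigmaL p]) z}
      - Q.law.real {z | c < (Q.law[fun y => resid g m Q.ψ₀ Q.β₀ y ^ 2 | sigmaAL p]) z}ᶜ)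
      ≤ ∫ z, score g m Q.ψ₀ Q.γ₀ Q.β₀ z ^ 2 ∂Q.law := by
  have h2i : Integrable (fun z => resid g m Q.ψ₀ Q.β₀ z ^ 2) Q.law :=
    ((memLp_four_of_integrable_pow (measurable_resid hm _ _).aestronglyMeasurable h4).mono_exponent
      (p := 2) (by norm_num)).integrable_sq
  set a : Obs p → ℝ := fun y => (exposure y - propensity (covar y) Q.γ₀) ^ 2 with ha
  set s := Q.law[a | sigmaL p] with hs
  set h2 := Q.law[fun y => resid g m Q.ψ₀ Q.β₀ y ^ 2 | sigmaAL p] with hh2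
  have ham : Measurable a := ((measurable_exposure_sub Q.γ₀).comp measurable_design).pow_const 2
  have ha1 : ∀ᵐ z ∂Q.law, |a z| ≤ 1 := by
    filter_upwards [ae_abs_exposure_sub_le hbin] with z hz
    rw [ha, abs_pow]
    exact pow_le_one₀ (abs_nonneg _) hz
  have hai : Integrable a Q.law := Integrable.of_bound ham.aestronglyMeasurable 1 ha1
  have hs0 : 0 ≤ᵐ[Q.law] s := condExp_nonneg (Eventually.of_forall fun z => sq_nonneg _)
  have hh0 : 0 ≤ᵐ[Q.law] h2 := condExp_nonneg (Eventually.of_forall fun z => sq_nonneg _)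
  have hsm : MeasurableSet {z | c < s z} :=
    measurableSet_lt measurable_const (stronglyMeasurable_condExp.mono sigmaL_le).measurable
  have hhm : MeasurableSet {z | c < h2 z} :=
    measurableSet_lt measurable_const (stronglyMeasurable_condExp.mono sigmaAL_le).measurable
  have e1 : ∫ z, score g m Q.ψ₀ Q.γ₀ Q.β₀ z ^ 2 ∂Q.law = ∫ z, a z * h2 z ∂Q.law := by
    have h1 := integral_comp_mul_condExp measurable_design
      ((measurable_exposure_sub Q.γ₀).pow_const 2) ha1 h2i
    rw [show (fun z => a z * h2 z) = fun z => (exposure z - propensity (covar z) Q.γ₀) ^ 2 *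
      (Q.law[fun y => resid g m Q.ψ₀ Q.β₀ y ^ 2 | MeasurableSpace.comap design inferInstance]) z
      from rfl, ← h1]
    exact integral_congr_ae (Eventually.of_forall fun z => by simp only [score]; ring)
  have e2 : ∫ z, a z ∂Q.law = ∫ z, s z ∂Q.law := (integral_condExp sigmaL_le).symm
  have e3 : c * Q.law.real {z | c < s z} ≤ ∫ z, s z ∂Q.law := by
    have : ∫ z, {z | c < s z}.indicator (fun _ => c) z ∂Q.law = c * Q.law.real {z | c < s z} := by
      rw [integral_indicator_const _ hsm, smul_eq_mul, mul_comm]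
    rw [← this]
    refine integral_mono_ae ((integrable_const c).indicator hsm) integrable_condExp ?_
    filter_upwards [hs0] with z hz
    simp only [Set.indicator, Set.mem_ofPred_eq]
    split_ifs with h
    · exact h.le
    · exact hz
  have e4 : c * (∫ z, a z ∂Q.law - Q.law.real {z | c < h2 z}ᶜ) ≤ ∫ z, a z * h2 z ∂Q.law := by
    have hii : Integrable ({z | c < h2 z}ᶜ.indicator fun _ : Obs p => (1 : ℝ)) Q.law :=
      (integrable_const 1).indicator hhm.compl
    have : ∫ z, c * (a z - {z | c < h2 z}ᶜ.indicator (fun _ => 1) z) ∂Q.law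
        = c * (∫ z, a z ∂Q.law - Q.law.real {z | c < h2 z}ᶜ) := by
      rw [integral_const_mul, integral_sub hai hii, integral_indicator_const _ hhm.compl]
      simp
    rw [← this]
    refine integral_mono_ae ((hai.sub hii).const_mul c)
      (integrable_condExp.bdd_mul ham.aestronglyMeasurable ha1) ?_
    filter_upwards [hh0, ha1] with z hz hz1
    have haz : 0 ≤ a z := sq_nonneg _
    rw [abs_of_nonneg haz] at hz1
    have hz' : 0 ≤ h2 z := hz
    simp only [Set.indicator, Set.mem_compl_iff, Set.mem_ofPred_eq]
    split_ifs with h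
    · have : 0 ≤ a z * h2 z := mul_nonneg haz hz'
      nlinarith
    · push Not at h
      nlinarith
  rw [e1]
  refine le_trans (mul_le_mul_of_nonneg_left ?_ hc) e4
  rw [e2]
  linarith

end Law

/-! ### Remainder terms and the empirical variance -/

section Remainders

variable {Ω : ℕ → Type*} [∀ n, MeasurableSpace (Ω n)] {P : ∀ n, Measure (Ω n)}

theorem isLittleOP_sqrt_of_sq_le {X Y : ∀ n, Ω n → ℝ} {E : ∀ n, Set (Ω n)}
    (hY : IsLittleOP P Y) (hE : HoldsWHP P E)
    (h : ∀ᶠ n in atTop, ∀ ω ∈ E n, X n ω ^ 2 ≤ Y n ω) : IsLittleOP P X := by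
  refine IsLittleOP.of_sq (hY.mono hE (h.mono fun n hn ω hω => ?_))
  rw [abs_sq]
  exact (hn ω hω).trans (le_abs_self _)

theorem holdsWHP_univ : HoldsWHP P (fun _ => Set.univ) := by simp [HoldsWHP]

/-- Cauchy–Schwarz for the product of the two prediction errors. -/
theorem isLittleOP_sqrt_mul_sampleMean_prod {d e : ∀ n, Ω n → Fin n → ℝ} {r s : ℕ → ℝ}
    (hr0 : ∀ n, 0 ≤ r n) (hs0 : ∀ n, 0 ≤ s n)
    (hd : IsBigOP P (fun n ω => sampleMean (fun i => d n ω i ^ 2)) r)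
    (he : IsBigOP P (fun n ω => sampleMean (fun i => e n ω i ^ 2)) s)
    (hrs : Tendsto (fun n : ℕ => (n : ℝ) * (r n * s n)) atTop (𝓝 0)) :
    IsLittleOP P (fun n ω => (n : ℝ) *
      (sampleMean (fun i => d n ω i ^ 2) * sampleMean (fun i => e n ω i ^ 2))) := by
  have hn : IsBigOP P (fun n _ => (n : ℝ)) (fun n => (n : ℝ)) :=
    IsBigOP.of_isBigO (Asymptotics.isBigO_refl _ _) fun n => Nat.cast_nonneg n
  exact (hn.mul (hd.mul he hr0 hs0) (fun n => Nat.cast_nonneg n)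
    fun n => mul_nonneg (hr0 n) (hs0 n)).isLittleOP hrs

theorem IsLittleOP.mul_isBigOP_one {X Y : ∀ n, Ω n → ℝ} (hX : IsLittleOP P X)
    (hY : IsBigOP P Y (fun _ => 1)) : IsLittleOP P (fun n ω => X n ω * Y n ω) := by
  refine IsLittleOP.of_truncate hY fun K => ?_
  refine (hX.const_mul (max K 0)).mono' (Eventually.of_forall fun n ω => ?_)
  by_cases h : |Y n ω| ≤ K * 1
  · rw [Set.indicator_of_mem (by exact h), abs_mul, abs_mul, abs_of_nonneg (le_max_right K 0),
      mul_comm]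
    exact mul_le_mul_of_nonneg_right ((h.trans (by simp)).trans (le_max_left K 0)) (abs_nonneg _)
  · rw [Set.indicator_of_notMem (by exact h), abs_zero]
    exact abs_nonneg _

/-- Replacing the nuisance parameters by consistent estimates changes the empirical second moment
of the score `(a + d) (ε + e)` by `o_P(1)`. -/
theorem isLittleOP_sampleMean_sq_sub {a d ε e : ∀ n, Ω n → Fin n → ℝ} {E : ∀ n, Set (Ω n)}
    (hE : HoldsWHP P E) (ha : ∀ n, ∀ ω ∈ E n, ∀ i, |a n ω i| ≤ 1)
    (hd1 : ∀ n ω i, |d n ω i| ≤ 1)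
    (hd : IsLittleOP P (fun n ω => sampleMean (fun i => d n ω i ^ 2)))
    (he : IsLittleOP P (fun n ω => sampleMean (fun i => e n ω i ^ 2)))
    (h4 : IsBigOP P (fun n ω => sampleMean (fun i => ε n ω i ^ 4)) (fun _ => 1))
    (hU : IsBigOP P (fun n ω => sampleMean (fun i => (a n ω i * ε n ω i) ^ 2)) (fun _ => 1)) :
    IsLittleOP P (fun n ω =>
      sampleMean (fun i => ((a n ω i + d n ω i) * (ε n ω i + e n ω i)) ^ 2)
        - sampleMean (fun i => (a n ω i * ε n ω i) ^ 2)) := by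
  have hdε : IsLittleOP P (fun n ω => sampleMean (fun i => d n ω i ^ 2 * ε n ω i ^ 2)) := by
    refine isLittleOP_sqrt_of_sq_le (hd.mul_isBigOP_one h4) holdsWHP_univ
      (Eventually.of_forall fun n ω _ => ?_)
    refine (sq_sampleMean_mul_le _ _).trans ?_
    have e4 : ∀ i, (ε n ω i ^ 2) ^ 2 = ε n ω i ^ 4 := fun i => by ring
    simp only [e4]
    refine mul_le_mul_of_nonneg_right (sampleMean_mono fun i => ?_)
      (sampleMean_nonneg fun i => by positivity)
    have h1 : d n ω i ^ 2 ≤ 1 := by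
      rw [← sq_abs]; exact pow_le_one₀ (abs_nonneg _) (hd1 n ω i)
    have h0 : 0 ≤ d n ω i ^ 2 := sq_nonneg _
    nlinarith
  set D : ∀ n, Ω n → Fin n → ℝ := fun n ω i =>
    (a n ω i + d n ω i) * (ε n ω i + e n ω i) - a n ω i * ε n ω i with hD
  have hD2 : IsLittleOP P (fun n ω => sampleMean (fun i => D n ω i ^ 2)) := by
    refine ((hdε.const_mul 3).add (he.const_mul 6)).mono hE
      (Eventually.of_forall fun n ω hω => ?_)
    rw [abs_of_nonneg (sampleMean_nonneg fun i => sq_nonneg _)]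
    refine le_trans ?_ (le_abs_self _)
    rw [← sampleMean_const_mul, ← sampleMean_const_mul, ← sampleMean_add]
    refine sampleMean_mono fun i => ?_
    have h1 : d n ω i ^ 2 ≤ 1 := by
      rw [← sq_abs]; exact pow_le_one₀ (abs_nonneg _) (hd1 n ω i)
    have h2 : a n ω i ^ 2 ≤ 1 := by
      rw [← sq_abs]; exact pow_le_one₀ (abs_nonneg _) (ha n ω hω i)
    have h3 : (d n ω i * e n ω i) ^ 2 ≤ e n ω i ^ 2 := by
      rw [mul_pow]; exact mul_le_of_le_one_left (sq_nonneg _) h1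
    have h5 : (a n ω i * e n ω i) ^ 2 ≤ e n ω i ^ 2 := by
      rw [mul_pow]; exact mul_le_of_le_one_left (sq_nonneg _) h2
    have e1 : D n ω i = d n ω i * ε n ω i + a n ω i * e n ω i + d n ω i * e n ω i := by
      simp only [hD]; ring
    rw [e1, ← mul_pow]
    generalize d n ω i * ε n ω i = x at *
    generalize a n ω i * e n ω i = y at *
    generalize d n ω i * e n ω i = w at *
    nlinarith [sq_nonneg (x - y), sq_nonneg (y - w), sq_nonneg (x - w)]
  have hUD : IsLittleOP P (fun n ω => sampleMean (fun i => D n ω i * (a n ω i * ε n ω i))) :=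
    isLittleOP_sqrt_of_sq_le (hD2.mul_isBigOP_one hU) holdsWHP_univ
      (Eventually.of_forall fun n ω _ => sq_sampleMean_mul_le _ _)
  refine (hD2.add (hUD.const_mul 2)).mono' (Eventually.of_forall fun n ω => le_of_eq ?_)
  rw [← sampleMean_sub, ← sampleMean_const_mul, ← sampleMean_add]
  congr 2
  ext i
  simp only [hD]
  ring

end Remainders

/-! ### Rates under ultra-sparsity -/

section Rates

theorem logDim_nonneg (p : ℕ → ℕ) (n : ℕ) : 0 ≤ logDim p n := Real.log_natCast_nonneg _

theorem tendsto_rate_of_sq_le {p : ℕ → ℕ} {Q : ∀ n, DGP (p n)} (hs : UltraSparse Q) {s : ℕ → ℝ}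
    (hs0 : ∀ n, 0 ≤ s n)
    (h : ∀ n, s n ^ 2 ≤ (sparsity (Q n).γ₀ : ℝ) ^ 2 + (sparsity (Q n).β₀ : ℝ) ^ 2) :
    Tendsto (fun n : ℕ => √(n : ℝ) * (s n * logDim p n / n)) atTop (𝓝 0) := by
  have h1 := hs.tendsto_div_nhds_zero
  have h2 := (Real.continuous_sqrt.tendsto 0).comp h1
  rw [Real.sqrt_zero] at h2
  refine tendsto_of_tendsto_of_tendsto_of_le_of_le' tendsto_const_nhds h2 ?_ ?_
  · exact Eventually.of_forall fun n => mul_nonneg (Real.sqrt_nonneg _)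
      (div_nonneg (mul_nonneg (hs0 n) (logDim_nonneg p n)) (Nat.cast_nonneg n))
  · filter_upwards [eventually_gt_atTop 0] with n hn
    have hn' : (0 : ℝ) < n := by exact_mod_cast hn
    refine Real.le_sqrt_of_sq_le ?_
    rw [mul_pow, Real.sq_sqrt hn'.le, div_pow, mul_pow]
    have e : (n : ℝ) * (s n ^ 2 * logDim p n ^ 2 / (n : ℝ) ^ 2) = s n ^ 2 * logDim p n ^ 2 / n := by
      field_simp
    rw [e]
    exact div_le_div_of_nonneg_right (mul_le_mul_of_nonneg_right (h n) (sq_nonneg _)) hn'.le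

theorem tendsto_of_tendsto_sqrt_mul {u : ℕ → ℝ} (hu0 : ∀ n, 0 ≤ u n)
    (h : Tendsto (fun n : ℕ => √(n : ℝ) * u n) atTop (𝓝 0)) : Tendsto u atTop (𝓝 0) := by
  refine tendsto_of_tendsto_of_tendsto_of_le_of_le' tendsto_const_nhds h
    (Eventually.of_forall hu0) ?_
  filter_upwards [eventually_gt_atTop 0] with n hn
  have h1 : (1 : ℝ) ≤ √(n : ℝ) := by
    rw [Real.one_le_sqrt]; exact_mod_cast hn
  exact le_mul_of_one_le_left (hu0 n) h1

theorem sq_sparsity_le {p : ℕ} (Q : DGP p) :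
    (sparsity Q.γ₀ : ℝ) ^ 2 ≤ (sparsity Q.γ₀ : ℝ) ^ 2 + (sparsity Q.β₀ : ℝ) ^ 2 := by
  have := sq_nonneg (sparsity Q.β₀ : ℝ); linarith

theorem sq_maxSparsity_le {p : ℕ} (Q : DGP p) :
    (maxSparsity Q : ℝ) ^ 2 ≤ (sparsity Q.γ₀ : ℝ) ^ 2 + (sparsity Q.β₀ : ℝ) ^ 2 := by
  have h1 := sq_nonneg (sparsity Q.γ₀ : ℝ)
  have h2 := sq_nonneg (sparsity Q.β₀ : ℝ)
  rw [maxSparsity]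
  rcases max_cases (sparsity Q.γ₀) (sparsity Q.β₀) with ⟨h, -⟩ | ⟨h, -⟩ <;> rw [h] <;> linarith

theorem rate_nonneg (p : ℕ → ℕ) (s : ℕ → ℕ) (n : ℕ) : (0 : ℝ) ≤ s n * logDim p n / n :=
  div_nonneg (mul_nonneg (Nat.cast_nonneg _) (logDim_nonneg p n)) (Nat.cast_nonneg n)

theorem tendsto_rate_sparsity {p : ℕ → ℕ} {Q : ∀ n, DGP (p n)} (hs : UltraSparse Q) :
    Tendsto (fun n : ℕ => √(n : ℝ) * (sparsity (Q n).γ₀ * logDim p n / n)) atTop (𝓝 0) :=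
  tendsto_rate_of_sq_le hs (fun _ => Nat.cast_nonneg _) fun n => sq_sparsity_le (Q n)

theorem tendsto_rate_maxSparsity {p : ℕ → ℕ} {Q : ∀ n, DGP (p n)} (hs : UltraSparse Q) :
    Tendsto (fun n : ℕ => √(n : ℝ) * (maxSparsity (Q n) * logDim p n / n)) atTop (𝓝 0) :=
  tendsto_rate_of_sq_le hs (fun _ => Nat.cast_nonneg _) fun n => sq_maxSparsity_le (Q n)

theorem tendsto_rate_mul_rate {p : ℕ → ℕ} {Q : ∀ n, DGP (p n)} (hs : UltraSparse Q) :
    Tendsto (fun n : ℕ => (n : ℝ) * ((sparsity (Q n).γ₀ * logDim p n / n)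
      * (maxSparsity (Q n) * logDim p n / n))) atTop (𝓝 0) := by
  have := (tendsto_rate_sparsity hs).mul (tendsto_rate_maxSparsity hs)
  rw [mul_zero] at this
  refine this.congr fun n => ?_
  have := Real.mul_self_sqrt (Nat.cast_nonneg n : (0 : ℝ) ≤ n)
  linear_combination ((sparsity (Q n).γ₀ * logDim p n / n)
    * (maxSparsity (Q n) * logDim p n / n)) * this

end Rates

/-! ### The effect of estimating the nuisance parameters -/

section Deterministic

variable {n p : ℕ} {g : Link} {m : (Fin p → ℝ) → (Fin p → ℝ) → ℝ}

/-- Deterministic bound for the term in which the error of the estimated exposure model multiplies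
the outcome residual. The part that is linear in `γ - γ₀` is controlled by the estimating equations
for `β`, because the weights in those equations are the derivatives of the exposure model. -/
theorem abs_sampleMean_exposure_error_le {c lam ψ : ℝ} (hc : 0 < c) (z : Fin n → Obs p)
    (γ₀ γ β₀ β : Fin p → ℝ) (hw : ∀ i, c ≤ weight (covar (z i)) γ₀)
    (hβ : ∀ j, |sampleMean (fun i => weight (covar (z i)) γ * resid g m ψ β (z i)
      * covar (z i) j)| ≤ lam) :
    |sampleMean (fun i => (propensity (covar (z i)) γ₀ - propensity (covar (z i)) γ)
        * resid g m ψ β₀ (z i))|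
      ≤ c⁻¹ * sampleMean (fun i => (propensity (covar (z i)) γ₀ - propensity (covar (z i)) γ) ^ 2
          * |resid g m ψ β₀ (z i)|)
        + lam * norm1 (γ - γ₀)
        + |sampleMean (fun i => weight (covar (z i)) γ * (γ ⬝ᵥ covar (z i) - γ₀ ⬝ᵥ covar (z i))
            * (m (covar (z i)) β₀ - m (covar (z i)) β))| := by
  set d : Fin n → ℝ := fun i => propensity (covar (z i)) γ₀ - propensity (covar (z i)) γ with hd
  set t : Fin n → ℝ := fun i =>
    weight (covar (z i)) γ * (γ ⬝ᵥ covar (z i) - γ₀ ⬝ᵥ covar (z i)) with ht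
  have e1 : sampleMean (fun i => d i * resid g m ψ β₀ (z i))
      = sampleMean (fun i => (d i + t i) * resid g m ψ β₀ (z i))
        - sampleMean (fun i => t i * resid g m ψ β (z i))
        + sampleMean (fun i => t i * (m (covar (z i)) β₀ - m (covar (z i)) β)) := by
    rw [← sampleMean_sub, ← sampleMean_add]
    congr 1; ext i; simp only [resid]; ring
  have b1 : |sampleMean (fun i => (d i + t i) * resid g m ψ β₀ (z i))|
      ≤ c⁻¹ * sampleMean (fun i => d i ^ 2 * |resid g m ψ β₀ (z i)|) := by
    refine (abs_sampleMean_le _).trans ?_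
    rw [← sampleMean_const_mul]
    refine sampleMean_mono fun i => ?_
    rw [abs_mul, ← mul_assoc]
    exact mul_le_mul_of_nonneg_right (abs_sigmoid_linearization_le hc (hw i)) (abs_nonneg _)
  have b2 : |sampleMean (fun i => t i * resid g m ψ β (z i))| ≤ lam * norm1 (γ - γ₀) := by
    have e2 : sampleMean (fun i => t i * resid g m ψ β (z i))
        = ∑ j, (γ - γ₀) j * sampleMean (fun i => weight (covar (z i)) γ * resid g m ψ β (z i)
            * covar (z i) j) := by
      simp only [sampleMean, ht, dotProduct, ← Finset.sum_sub_distrib, ← sub_mul]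
      simp only [Finset.mul_sum, Finset.sum_mul]
      rw [Finset.sum_comm]
      refine Finset.sum_congr rfl fun j _ => Finset.sum_congr rfl fun i _ => ?_
      simp only [Pi.sub_apply]
      ring
    rw [e2]
    exact abs_sum_mul_le_norm_mul_norm1 _ _ hβ
  rw [e1]
  refine (abs_add_le _ _).trans ?_
  refine add_le_add ((abs_sub _ _).trans (add_le_add b1 b2)) le_rfl

theorem sq_sampleMean_weight_mul_le {c : ℝ} (hc : 0 < c) (z : Fin n → Obs p)
    (γ₀ γ : Fin p → ℝ) (hw : ∀ i, c ≤ weight (covar (z i)) γ₀) (e : Fin n → ℝ) :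
    sampleMean (fun i => weight (covar (z i)) γ * (γ ⬝ᵥ covar (z i) - γ₀ ⬝ᵥ covar (z i)) * e i) ^ 2
      ≤ (1 + c⁻¹) ^ 2 * (sampleMean (fun i =>
          (propensity (covar (z i)) γ₀ - propensity (covar (z i)) γ) ^ 2)
        * sampleMean (fun i => e i ^ 2)) := by
  refine (sq_sampleMean_mul_le _ _).trans ?_
  rw [← mul_assoc, ← sampleMean_const_mul ((1 + c⁻¹) ^ 2)]
  refine mul_le_mul_of_nonneg_right (sampleMean_mono fun i => ?_)
    (sampleMean_nonneg fun i => sq_nonneg _)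
  rw [← mul_pow]
  refine sq_le_sq.2 ?_
  rw [abs_mul (1 + c⁻¹), abs_of_nonneg (by positivity : 0 ≤ 1 + c⁻¹)]
  exact abs_weight_mul_increment_le hc (hw i)

/-- For a linear outcome model the error of the estimated outcome model enters through the
exposure residuals averaged against the gradient. -/
theorem abs_sqrt_mul_sampleMean_outcome_error_le (hm : ∀ l, IsLinearMap ℝ (m l)) (hn : 0 < n)
    (z : Fin n → Obs p) (a : Fin n → ℝ) (β₀ β : Fin p → ℝ) :
    |√(n : ℝ) * sampleMean (fun i => a i * (m (covar (z i)) β₀ - m (covar (z i)) β))|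
      ≤ ‖(1 / √(n : ℝ)) • ∑ i, a i • gradM m (covar (z i)) β₀‖ * norm1 (β - β₀) := by
  set V := (1 / √(n : ℝ)) • ∑ i, a i • gradM m (covar (z i)) β₀ with hV
  have hn' : (0 : ℝ) < n := by exact_mod_cast hn
  have hs : √(n : ℝ) * (1 / n) = 1 / √(n : ℝ) := by
    have := Real.sq_sqrt hn'.le
    have h0 : √(n : ℝ) ≠ 0 := by positivity
    field_simp
    exact this
  have hVj : ∀ j, V j = ∑ i, 1 / √(n : ℝ) * (a i * m (covar (z i)) (Pi.single j 1)) := by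
    intro j
    simp [hV, Finset.sum_apply, gradM_of_isLinearMap hm, Finset.mul_sum]
  have e : √(n : ℝ) * sampleMean (fun i => a i * (m (covar (z i)) β₀ - m (covar (z i)) β))
      = -∑ j, (β - β₀) j * V j := by
    rw [sampleMean, ← mul_assoc, hs]
    simp only [hVj, Finset.mul_sum]
    rw [Finset.sum_comm, ← Finset.sum_neg_distrib]
    refine Finset.sum_congr rfl fun i _ => ?_
    rw [eq_sum_of_isLinearMap (hm _) β₀, eq_sum_of_isLinearMap (hm _) β, ← Finset.sum_sub_distrib,
      Finset.mul_sum, Finset.mul_sum, ← Finset.sum_neg_distrib]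
    refine Finset.sum_congr rfl fun j _ => ?_
    simp only [Pi.sub_apply]
    ring
  rw [e, abs_neg]
  exact abs_sum_mul_le_norm_mul_norm1 _ _ fun j => norm_le_pi_norm V j

end Deterministic

section Sequence

instance {p : ℕ} (Q : DGP p) (n : ℕ) : IsProbabilityMeasure (Q.sample n) := by
  unfold DGP.sample; infer_instance

theorem ae_sample {p : ℕ} {Q : DGP p} {S : Obs p → Prop} (h : ∀ᵐ y ∂Q.law, S y) (n : ℕ) :
    ∀ᵐ z ∂Q.sample n, ∀ i, S (z i) := by
  refine ae_all_iff.2 fun i => ?_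
  exact (measurePreserving_eval (fun _ : Fin n => Q.law) i).quasiMeasurePreserving.ae h

theorem measurableSet_forall_sample {n p : ℕ} {S : Set (Obs p)} (hS : MeasurableSet S) :
    MeasurableSet {z : Fin n → Obs p | ∀ i, z i ∈ S} := by
  have e : {z : Fin n → Obs p | ∀ i, z i ∈ S} = ⋂ i, (fun z => z i) ⁻¹' S := by ext; simp
  rw [e]
  exact MeasurableSet.iInter fun i => measurable_pi_apply i hS

variable {p : ℕ → ℕ} {g : Link} {m : ∀ n, (Fin (p n) → ℝ) → (Fin (p n) → ℝ) → ℝ}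
  {Q : ∀ n, DGP (p n)} {γhat : ∀ n, (Fin n → ℝ × (Fin (p n) → ℝ)) → Fin (p n) → ℝ}
  {βhat : ∀ n, ℝ → (Fin n → Obs (p n)) → Fin (p n) → ℝ} {lamβ : ℕ → ℝ}

/-- The error `π(Lᵢ; γ₀) - π(Lᵢ; γ̂)` of the fitted exposure model, as a function of the design. -/
noncomputable def exposureError {n p : ℕ} (γ₀ : Fin p → ℝ) (γhat : (Fin n → ℝ × (Fin p → ℝ)) → Fin p → ℝ)
    (i : Fin n) (v : Fin n → ℝ × (Fin p → ℝ)) : ℝ :=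
  propensity (v i).2 γ₀ - propensity (v i).2 (γhat v)

theorem measurable_exposureError {n p : ℕ} (γ₀ : Fin p → ℝ)
    {γhat : (Fin n → ℝ × (Fin p → ℝ)) → Fin p → ℝ} (h : Measurable γhat) (i : Fin n) :
    Measurable (exposureError γ₀ γhat i) := by
  have hi : Measurable fun v : Fin n → ℝ × (Fin p → ℝ) => (v i).2 :=
    measurable_snd.comp (measurable_pi_apply i)
  exact ((measurable_propensity_left γ₀).comp hi).sub (measurable_propensity.comp (hi.prodMk h))

theorem abs_propensity_sub_le {p : ℕ} (l γ γ' : Fin p → ℝ) :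
    |propensity l γ - propensity l γ'| ≤ 1 := by
  rw [abs_le]
  constructor <;> linarith [propensity_pos l γ, propensity_pos l γ', propensity_lt_one l γ,
    propensity_lt_one l γ']

/-- The error of the exposure model times the outcome residual is negligible. If the outcome model
holds, the residuals are conditionally centred given the design. Otherwise the exposure model holds,
its variance function is bounded away from zero at the sampled points, and the estimating equations
for `β` apply. -/
theorem isLittleOP_exposure_error_term (hm_meas : ∀ n β, Measurable (fun l => m n l β))
    (hm_lin : ∀ n l, IsLinearMap ℝ (m n l)) (hlamβ : ∀ n, 0 < lamβ n)
    (hlamβ_rate : lamβ =O[atTop] (fun n => √(logDim p n / n)))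
    (hbin : ∀ n, BinaryExposure (Q n)) (hunion : ∀ n, UnionModel g (m n) (Q n))
    (hγhat : ∀ n, Measurable (γhat n))
    (hβhat : ∀ n, ∀ᵐ z ∂((Q n).sample n), IsBridgeEstimate g (m n) (lamβ n) (Q n).ψ₀
      (γhat n (fun i => design (z i))) z (βhat n (Q n).ψ₀ z))
    (h4 : ∀ n, Integrable (fun y => resid g (m n) (Q n).ψ₀ (Q n).β₀ y ^ 4) (Q n).law)
    {c C : ℝ} (hc : 0 < c) (hC : 0 ≤ C)
    (hmom : WithProbApproachingOne (fun n => (Q n).sample n) (fun n => {z | ∀ i,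
      ((Q n).law[fun y => resid g (m n) (Q n).ψ₀ (Q n).β₀ y ^ 4 | sigmaAL (p n)]) (z i) < C}))
    (hvarA : WithProbApproachingOne (fun n => (Q n).sample n) (fun n => {z | ∀ i,
      c < ((Q n).law[fun y => (exposure y - propensity (covar y) (Q n).γ₀) ^ 2
        | sigmaL (p n)]) (z i)}))
    (hest : EstimationRates γhat βhat Q) (hpred : PredictionRates m γhat βhat Q)
    (hsparse : UltraSparse Q) :
    IsLittleOP (fun n => (Q n).sample n) (fun n z => √(n : ℝ) * sampleMean (fun i =>
      (propensity (covar (z i)) (Q n).γ₀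
        - propensity (covar (z i)) (γhat n (fun i => design (z i))))
      * resid g (m n) (Q n).ψ₀ (Q n).β₀ (z i))) := by
  classical
  set B : ℕ → Prop := fun n =>
    (Q n).law[resid g (m n) (Q n).ψ₀ (Q n).β₀ | sigmaAL (p n)] =ᵐ[(Q n).law] 0 with hBdef
  have hεm : ∀ n, Measurable (resid g (m n) (Q n).ψ₀ (Q n).β₀) :=
    fun n => measurable_resid (hm_meas n) _ _
  have hεi : ∀ n, Integrable (resid g (m n) (Q n).ψ₀ (Q n).β₀) (Q n).law := fun n =>
    (memLp_four_of_integrable_pow (hεm n).aestronglyMeasurable (h4 n)).integrable (by norm_num)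
  have hA : ∀ n, ¬ B n → ModelA (Q n) := by
    intro n hn
    obtain ⟨μ, hM, hAB⟩ := hunion n
    refine hAB.resolve_right fun hB => hn ?_
    have hB' : ∀ᵐ z ∂(Q n).law, μ 0 (covar z) = m n (covar z) (Q n).β₀ := hB
    filter_upwards [condExp_resid (hm_meas n) (hbin n) hM (hεi n), hB'] with z h1 h2
    rw [h1, h2, sub_self]; rfl
  have hs0 : ∀ n, (0 : ℝ) ≤ sparsity (Q n).γ₀ := fun n => Nat.cast_nonneg _
  have hrγ0 := rate_nonneg p fun n => sparsity (Q n).γ₀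
  have hrβ0 := rate_nonneg p fun n => maxSparsity (Q n)
  have hrγ := tendsto_rate_sparsity hsparse
  have hmom' := hmom.holdsWHP fun n => measurableSet_forall_sample
    (S := {y | ((Q n).law[fun y => resid g (m n) (Q n).ψ₀ (Q n).β₀ y ^ 4 | sigmaAL (p n)]) y < C})
    (measurableSet_lt (stronglyMeasurable_condExp.mono sigmaAL_le).measurable measurable_const)
  have hvarA' := hvarA.holdsWHP fun n => measurableSet_forall_sample
    (S := {y | c < ((Q n).law[fun y => (exposure y - propensity (covar y) (Q n).γ₀) ^ 2
      | sigmaL (p n)]) y})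
    (measurableSet_lt measurable_const (stronglyMeasurable_condExp.mono sigmaL_le).measurable)
  have hd : ∀ n i, Measurable (exposureError (Q n).γ₀ (γhat n) i) :=
    fun n i => measurable_exposureError _ (hγhat n) i
  have hd1 : ∀ n i v, |exposureError (Q n).γ₀ (γhat n) i v| ≤ 1 :=
    fun n i v => abs_propensity_sub_le _ _ _
  refine IsLittleOP.of_cases B ?_ ?_
  · exact isLittleOP_sqrt_mul_sampleMean_mul (μ := fun n => (Q n).law)
      (x := fun n => design) (ε := fun n => resid g (m n) (Q n).ψ₀ (Q n).β₀)
      (d := fun n => exposureError (Q n).γ₀ (γhat n)) (B := B) (fun n => measurable_design)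
      (fun n => (hεm n).aestronglyMeasurable) h4 hC hmom' hd hd1 hrγ0 hpred.1
      (tendsto_of_tendsto_sqrt_mul hrγ0 hrγ) fun n hn => hn
  · -- the three terms of the deterministic bound
    have hY1 : IsLittleOP (fun n => (Q n).sample n) (fun n z => √(n : ℝ) * sampleMean (fun i =>
        (propensity (covar (z i)) (Q n).γ₀
          - propensity (covar (z i)) (γhat n (fun i => design (z i)))) ^ 2
        * |resid g (m n) (Q n).ψ₀ (Q n).β₀ (z i)|)) :=
      isLittleOP_sqrt_mul_sampleMean_sq_mul_abs (μ := fun n => (Q n).law)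
        (x := fun n => design) (ε := fun n => resid g (m n) (Q n).ψ₀ (Q n).β₀)
        (d := fun n => exposureError (Q n).γ₀ (γhat n)) (fun n => measurable_design) h4 hC hmom' hd hd1 hrγ0 hpred.1 hrγ
    have hY2 : IsLittleOP (fun n => (Q n).sample n) (fun n z => √(n : ℝ) * (lamβ n
        * norm1 (γhat n (fun i => design (z i)) - (Q n).γ₀))) := by
      have hn : IsBigOP (fun n => (Q n).sample n) (fun n _ => √(n : ℝ)) (fun n => √(n : ℝ)) :=
        IsBigOP.of_isBigO (Asymptotics.isBigO_refl _ _) fun n => Real.sqrt_nonneg _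
      have hl : IsBigOP (fun n => (Q n).sample n) (fun n _ => lamβ n) _ :=
        IsBigOP.of_isBigO hlamβ_rate fun n => Real.sqrt_nonneg _
      have h0 : ∀ n : ℕ, (0 : ℝ) ≤ sparsity (Q n).γ₀ * √(logDim p n / n) := fun n =>
        mul_nonneg (hs0 n) (Real.sqrt_nonneg _)
      refine (hn.mul (hl.mul hest.1 (fun n => Real.sqrt_nonneg _) h0) (fun n => Real.sqrt_nonneg _)
        fun n => mul_nonneg (Real.sqrt_nonneg _) (h0 n)).isLittleOP (hrγ.congr fun n => ?_)
      have := Real.mul_self_sqrt (div_nonneg (logDim_nonneg p n) (Nat.cast_nonneg n))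
      linear_combination (-(√(n : ℝ) * sparsity (Q n).γ₀)) * this
    let E : ∀ n, Set (Fin n → Obs (p n)) := fun n =>
      {z | ∀ i, c < ((Q n).law[fun y => (exposure y - propensity (covar y) (Q n).γ₀) ^ 2
        | sigmaL (p n)]) (z i)} ∩
      ({z | ¬ B n → ∀ i, ((Q n).law[fun y => (exposure y - propensity (covar y) (Q n).γ₀) ^ 2
        | sigmaL (p n)]) (z i) = weight (covar (z i)) (Q n).γ₀} ∩
      {z | IsBridgeEstimate g (m n) (lamβ n) (Q n).ψ₀
        (γhat n (fun i => design (z i))) z (βhat n (Q n).ψ₀ z)})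
    have hE : HoldsWHP (fun n => (Q n).sample n) E := by
      refine hvarA'.inter (HoldsWHP.inter (HoldsWHP.of_ae fun n => ?_) (HoldsWHP.of_ae hβhat))
      by_cases hn : B n
      · exact Eventually.of_forall fun z hz => absurd hn hz
      · filter_upwards [ae_sample (condExp_sq_exposure_sub (hbin n) (hA n hn)) n] with z hz _
        exact hz
    have hEw : ∀ n, ¬ B n → ∀ z ∈ E n, ∀ i, c ≤ weight (covar (z i)) (Q n).γ₀ := by
      intro n hn z hz i
      rw [← hz.2.1 hn i]
      exact (hz.1 i).le
    have hY3 : IsLittleOP (fun n => (Q n).sample n) (fun n z => if B n then 0 else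
        √(n : ℝ) * sampleMean (fun i => weight (covar (z i)) (γhat n (fun i => design (z i)))
          * (γhat n (fun i => design (z i)) ⬝ᵥ covar (z i) - (Q n).γ₀ ⬝ᵥ covar (z i))
          * (m n (covar (z i)) (Q n).β₀ - m n (covar (z i)) (βhat n (Q n).ψ₀ z)))) := by
      refine isLittleOP_sqrt_of_sq_le ((isLittleOP_sqrt_mul_sampleMean_prod hrγ0 hrβ0 hpred.1
        hpred.2 (tendsto_rate_mul_rate hsparse)).const_mul ((1 + c⁻¹) ^ 2)) hE (Eventually.of_forall fun n z hz => ?_)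
      have hnn : 0 ≤ (1 + c⁻¹) ^ 2 * ((n : ℝ) * (sampleMean (fun i =>
          (propensity (covar (z i)) (Q n).γ₀ - propensity (covar (z i))
            (γhat n (fun i => (exposure (z i), covar (z i))))) ^ 2)
          * sampleMean (fun i => (m n (covar (z i)) (Q n).β₀
            - m n (covar (z i)) (βhat n (Q n).ψ₀ z)) ^ 2))) :=
        mul_nonneg (sq_nonneg _) (mul_nonneg (Nat.cast_nonneg n) (mul_nonneg
          (sampleMean_nonneg fun i => sq_nonneg _) (sampleMean_nonneg fun i => sq_nonneg _)))
      split_ifs with hn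
      · rw [zero_pow two_ne_zero]; exact hnn
      · rw [mul_pow, Real.sq_sqrt (Nat.cast_nonneg n), mul_left_comm]
        exact mul_le_mul_of_nonneg_left (sq_sampleMean_weight_mul_le hc z _ _ (hEw n hn z hz) _)
          (Nat.cast_nonneg n)
    have hY3' := hY3.mono' (X := fun n z => |if B n then 0 else
        √(n : ℝ) * sampleMean (fun i => weight (covar (z i)) (γhat n (fun i => design (z i)))
          * (γhat n (fun i => design (z i)) ⬝ᵥ covar (z i) - (Q n).γ₀ ⬝ᵥ covar (z i))
          * (m n (covar (z i)) (Q n).β₀ - m n (covar (z i)) (βhat n (Q n).ψ₀ z)))|)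
      (Eventually.of_forall fun n z => by rw [abs_abs])
    refine (((hY1.const_mul c⁻¹).add hY2).add hY3').mono hE (Eventually.of_forall fun n z hz => ?_)
    split_ifs with hn
    · rw [abs_zero]; exact abs_nonneg _
    · refine le_trans ?_ (le_abs_self _)
      have key := abs_sampleMean_exposure_error_le (g := g) (m := m n) (lam := lamβ n)
        (ψ := (Q n).ψ₀) hc z (Q n).γ₀ (γhat n (fun i => design (z i))) (Q n).β₀
        (βhat n (Q n).ψ₀ z) (hEw n hn z hz)
        (fun j => hz.2.2.abs_sampleMean_le (hm_lin n) (hlamβ n).le j)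
      have h1 := mul_le_mul_of_nonneg_left key (Real.sqrt_nonneg (n : ℝ))
      rw [abs_mul, abs_of_nonneg (Real.sqrt_nonneg (n : ℝ)), abs_mul √(n : ℝ),
        abs_of_nonneg (Real.sqrt_nonneg (n : ℝ))]
      linarith

end Sequence

/-! ### Coverage along a sequence of laws -/

section Coverage

theorem IsCriticalValue.gaussianReal_Icc {α q : ℝ} (hα : α ∈ Set.Ioo (0 : ℝ) 1)
    (hq : IsCriticalValue α q) :
    0 ≤ q ∧ (gaussianReal 0 1).real (Set.Icc (-√q) (√q)) = 1 - α := by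
  have hms : Measurable fun x : ℝ => x ^ 2 := measurable_id.pow_const 2
  have h : gaussianReal 0 1 ((fun x : ℝ => x ^ 2) ⁻¹' Set.Ioi q) = ENNReal.ofReal α := by
    rw [← Measure.map_apply hms measurableSet_Ioi]; exact hq
  have hq0 : 0 ≤ q := by
    by_contra hneg
    have e : (fun x : ℝ => x ^ 2) ⁻¹' Set.Ioi q = Set.univ := by
      ext x
      simp only [Set.mem_preimage, Set.mem_Ioi, Set.mem_univ, iff_true]
      nlinarith [sq_nonneg x]
    rw [e, measure_univ, ← ENNReal.ofReal_one, ENNReal.ofReal_eq_ofReal_iff zero_le_one hα.1.le] at h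
    exact hα.2.ne h.symm
  refine ⟨hq0, ?_⟩
  have e : Set.Icc (-√q) (√q) = ((fun x : ℝ => x ^ 2) ⁻¹' Set.Ioi q)ᶜ := by
    ext x
    simp only [Set.mem_Icc, Set.mem_compl_iff, Set.mem_preimage, Set.mem_Ioi, not_lt]
    rw [← abs_le, ← Real.sqrt_sq_eq_abs, Real.sqrt_le_sqrt_iff hq0]
  rw [e, probReal_compl_eq_one_sub (hms measurableSet_Ioi), measureReal_def, h,
    ENNReal.toReal_ofReal hα.1.le]

variable {p : ℕ → ℕ} {g : Link} {m : ∀ n, (Fin (p n) → ℝ) → (Fin (p n) → ℝ) → ℝ}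
  {Q : ∀ n, DGP (p n)} {γhat : ∀ n, (Fin n → ℝ × (Fin (p n) → ℝ)) → Fin (p n) → ℝ}
  {βhat : ∀ n, ℝ → (Fin n → Obs (p n)) → Fin (p n) → ℝ} {lamβ : ℕ → ℝ}

/-- If all `n` observations lie in a set with probability tending to one, then so does a single
one. -/
theorem tendsto_law_real_of_sample {S : ∀ n, Set (Obs (p n))} (hS : ∀ n, MeasurableSet (S n))
    (h : WithProbApproachingOne (fun n => (Q n).sample n) (fun n => {z | ∀ i, z i ∈ S n})) :
    Tendsto (fun n => (Q n).law.real (S n)) atTop (𝓝 1) := by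
  have h1 : Tendsto (fun n => (Q n).law (S n)) atTop (𝓝 1) := by
    refine tendsto_of_tendsto_of_tendsto_of_le_of_le' h tendsto_const_nhds ?_
      (Eventually.of_forall fun n => prob_le_one)
    filter_upwards [eventually_gt_atTop 0] with n hn
    have hp := measurePreserving_eval (fun _ : Fin n => (Q n).law) ⟨0, hn⟩
    rw [← hp.measure_preimage (hS n).nullMeasurableSet]
    exact measure_mono fun z hz => hz _
  exact (ENNReal.tendsto_toReal ENNReal.one_ne_top).comp h1

theorem ae_abs_score_le {p : ℕ} {g : Link} {m : (Fin p → ℝ) → (Fin p → ℝ) → ℝ} {Q : DGP p}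
    (hbin : BinaryExposure Q) :
    ∀ᵐ y ∂Q.law, |score g m Q.ψ₀ Q.γ₀ Q.β₀ y| ≤ |resid g m Q.ψ₀ Q.β₀ y| := by
  filter_upwards [ae_abs_exposure_sub_le hbin] with y hy
  rw [score, abs_mul]
  exact mul_le_of_le_one_left (abs_nonneg _) hy

theorem integrable_score_pow_four {p : ℕ} {g : Link} {m : (Fin p → ℝ) → (Fin p → ℝ) → ℝ}
    {Q : DGP p} (hm : ∀ β, Measurable fun l => m l β) (hbin : BinaryExposure Q)
    (h4 : Integrable (fun y => resid g m Q.ψ₀ Q.β₀ y ^ 4) Q.law) :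
    Integrable (fun y => score g m Q.ψ₀ Q.γ₀ Q.β₀ y ^ 4) Q.law ∧
      ∫ y, score g m Q.ψ₀ Q.γ₀ Q.β₀ y ^ 4 ∂Q.law ≤ ∫ y, resid g m Q.ψ₀ Q.β₀ y ^ 4 ∂Q.law := by
  have hle : ∀ᵐ y ∂Q.law, score g m Q.ψ₀ Q.γ₀ Q.β₀ y ^ 4 ≤ resid g m Q.ψ₀ Q.β₀ y ^ 4 := by
    filter_upwards [ae_abs_score_le (g := g) (m := m) hbin] with y hy
    have := pow_le_pow_left₀ (abs_nonneg _) hy 4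
    rwa [← abs_pow, ← abs_pow, abs_of_nonneg (by positivity), abs_of_nonneg (by positivity)] at this
  have hi : Integrable (fun y => score g m Q.ψ₀ Q.γ₀ Q.β₀ y ^ 4) Q.law := by
    refine h4.mono' ((measurable_score hm _ _ _).pow_const 4).aestronglyMeasurable ?_
    filter_upwards [hle] with y hy
    rwa [Real.norm_of_nonneg (by positivity)]
  exact ⟨hi, integral_mono_ae hi h4 hle⟩

/-- Stochastic expansion of the score: estimating the nuisance parameters has no first-order effect,
whichever of the two working models is correct. -/
theorem isLittleOP_sqrt_mul_score_sub (hm_meas : ∀ n β, Measurable (fun l => m n l β))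
    (hm_lin : ∀ n l, IsLinearMap ℝ (m n l)) (hlamβ : ∀ n, 0 < lamβ n)
    (hlamβ_rate : lamβ =O[atTop] (fun n => √(logDim p n / n)))
    (hbin : ∀ n, BinaryExposure (Q n)) (hunion : ∀ n, UnionModel g (m n) (Q n))
    (hγhat : ∀ n, Measurable (γhat n))
    (hβhat : ∀ n, ∀ᵐ z ∂((Q n).sample n), IsBridgeEstimate g (m n) (lamβ n) (Q n).ψ₀
      (γhat n (fun i => design (z i))) z (βhat n (Q n).ψ₀ z))
    (h4 : ∀ n, Integrable (fun y => resid g (m n) (Q n).ψ₀ (Q n).β₀ y ^ 4) (Q n).law)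
    {c C : ℝ} (hc : 0 < c) (hC : 0 ≤ C)
    (hmom : WithProbApproachingOne (fun n => (Q n).sample n) (fun n => {z | ∀ i,
      ((Q n).law[fun y => resid g (m n) (Q n).ψ₀ (Q n).β₀ y ^ 4 | sigmaAL (p n)]) (z i) < C}))
    (hvarA : WithProbApproachingOne (fun n => (Q n).sample n) (fun n => {z | ∀ i,
      c < ((Q n).law[fun y => (exposure y - propensity (covar y) (Q n).γ₀) ^ 2
        | sigmaL (p n)]) (z i)}))
    (hconc : ConcentrationBound m Q)
    (hest : EstimationRates γhat βhat Q) (hpred : PredictionRates m γhat βhat Q)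
    (hsparse : UltraSparse Q) :
    IsLittleOP (fun n => (Q n).sample n) (fun n z => √(n : ℝ) *
      (sampleMean (fun i => score g (m n) (Q n).ψ₀ (γhat n (fun i => design (z i)))
          (βhat n (Q n).ψ₀ z) (z i))
        - sampleMean (fun i => score g (m n) (Q n).ψ₀ (Q n).γ₀ (Q n).β₀ (z i)))) := by
  set ε : ∀ n, Obs (p n) → ℝ := fun n => resid g (m n) (Q n).ψ₀ (Q n).β₀ with hε
  set U : ∀ n, Obs (p n) → ℝ := fun n => score g (m n) (Q n).ψ₀ (Q n).γ₀ (Q n).β₀ with hU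
  set Uhat : ∀ n, (Fin n → Obs (p n)) → Fin n → ℝ := fun n z i =>
    score g (m n) (Q n).ψ₀ (γhat n (fun i => design (z i))) (βhat n (Q n).ψ₀ z) (z i) with hUhat
  set a : ∀ n, (Fin n → Obs (p n)) → Fin n → ℝ := fun n z i =>
    exposure (z i) - propensity (covar (z i)) (Q n).γ₀ with ha
  set d : ∀ n, (Fin n → Obs (p n)) → Fin n → ℝ := fun n z i =>
    propensity (covar (z i)) (Q n).γ₀
      - propensity (covar (z i)) (γhat n (fun i => design (z i))) with hd
  set e : ∀ n, (Fin n → Obs (p n)) → Fin n → ℝ := fun n z i =>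
    m n (covar (z i)) (Q n).β₀ - m n (covar (z i)) (βhat n (Q n).ψ₀ z) with he
  have hUa : ∀ n z i, U n (z i) = a n z i * ε n (z i) := fun n z i => rfl
  have hUhat_eq : ∀ n z i, Uhat n z i = (a n z i + d n z i) * (ε n (z i) + e n z i) := by
    intro n z i
    simp only [hUhat, ha, hd, he, hε, score, resid]
    ring
  have hR1 : IsLittleOP (fun n => (Q n).sample n)
      (fun n z => √(n : ℝ) * sampleMean (fun i => d n z i * ε n (z i))) :=
    isLittleOP_exposure_error_term hm_meas hm_lin hlamβ hlamβ_rate hbin hunion hγhat hβhat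
      h4 hc hC hmom hvarA hest hpred hsparse
  have hR2 : IsLittleOP (fun n => (Q n).sample n)
      (fun n z => √(n : ℝ) * sampleMean (fun i => a n z i * e n z i)) := by
    have h0 : ∀ n : ℕ, (0 : ℝ) ≤ maxSparsity (Q n) * √(logDim p n / n) := fun n =>
      mul_nonneg (Nat.cast_nonneg _) (Real.sqrt_nonneg _)
    have hB := IsBigOP.mul hconc hest.2.2.1 (fun n => Real.sqrt_nonneg _) h0
    have ht : Tendsto (fun n => √(logDim p n) * (maxSparsity (Q n) * √(logDim p n / n)))
        atTop (𝓝 0) := by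
      refine (tendsto_rate_maxSparsity hsparse).congr fun n => ?_
      rw [Real.sqrt_div (logDim_nonneg p n)]
      have h1 := Real.mul_self_sqrt (logDim_nonneg p n)
      rcases Nat.eq_zero_or_pos n with rfl | hn
      · simp
      · have hn' : (0 : ℝ) < n := by exact_mod_cast hn
        have h2 : √(n : ℝ) / n = 1 / √(n : ℝ) := Real.sqrt_div_self'
        calc √(n : ℝ) * (maxSparsity (Q n) * logDim p n / n)
            = maxSparsity (Q n) * logDim p n * (√(n : ℝ) / n) := by ring
          _ = _ := by rw [h2]; nth_rewrite 1 [← h1]; ring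
    refine (hB.isLittleOP ht).mono' ?_
    filter_upwards [eventually_gt_atTop 0] with n hn z
    exact (abs_sqrt_mul_sampleMean_outcome_error_le (hm_lin n) hn z (a n z) (Q n).β₀ _).trans
      (le_abs_self _)
  have hR3 : IsLittleOP (fun n => (Q n).sample n)
      (fun n z => √(n : ℝ) * sampleMean (fun i => d n z i * e n z i)) := by
    refine isLittleOP_sqrt_of_sq_le (isLittleOP_sqrt_mul_sampleMean_prod
      (rate_nonneg p fun n => sparsity (Q n).γ₀) (rate_nonneg p fun n => maxSparsity (Q n)) hpred.1
      hpred.2 (tendsto_rate_mul_rate hsparse)) holdsWHP_univ (Eventually.of_forall fun n z _ => ?_)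
    rw [mul_pow, Real.sq_sqrt (Nat.cast_nonneg n)]
    exact mul_le_mul_of_nonneg_left (sq_sampleMean_mul_le _ _) (Nat.cast_nonneg n)
  refine ((hR1.add hR2).add hR3).mono' (Eventually.of_forall fun n z => le_of_eq ?_)
  rw [← mul_add, ← mul_add, ← sampleMean_sub, ← sampleMean_add, ← sampleMean_add]
  congr 3
  ext i
  change Uhat n z i - U n (z i) = _
  rw [hUhat_eq, hUa]
  ring

/-- Consistency of the empirical variance of the estimated scores. -/
theorem isLittleOP_sampleVar_score_sub (hm_meas : ∀ n β, Measurable (fun l => m n l β))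
    (hbin : ∀ n, BinaryExposure (Q n)) {C : ℝ}
    (h4 : ∀ n, Integrable (fun y => resid g (m n) (Q n).ψ₀ (Q n).β₀ y ^ 4) (Q n).law ∧
      ∫ y, resid g (m n) (Q n).ψ₀ (Q n).β₀ y ^ 4 ∂(Q n).law ≤ C)
    (hU0 : ∀ n, ∫ y, score g (m n) (Q n).ψ₀ (Q n).γ₀ (Q n).β₀ y ∂(Q n).law = 0)
    (hR : IsLittleOP (fun n => (Q n).sample n) (fun n z => √(n : ℝ) *
      (sampleMean (fun i => score g (m n) (Q n).ψ₀ (γhat n (fun i => design (z i)))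
          (βhat n (Q n).ψ₀ z) (z i))
        - sampleMean (fun i => score g (m n) (Q n).ψ₀ (Q n).γ₀ (Q n).β₀ (z i)))))
    (hpred : PredictionRates m γhat βhat Q) (hsparse : UltraSparse Q) :
    IsLittleOP (fun n => (Q n).sample n) (fun n z =>
      sampleVar (fun i => score g (m n) (Q n).ψ₀ (γhat n (fun i => design (z i)))
          (βhat n (Q n).ψ₀ z) (z i))
        - ∫ y, score g (m n) (Q n).ψ₀ (Q n).γ₀ (Q n).β₀ y ^ 2 ∂(Q n).law) := by
  set ε : ∀ n, Obs (p n) → ℝ := fun n => resid g (m n) (Q n).ψ₀ (Q n).β₀ with hε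
  set U : ∀ n, Obs (p n) → ℝ := fun n => score g (m n) (Q n).ψ₀ (Q n).γ₀ (Q n).β₀ with hU
  have hUm : ∀ n, Measurable (U n) := fun n => measurable_score (hm_meas n) _ _ _
  have hU4 : ∀ n, Integrable (fun y => U n y ^ 4) (Q n).law ∧ ∫ y, U n y ^ 4 ∂(Q n).law ≤ C :=
    fun n => ⟨(integrable_score_pow_four (hm_meas n) (hbin n) (h4 n).1).1,
      (integrable_score_pow_four (hm_meas n) (hbin n) (h4 n).1).2.trans (h4 n).2⟩
  have hUL2 : ∀ n, MemLp (U n) 2 (Q n).law := fun n =>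
    (memLp_four_of_integrable_pow (hUm n).aestronglyMeasurable (hU4 n).1).mono_exponent
      (by norm_num)
  have hU2i : ∀ n, Integrable (fun y => U n y ^ 2) (Q n).law := fun n => (hUL2 n).integrable_sq
  set v : ℕ → ℝ := fun n => ∫ y, U n y ^ 2 ∂(Q n).law with hv
  have hvle : ∀ n, v n ≤ 1 + C := by
    intro n
    have hi : Integrable (fun y => 1 + U n y ^ 4) (Q n).law := (integrable_const 1).add (hU4 n).1
    refine (integral_mono (hU2i n) hi fun y => sq_le_one_add_pow_four _).trans ?_
    rw [integral_add (integrable_const 1) (hU4 n).1]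
    have := (hU4 n).2
    simp only [integral_const, probReal_univ, smul_eq_mul, mul_one]
    linarith
  set Uhat : ∀ n, (Fin n → Obs (p n)) → Fin n → ℝ := fun n z i =>
    score g (m n) (Q n).ψ₀ (γhat n (fun i => design (z i))) (βhat n (Q n).ψ₀ z) (z i) with hUhat
  set a : ∀ n, (Fin n → Obs (p n)) → Fin n → ℝ := fun n z i =>
    exposure (z i) - propensity (covar (z i)) (Q n).γ₀ with ha
  set d : ∀ n, (Fin n → Obs (p n)) → Fin n → ℝ := fun n z i =>
    propensity (covar (z i)) (Q n).γ₀
      - propensity (covar (z i)) (γhat n (fun i => design (z i))) with hd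
  set e : ∀ n, (Fin n → Obs (p n)) → Fin n → ℝ := fun n z i =>
    m n (covar (z i)) (Q n).β₀ - m n (covar (z i)) (βhat n (Q n).ψ₀ z) with he
  have hUa : ∀ n z i, U n (z i) = a n z i * ε n (z i) := fun n z i => rfl
  have hUhat_eq : ∀ n z i, Uhat n z i = (a n z i + d n z i) * (ε n (z i) + e n z i) := by
    intro n z i
    simp only [hUhat, ha, hd, he, hε, score, resid]
    ring
  have hlaw1 : IsLittleOP (fun n => (Q n).sample n)
      (fun n z => sampleMean (fun i => U n (z i))) :=
    isLittleOP_sampleMean (μ := fun n => (Q n).law) (W := U) hUL2 hU0 hvle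
  have hlaw2 : IsLittleOP (fun n => (Q n).sample n)
      (fun n z => sampleMean (fun i => U n (z i) ^ 2 - v n)) := by
    have hsqL2 : ∀ n, MemLp (fun y => U n y ^ 2 - v n) 2 (Q n).law := by
      intro n
      refine MemLp.sub ?_ (memLp_const _)
      rw [memLp_two_iff_integrable_sq ((hUm n).pow_const 2).aestronglyMeasurable]
      refine (hU4 n).1.congr (Eventually.of_forall fun y => ?_)
      simp only
      ring
    refine isLittleOP_sampleMean (μ := fun n => (Q n).law)
      (W := fun n y => U n y ^ 2 - v n) (C := C) hsqL2 ?_ ?_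
    · intro n
      rw [integral_sub (hU2i n) (integrable_const _)]
      simp [hv]
    · intro n
      have e1 : ∀ y, (U n y ^ 2 - v n) ^ 2 = U n y ^ 4 - (2 * v n) * U n y ^ 2 + v n ^ 2 :=
        fun y => by ring
      have i1 : Integrable (fun y => (2 * v n) * U n y ^ 2) (Q n).law := (hU2i n).const_mul _
      have i2 : Integrable (fun y => U n y ^ 4 - (2 * v n) * U n y ^ 2) (Q n).law :=
        (hU4 n).1.sub i1
      simp only [e1]
      rw [integral_add i2 (integrable_const _), integral_sub (hU4 n).1 i1, integral_const_mul]
      have h3 : ∫ y, U n y ^ 2 ∂(Q n).law = v n := rfl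
      simp only [h3, integral_const, probReal_univ, smul_eq_mul, one_mul]
      nlinarith [(hU4 n).2, sq_nonneg (v n)]
  have hbig4 : IsBigOP (fun n => (Q n).sample n)
      (fun n z => sampleMean (fun i => ε n (z i) ^ 4)) (fun _ => 1) := by
    refine IsBigOP.of_integral (C := C) ?_
    filter_upwards [eventually_gt_atTop 0] with n hn
    obtain ⟨h1, h2⟩ := integral_sampleMean_comp (h4 n).1 n hn
    refine ⟨h1, ?_⟩
    have h3 : ∀ z : Fin n → Obs (p n), |sampleMean (fun i => ε n (z i) ^ 4)|
        = sampleMean (fun i => ε n (z i) ^ 4) := fun z =>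
      abs_of_nonneg (sampleMean_nonneg fun i => by positivity)
    simp only [h3]
    exact h2.le.trans (h4 n).2
  have hbig2 : IsBigOP (fun n => (Q n).sample n)
      (fun n z => sampleMean (fun i => (a n z i * ε n (z i)) ^ 2)) (fun _ => 1) := by
    refine IsBigOP.of_integral (C := 1 + C) ?_
    filter_upwards [eventually_gt_atTop 0] with n hn
    obtain ⟨h1, h2⟩ := integral_sampleMean_comp (hU2i n) n hn
    refine ⟨h1, ?_⟩
    have h3 : ∀ z : Fin n → Obs (p n), |sampleMean (fun i => (a n z i * ε n (z i)) ^ 2)|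
        = sampleMean (fun i => U n (z i) ^ 2) := fun z =>
      abs_of_nonneg (sampleMean_nonneg fun i => sq_nonneg _)
    simp only [h3]
    exact h2.le.trans (hvle n)
  have hsq : IsLittleOP (fun n => (Q n).sample n) (fun n z =>
      sampleMean (fun i => Uhat n z i ^ 2) - sampleMean (fun i => U n (z i) ^ 2)) := by
    have hE : HoldsWHP (fun n => (Q n).sample n) (fun n => {z | ∀ i, |a n z i| ≤ 1}) :=
      HoldsWHP.of_ae fun n => ae_sample (ae_abs_exposure_sub_le (hbin n)) n
    have := isLittleOP_sampleMean_sq_sub (a := a) (d := d) (e := e)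
      (ε := fun n z i => ε n (z i)) hE (fun n z hz => hz)
      (fun n z i => abs_propensity_sub_le _ _ _)
      (hpred.1.isLittleOP (tendsto_of_tendsto_sqrt_mul
        (rate_nonneg p fun n => sparsity (Q n).γ₀) (tendsto_rate_sparsity hsparse)))
      (hpred.2.isLittleOP (tendsto_of_tendsto_sqrt_mul
        (rate_nonneg p fun n => maxSparsity (Q n)) (tendsto_rate_maxSparsity hsparse))) hbig4 hbig2
    refine this.mono' (Eventually.of_forall fun n z => le_of_eq ?_)
    simp only [hUhat_eq, hUa]
  have hmean : IsLittleOP (fun n => (Q n).sample n) (fun n z => sampleMean (Uhat n z)) := by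
    have h1 : IsLittleOP (fun n => (Q n).sample n)
        (fun n z => sampleMean (Uhat n z) - sampleMean (fun i => U n (z i))) := by
      refine hR.mono' ?_
      filter_upwards [eventually_gt_atTop 0] with n hn z
      rw [abs_mul, abs_of_nonneg (Real.sqrt_nonneg _)]
      refine le_mul_of_one_le_left (abs_nonneg _) ?_
      rw [Real.one_le_sqrt]; exact_mod_cast hn
    simpa using h1.add hlaw1
  refine ((hsq.add hlaw2).sub hmean.sq).mono' ?_
  filter_upwards [eventually_gt_atTop 0] with n hn z
  refine le_of_eq (congrArg _ ?_)
  have hn' : (n : ℝ) ≠ 0 := by exact_mod_cast hn.ne'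
  have hcst : sampleMean (fun _ : Fin n => v n) = v n := by
    simp only [sampleMean, Finset.sum_const, Finset.card_univ, Fintype.card_fin, nsmul_eq_mul]
    field_simp
  rw [sampleVar_eq hn, sampleMean_sub, hcst]
  ring

/-- The variance of the score is eventually bounded away from zero. -/
theorem exists_pos_eventually_le_integral_score_sq
    (hm_meas : ∀ n β, Measurable (fun l => m n l β)) (hbin : ∀ n, BinaryExposure (Q n))
    (h4 : ∀ n, Integrable (fun y => resid g (m n) (Q n).ψ₀ (Q n).β₀ y ^ 4) (Q n).law)
    {c : ℝ} (hc : 0 < c)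
    (hvarA : WithProbApproachingOne (fun n => (Q n).sample n) (fun n => {z | ∀ i,
      c < ((Q n).law[fun y => (exposure y - propensity (covar y) (Q n).γ₀) ^ 2
        | sigmaL (p n)]) (z i)}))
    (hvarε : WithProbApproachingOne (fun n => (Q n).sample n) (fun n => {z | ∀ i,
      c < ((Q n).law[fun y => resid g (m n) (Q n).ψ₀ (Q n).β₀ y ^ 2 | sigmaAL (p n)]) (z i)})) :
    ∃ b : ℝ, 0 < b ∧ ∀ᶠ n in atTop,
      b ≤ ∫ y, score g (m n) (Q n).ψ₀ (Q n).γ₀ (Q n).β₀ y ^ 2 ∂(Q n).law := by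
  refine ⟨c * c / 2, by positivity, ?_⟩
  have hm1 : ∀ n, MeasurableSet {y | c < ((Q n).law[fun y =>
      (exposure y - propensity (covar y) (Q n).γ₀) ^ 2 | sigmaL (p n)]) y} := fun n =>
    measurableSet_lt measurable_const (stronglyMeasurable_condExp.mono sigmaL_le).measurable
  have hm2 : ∀ n, MeasurableSet {y | c < ((Q n).law[fun y => resid g (m n) (Q n).ψ₀ (Q n).β₀ y ^ 2 | sigmaAL (p n)]) y} :=
    fun n => measurableSet_lt measurable_const
      (stronglyMeasurable_condExp.mono sigmaAL_le).measurable
  have t1 := tendsto_law_real_of_sample hm1 hvarA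
  have t2 := tendsto_law_real_of_sample hm2 hvarε
  have t3 := ((t1.const_mul c).sub ((tendsto_const_nhds (x := (1 : ℝ))).sub t2)).const_mul c
  have hlt : c * c / 2 < c * (c * 1 - (1 - 1)) := by nlinarith [mul_pos hc hc]
  filter_upwards [t3.eventually_const_lt hlt] with n hn
  refine hn.le.trans ?_
  have := le_integral_score_sq (hm_meas n) (hbin n) (h4 n) hc.le
  rwa [probReal_compl_eq_one_sub (hm2 n)] at this

/-- Asymptotic exactness of the score-test confidence set along one sequence of laws. -/
theorem tendsto_coverage (hm_meas : ∀ n β, Measurable (fun l => m n l β))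
    (hm_lin : ∀ n l, IsLinearMap ℝ (m n l)) {α q : ℝ} (hα : α ∈ Set.Ioo (0 : ℝ) 1)
    (hq : IsCriticalValue α q) (hlamβ : ∀ n, 0 < lamβ n)
    (hlamβ_rate : lamβ =O[atTop] (fun n => √(logDim p n / n)))
    (hbin : ∀ n, BinaryExposure (Q n)) (hunion : ∀ n, UnionModel g (m n) (Q n))
    (hγhat : ∀ n, Measurable (γhat n))
    (hβhat : ∀ n, ∀ᵐ z ∂((Q n).sample n), IsBridgeEstimate g (m n) (lamβ n) (Q n).ψ₀
      (γhat n (fun i => design (z i))) z (βhat n (Q n).ψ₀ z))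
    (hmoment : MomentConditions g m Q) (hconc : ConcentrationBound m Q)
    (hest : EstimationRates γhat βhat Q) (hpred : PredictionRates m γhat βhat Q)
    (hsparse : UltraSparse Q) :
    Tendsto (fun n => ((Q n).sample n).real {z | (Q n).ψ₀ ∈ confSet g (m n) q
      (γhat n (fun i => design (z i))) (fun ψ => βhat n ψ z) z}) atTop (𝓝 (1 - α)) := by
  obtain ⟨c, C, r, hc, hcC, hr, hmom, hmomr, hvarA, hvarε⟩ := hmoment
  obtain ⟨hq0, hqα⟩ := hq.gaussianReal_Icc hα
  have h4 : ∀ n, Integrable (fun y => resid g (m n) (Q n).ψ₀ (Q n).β₀ y ^ 4) (Q n).law ∧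
      ∫ y, resid g (m n) (Q n).ψ₀ (Q n).β₀ y ^ 4 ∂(Q n).law ≤ 1 + C :=
    fun n => integrable_pow_four_of_rpow (measurable_resid (hm_meas n) _ _) hr (hmomr n).1
      (hmomr n).2.le
  have hU0 : ∀ n, ∫ y, score g (m n) (Q n).ψ₀ (Q n).γ₀ (Q n).β₀ y ∂(Q n).law = 0 := fun n =>
    integral_score_eq_zero (hm_meas n) (hbin n) (hunion n)
      ((memLp_four_of_integrable_pow (measurable_resid (hm_meas n) _ _).aestronglyMeasurable
        (h4 n).1).integrable (by norm_num))
  have hR := isLittleOP_sqrt_mul_score_sub hm_meas hm_lin hlamβ hlamβ_rate hbin hunion hγhat hβhat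
    (fun n => (h4 n).1) hc (hc.trans hcC).le hmom hvarA hconc hest hpred hsparse
  have hvar := isLittleOP_sampleVar_score_sub hm_meas hbin h4 hU0 hR hpred hsparse
  obtain ⟨b, hb0, hvb⟩ := exists_pos_eventually_le_integral_score_sq hm_meas hbin
    (fun n => (h4 n).1) hc hvarA hvarε
  set U : ∀ n, Obs (p n) → ℝ := fun n => score g (m n) (Q n).ψ₀ (Q n).γ₀ (Q n).β₀ with hU
  set Uhat : ∀ n, (Fin n → Obs (p n)) → Fin n → ℝ := fun n z i =>
    score g (m n) (Q n).ψ₀ (γhat n (fun i => design (z i))) (βhat n (Q n).ψ₀ z) (z i) with hUhat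
  set v : ℕ → ℝ := fun n => ∫ y, U n y ^ 2 ∂(Q n).law with hv
  have hUm : ∀ n, Measurable (U n) := fun n => measurable_score (hm_meas n) _ _ _
  have hU4 : ∀ n, Integrable (fun y => U n y ^ 4) (Q n).law ∧ ∫ y, U n y ^ 4 ∂(Q n).law ≤ 1 + C :=
    fun n => ⟨(integrable_score_pow_four (hm_meas n) (hbin n) (h4 n).1).1,
      (integrable_score_pow_four (hm_meas n) (hbin n) (h4 n).1).2.trans (h4 n).2⟩
  set S : ∀ n, (Fin n → Obs (p n)) → ℝ := fun n z => (√(n : ℝ))⁻¹ * ∑ i, U n (z i) / √(v n) with hS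
  have hSn : ∀ n z, S n z = √(n : ℝ) * sampleMean (fun i => U n (z i)) / √(v n) := by
    intro n z
    simp only [hS, sampleMean, ← Finset.sum_div]
    rcases Nat.eq_zero_or_pos n with rfl | hn
    · simp
    · have hn' : (0 : ℝ) < n := by exact_mod_cast hn
      have h2 := Real.mul_self_sqrt hn'.le
      have h3 : √(n : ℝ) ≠ 0 := by positivity
      have h5 : (√(n : ℝ))⁻¹ = √(n : ℝ) * (1 / n) := by
        field_simp
        linarith
      rw [h5]; ring
  have hSlim : ∀ u : ℝ, Tendsto (fun n => ((Q n).sample n).real {z | |S n z| ≤ u}) atTop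
      (𝓝 ((gaussianReal 0 1).real (Set.Icc (-u) u))) := by
    intro u
    have hfr : gaussianReal 0 1 (frontier (Set.Icc (-u) u)) = 0 := by
      have := nullSingletonClass_gaussianReal (μ := 0) (v := 1) one_ne_zero
      rcases le_or_gt (-u) u with hu | hu
      · rw [frontier_Icc hu]
        exact (Set.toFinite _).measure_zero _
      · rw [Set.Icc_eq_empty (not_le.2 hu)]; simp
    have hclt := tendsto_map_inv_sqrt_mul_sum_gaussian (μ := fun n => (Q n).law)
      (X := fun n y => U n y / √(v n)) (fun n => (hUm n).div_const _) (K := (1 + C) / b ^ 2)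
      (by
        filter_upwards [hvb] with n hn
        have hvn : 0 < v n := hb0.trans_le hn
        have h2 : √(v n) ^ 2 = v n := Real.sq_sqrt hvn.le
        have h4' : √(v n) ^ 4 = v n ^ 2 := by
          rw [show √(v n) ^ 4 = (√(v n) ^ 2) ^ 2 by ring, h2]
        simp only [div_pow, integral_div, h2, h4']
        refine ⟨(hU4 n).1.div_const _, by rw [hU0, zero_div], div_self hvn.ne', ?_⟩
        have := (hU4 n).2
        have hC : 0 < C := hc.trans hcC
        gcongr) hfr
    have hcl2 := (ENNReal.tendsto_toReal (measure_ne_top _ _)).comp hclt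
    refine hcl2.congr fun n => ?_
    have hSm : Measurable (S n) := (Finset.measurable_fun_sum _ fun i _ =>
      ((hUm n).div_const _).comp (measurable_pi_apply i)).const_mul _
    have hpre : {z | |S n z| ≤ u} = S n ⁻¹' Set.Icc (-u) u := by
      ext z
      simp only [Set.mem_ofPred_eq, Set.mem_preimage, Set.mem_Icc, abs_le]
    rw [hpre, measureReal_def, Function.comp_apply, ← Measure.map_apply hSm measurableSet_Icc]
    rfl
  have hT : IsLittleOP (fun n => (Q n).sample n)
      (fun n z => √(n : ℝ) * sampleMean (Uhat n z) / √(v n) - S n z) := by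
    refine (hR.const_mul (√b)⁻¹).mono' ?_
    filter_upwards [hvb] with n hn z
    have hvn : 0 < v n := hb0.trans_le hn
    rw [hSn, ← sub_div, ← mul_sub, abs_div, abs_of_pos (Real.sqrt_pos.2 hvn), abs_mul (√b)⁻¹,
      abs_of_pos (inv_pos.2 (Real.sqrt_pos.2 hb0)), div_eq_inv_mul]
    have hbpos := Real.sqrt_pos.2 hb0
    have := Real.sqrt_le_sqrt hn
    gcongr
  have hW : IsLittleOP (fun n => (Q n).sample n)
      (fun n z => sampleVar (Uhat n z) / v n - 1) := by
    refine (hvar.const_mul b⁻¹).mono' ?_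
    filter_upwards [hvb] with n hn z
    have hvn : 0 < v n := hb0.trans_le hn
    rw [div_sub_one hvn.ne', abs_div, abs_of_pos hvn, abs_mul, abs_of_pos (inv_pos.2 hb0),
      div_eq_inv_mul]
    gcongr
  have hfin := tendsto_measure_sq_le_mul hSlim hT hW hq0
  rw [hqα] at hfin
  refine hfin.congr' ?_
  filter_upwards [hvb, eventually_gt_atTop 0] with n hn hn0
  have hvn : 0 < v n := hb0.trans_le hn
  have hn' : (0 : ℝ) < n := by exact_mod_cast hn0
  congr 1
  ext z
  simp only [Set.mem_ofPred_eq, confSet]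
  change _ ↔ sampleMean (Uhat n z) ^ 2 - q / n * sampleVar (Uhat n z) ≤ 0
  rw [div_pow, mul_pow, Real.sq_sqrt hn'.le, Real.sq_sqrt hvn.le, ← mul_div_assoc,
    div_le_div_iff_of_pos_right hvn, sub_nonpos, div_mul_eq_mul_div, le_div_iff₀ hn', mul_comm]

end Coverage

end UDR

/-! ### Uniformity over the classes of laws -/

/-- Uniform double robustness of the score-test confidence set with a linear outcome model. -/
theorem corollary1
    (p : ℕ → ℕ) (g : UDR.Link)
    -- outcome working model, linear in `β`
    (m : ∀ n, (Fin (p n) → ℝ) → (Fin (p n) → ℝ) → ℝ)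
    (hm_meas : ∀ n β, Measurable (fun l => m n l β))
    (hm_lin : ∀ n l, IsLinearMap ℝ (m n l))
    -- nominal level and critical value
    (α q : ℝ) (hα : α ∈ Set.Ioo (0 : ℝ) 1) (hq : UDR.IsCriticalValue α q)
    -- penalty parameters
    (lamγ lamβ : ℕ → ℝ) (hlamγ : ∀ n, 0 < lamγ n) (hlamβ : ∀ n, 0 < lamβ n)
    (hlamγ_rate : lamγ =O[atTop] (fun n => Real.sqrt (UDR.logDim p n / n)))
    (hlamβ_rate : lamβ =O[atTop] (fun n => Real.sqrt (UDR.logDim p n / n)))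
    -- for each `n`, a class of laws obeying the union model
    (Laws : ∀ n, Set (UDR.DGP (p n))) (hLaws : ∀ n, (Laws n).Nonempty)
    (hbinary : ∀ n, ∀ Q ∈ Laws n, UDR.BinaryExposure Q)
    (hunion : ∀ n, ∀ Q ∈ Laws n, UDR.UnionModel g (m n) Q)
    (hpop : ∀ n, ∀ Q ∈ Laws n, UDR.PopulationBeta g (m n) Q)
    -- the estimators
    (γhat : ∀ n, (Fin n → ℝ × (Fin (p n) → ℝ)) → Fin (p n) → ℝ)
    (hγhat_meas : ∀ n, Measurable (γhat n))
    (hγhat : ∀ n x, (∀ i, (x i).1 = 0 ∨ (x i).1 = 1) →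
      UDR.IsLassoEstimate (lamγ n) x (γhat n x))
    (βhat : ∀ n, ℝ → (Fin n → UDR.Obs (p n)) → Fin (p n) → ℝ)
    (hβhat_meas : ∀ n ψ, Measurable (βhat n ψ))
    (hβhat : ∀ n, ∀ Q ∈ Laws n, ∀ ψ, ∀ᵐ z ∂(Q.sample n),
      UDR.IsBridgeEstimate g (m n) (lamβ n) ψ
        (γhat n (fun i => (UDR.exposure (z i), UDR.covar (z i)))) z (βhat n ψ z))
    -- the assumptions, along every sequence of laws in the classes
    (hmoment : ∀ Q : ∀ n, UDR.DGP (p n), (∀ n, Q n ∈ Laws n) → UDR.MomentConditions g m Q)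
    (hconc : ∀ Q : ∀ n, UDR.DGP (p n), (∀ n, Q n ∈ Laws n) → UDR.ConcentrationBound m Q)
    (hest : ∀ Q : ∀ n, UDR.DGP (p n), (∀ n, Q n ∈ Laws n) → UDR.EstimationRates γhat βhat Q)
    (hpred : ∀ Q : ∀ n, UDR.DGP (p n), (∀ n, Q n ∈ Laws n) → UDR.PredictionRates m γhat βhat Q)
    (hsparse : ∀ Q : ∀ n, UDR.DGP (p n), (∀ n, Q n ∈ Laws n) → UDR.UltraSparse Q) :
    Tendsto (fun n => ⨆ Q : Laws n,
      |((Q : UDR.DGP (p n)).sample n).real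
          {z | (Q : UDR.DGP (p n)).ψ₀ ∈ UDR.confSet g (m n) q
            (γhat n (fun i => (UDR.exposure (z i), UDR.covar (z i))))
            (fun ψ => βhat n ψ z) z}
        - (1 - α)|) atTop (𝓝 0) := by
  -- a sequence of laws that nearly attain the suprema
  have hnear : ∀ n, ∃ Q : Laws n, (⨆ Q : Laws n,
      |((Q : UDR.DGP (p n)).sample n).real
          {z | (Q : UDR.DGP (p n)).ψ₀ ∈ UDR.confSet g (m n) q
            (γhat n (fun i => (UDR.exposure (z i), UDR.covar (z i))))
            (fun ψ => βhat n ψ z) z}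
        - (1 - α)|) - 1 / ((n : ℝ) + 1) <
      |((Q : UDR.DGP (p n)).sample n).real
          {z | (Q : UDR.DGP (p n)).ψ₀ ∈ UDR.confSet g (m n) q
            (γhat n (fun i => (UDR.exposure (z i), UDR.covar (z i))))
            (fun ψ => βhat n ψ z) z}
        - (1 - α)| := by
    intro n
    have : Nonempty (Laws n) := (hLaws n).to_subtype
    exact exists_lt_of_lt_ciSup (sub_lt_self _ (by positivity))
  choose Q hQ using hnear
  have hmem : ∀ n, (Q n : UDR.DGP (p n)) ∈ Laws n := fun n => (Q n).2
  have hcov := UDR.tendsto_coverage (Q := fun n => (Q n : UDR.DGP (p n))) hm_meas hm_lin hα hq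
    hlamβ hlamβ_rate (fun n => hbinary n _ (hmem n)) (fun n => hunion n _ (hmem n)) hγhat_meas
    (fun n => hβhat n _ (hmem n) _) (hmoment _ hmem) (hconc _ hmem) (hest _ hmem) (hpred _ hmem)
    (hsparse _ hmem)
  have hlim : Tendsto (fun n : ℕ => |((Q n : UDR.DGP (p n)).sample n).real
      {z | (Q n : UDR.DGP (p n)).ψ₀ ∈ UDR.confSet g (m n) q
        (γhat n (fun i => (UDR.exposure (z i), UDR.covar (z i)))) (fun ψ => βhat n ψ z) z}
      - (1 - α)| + 1 / ((n : ℝ) + 1)) atTop (𝓝 0) := by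
    have := (hcov.sub_const (1 - α)).abs.add tendsto_one_div_add_atTop_nhds_zero_nat
    simpa using this
  refine squeeze_zero (fun n => Real.iSup_nonneg fun Q => abs_nonneg _) (fun n => ?_) hlim
  linarith [hQ n]
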